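/- **Setting.** Let $\Lambda$ be a finite set of qubits and $H=\sum_{\gamma\in\Gamma}H_\gamma$ a finite sum of Hermitian terms with $\|H_\gamma\|\le 1$, $H_\gamma$ acting on a set $\mathrm{Supp}(\gamma)\subset\Lambda$. Write $S\sim S'$ if $S\cap S'\neq\emptyset$ (and $\gamma$ for $\mathrm{Supp}(\gamma)$). The interaction degree is at most $d\ge 1$ if every $\gamma$ satisfies $|\{\gamma':\gamma'\sim\gamma\}|\le d$ ($\gamma$ itself counted). For $S,S'\subset\Lambda$ let $\mathrm{dist}(S,S')$ be the least $k\ge 0$ such that $S\sim\gamma_1\sim\dots\sim\gamma_k\sim S'$ for some terms ($k=0$ means $S\sim S'$; $\infty$ if there is no such path). For a region $A\subset\Lambda$ and an integer $\ell\ge 0$ let $H_\ell=\sum_{\gamma:\,\mathrm{dist}(\gamma,A)<\ell-1}H_\gamma$. Let $\rho_\beta=e^{-\beta H}/\mathrm{Tr}\,e^{-\beta H}$, $\beta>0$, and $\rho_{\beta,-A}=\mathrm{Tr}_A[\rho_\beta]\otimes\tau_A$ with $\tau_A$ maximally mixed. With $\sigma=1/\beta$, $f(t)=e^{-\sigma^2t^2}\sqrt{\sigma\sqrt{2/\pi}}$,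 $\gamma(\omega)=\exp(-\beta\max(\omega+\beta\sigma^2/2,0))$ and a self-adjoint jump operator $V$, put $\hat V(\omega)=\frac1{\sqrt{2\pi}}\int e^{iHt}Ve^{-iHt}e^{-i\omega t}f(t)\,dt$, $N_V=\int\gamma(\omega)\hat V(\omega)^\dagger\hat V(\omega)\,d\omega$, and $$\mathcal L_V[X]=-i[B_V,X]+\int_{-\infty}^{\infty}\gamma(\omega)\Big(\hat V(\omega)X\hat V(\omega)^\dagger-\tfrac12\{\hat V(\omega)^\dagger\hat V(\omega),X\}\Big)d\omega,$$ $$B_V=\sum_{E_1,E_2\in\mathrm{spec}(H)}\tfrac{i}{2}\tanh\!\big(\tfrac{\beta(E_2-E_1)}{4}\big)P_{E_2}N_VP_{E_1},$$ where $P_E$ are the spectral projectors of $H$; $B_V$ is the coherent term of the exactly (KMS) detailed-balanced Lindbladian. Let $\mathcal L_A=\sum_V\mathcal L_V$ over the $3|A|$ single-qubit Paulis $V\in\{X_i,Y_i,Z_i\}_{i\in A}$, and $\mathcal R_{A,t}=\frac1t\int_0^te^{s\mathcal L_A}ds$ for $t>0$. Let $\mathcal R_{A,t,\ell}$ be the same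 map built from $H_\ell$ in place of $H$ (same $\beta$, $A$, $t$). $\|\cdot\|_1$ is the trace norm and $\|\cdot\|_{1-1}$ the superoperator norm it induces. For $\beta>0$ and $d\ge1$, say that $(r,\mu,\lambda)$ satisfies (R) if for every system as above with interaction degree at most $d$, every region $A$ and every $t>0$, $$\|\mathcal R_{A,t}[\rho_{\beta,-A}]-\rho_\beta\|_1\le r\,e^{\mu|A|}\,t^{-\lambda}.\tag{R}$$ **Corollary (Quasi-locality estimates).** There are absolute constants $c'>0$ and $C>0$ such that for all $\beta>0$ and integers $d\ge1$: 1. For every system with interaction degree at most $d$, every region $A$, every $t>0$ and every integer $\ell\ge0$, the map $\mathcal R_{A,t,\ell}$ is strictly local: it is of the form $\Psi\otimes\mathrm{id}$ with $\Psi$ acting on the qubits at distance at most $\ell$ from $A$. Moreover $$\|\mathcal R_{A,t,\ell}-\mathcal R_{A,t}\|_{1-1}\le C\,|A|\,t\,\big(e^{-c'\ell/(d\beta)}+2^{-\ell}\big).$$ 2. There are numbers $r\ge1$, $\mu>0$, $0<\lambda<1$, depending only on $\beta$ and $d$, that satisfy (R). For any such $r,\mu,\lambda$, set $m=\min(\ln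 2,\,c'/(d\beta))$, $\mu'=\mu+2$ and $t^*=t^*(\ell)=\exp\big(\frac{\mu|A|+m\ell}{\lambda+1}\big)$. Then for every system with interaction degree at most $d$, every region $A$ and every integer $\ell\ge0$, $$\|\rho_\beta-\mathcal R_{A,t^*,\ell}[\rho_{\beta,-A}]\|_1\le C\,r\,\exp\Big(\frac{\mu'|A|-m\lambda\ell}{2}\Big).$$ -/

import Mathlib

open scoped Matrix Matrix.Norms.L2Operator ENNReal

noncomputable section

namespace QGibbs

/-! ### Qubits, supports, norms -/

/-- Operators on the Hilbert space `(ℂ²)^{⊗Λ}` of qubits labelled by `Λ`, in the computational basis.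
The norm `‖·‖` on them is the operator norm (the scope `Matrix.Norms.L2Operator` is open). -/
abbrev Op (Λ : Type) := Matrix (Λ → Fin 2) (Λ → Fin 2) ℂ

/-- Superoperators. -/
abbrev SuperOp (Λ : Type) [Fintype Λ] [DecidableEq Λ] := Op Λ →L[ℂ] Op Λ

/-- The configuration equal to `u` on `S` and to `x` off `S`. -/
def glue {Λ : Type} [DecidableEq Λ] (S : Finset Λ) (u : S → Fin 2) (x : Λ → Fin 2) : Λ → Fin 2 :=
  fun i => if h : i ∈ S then u ⟨i, h⟩ else x i

/-- `O` acts nontrivially only on `S`: `O = K ⊗ 1` for an operator `K` on the qubits of `S`. -/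
def ActsOn {Λ : Type} [Fintype Λ] [DecidableEq Λ] (S : Finset Λ) (O : Op Λ) : Prop :=
  ∃ K : Matrix (S → Fin 2) (S → Fin 2) ℂ, ∀ x y : Λ → Fin 2,
    O x y = if ∀ i, i ∉ S → x i = y i then K (fun i => x i) (fun i => y i) else 0

/-- The superoperator `Φ` is strictly local on `S`: `Φ = Ψ ⊗ id` for a superoperator `Ψ` on the
qubits of `S`. -/
def SuperActsOn {Λ : Type} [Fintype Λ] [DecidableEq Λ] (S : Finset Λ) (Φ : SuperOp Λ) : Prop :=
  ∃ Ψ : Matrix (S → Fin 2) (S → Fin 2) ℂ →ₗ[ℂ] Matrix (S → Fin 2) (S → Fin 2) ℂ,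
    ∀ (O : Op Λ) (x y : Λ → Fin 2),
      Φ O x y =
        Ψ (Matrix.of fun u v => O (glue S u x) (glue S v y)) (fun i => x i) (fun i => y i)

/-- The trace norm `‖O‖₁ = Tr |O|`: the sum of the square roots of the eigenvalues of `O†O`. -/
def traceNorm {Λ : Type} [Fintype Λ] [DecidableEq Λ] (O : Op Λ) : ℝ :=
  ∑ x, Real.sqrt ((Matrix.isHermitian_conjTranspose_mul_self O).eigenvalues x)

/-- The induced norm `‖Φ‖_{1-1} = sup_{O ≠ 0} ‖Φ[O]‖₁ / ‖O‖₁`. -/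
def superNormOne {Λ : Type} [Fintype Λ] [DecidableEq Λ] (Φ : SuperOp Λ) : ℝ≥0∞ :=
  ⨆ (O : Op Λ) (_ : O ≠ 0), ENNReal.ofReal (traceNorm (Φ O) / traceNorm O)

/-- The three Pauli matrices `X`, `Y`, `Z`. -/
def pauli : Fin 3 → Matrix (Fin 2) (Fin 2) ℂ :=
  ![!![0, 1; 1, 0], !![0, -Complex.I; Complex.I, 0], !![1, 0; 0, -1]]

/-- The single-qubit matrix `M` acting on qubit `i`. -/
def siteOp {Λ : Type} [Fintype Λ] [DecidableEq Λ] (i : Λ) (M : Matrix (Fin 2) (Fin 2) ℂ) : Op Λ :=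
  Matrix.of fun x y => if ∀ j, j ≠ i → x j = y j then M (x i) (y i) else 0

/-- `Tr_A[ρ] ⊗ τ_A`, with `τ_A` the maximally mixed state on the qubits of `A`. -/
def resetRegion {Λ : Type} [Fintype Λ] [DecidableEq Λ] (A : Finset Λ) (ρ : Op Λ) : Op Λ :=
  Matrix.of fun x y =>
    if ∀ i ∈ A, x i = y i then
      ((2 : ℂ) ^ A.card)⁻¹ * ∑ u : A → Fin 2, ρ (glue A u x) (glue A u y)
    else 0

/-! ### Local Hamiltonians and the interaction graph -/

/-- A family of Hermitian interaction terms of operator norm at most one, indexed by `Γ`, together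
with the sets of qubits on which they act. -/
structure LocalHamiltonian (Λ Γ : Type) [Fintype Λ] [DecidableEq Λ] [Fintype Γ] where
  term : Γ → Op Λ
  supp : Γ → Finset Λ
  isHermitian : ∀ γ, (term γ).IsHermitian
  actsOn : ∀ γ, ActsOn (supp γ) (term γ)
  norm_le_one : ∀ γ, ‖term γ‖ ≤ 1

namespace LocalHamiltonian

variable {Λ Γ : Type} [Fintype Λ] [DecidableEq Λ] [Fintype Γ]

/-- The interaction graph has degree at most `d`; a term with nonempty support is adjacent to
itself. -/
def DegreeLE (I : LocalHamiltonian Λ Γ) (d : ℕ) : Prop :=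
  ∀ γ : Γ, (Finset.univ.filter fun γ' : Γ => (I.supp γ ∩ I.supp γ').Nonempty).card ≤ d

/-- `A` and `B` are joined by a path `A ∼ γ₁ ∼ ⋯ ∼ γ_k ∼ B` through `k` interaction terms, where
`∼` means that the sets of qubits overlap. -/
def Joined (I : LocalHamiltonian Λ Γ) : ℕ → Finset Λ → Finset Λ → Prop
  | 0, A, B => (A ∩ B).Nonempty
  | k + 1, A, B => ∃ γ : Γ, (A ∩ I.supp γ).Nonempty ∧ I.Joined k (I.supp γ) B

/-- The least `k` such that `A` and `B` are joined by a path through `k` terms, or `∞`. -/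
def dist (I : LocalHamiltonian Λ Γ) (A B : Finset Λ) : ℕ∞ :=
  ⨅ (k : ℕ) (_ : I.Joined k A B), (k : ℕ∞)

open Classical in
/-- The qubits at distance at most `ℓ` from `A`. -/
def neighborhood (I : LocalHamiltonian Λ Γ) (A : Finset Λ) (ℓ : ℕ) : Finset Λ :=
  Finset.univ.filter fun i : Λ => I.dist {i} A ≤ (ℓ : ℕ∞)

/-- The Hamiltonian `H = ∑_γ H_γ`. -/
def ham (I : LocalHamiltonian Λ Γ) : Op Λ := ∑ γ, I.term γ

open Classical in
/-- The patch `H_ℓ`: the sum of the terms with `dist(γ, A) < ℓ - 1`. -/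
def patch (I : LocalHamiltonian Λ Γ) (A : Finset Λ) (ℓ : ℕ) : Op Λ :=
  ∑ γ with I.dist (I.supp γ) A + 1 < (ℓ : ℕ∞), I.term γ

theorem ham_isHermitian (I : LocalHamiltonian Λ Γ) : I.ham.IsHermitian := by
  unfold ham Matrix.IsHermitian
  rw [Matrix.conjTranspose_sum]
  exact Finset.sum_congr rfl fun γ _ => I.isHermitian γ

theorem patch_isHermitian (I : LocalHamiltonian Λ Γ) (A : Finset Λ) (ℓ : ℕ) :
    (I.patch A ℓ).IsHermitian := by
  unfold patch Matrix.IsHermitian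
  rw [Matrix.conjTranspose_sum]
  exact Finset.sum_congr rfl fun γ _ => I.isHermitian γ

end LocalHamiltonian

/-! ### The Gibbs state and the detailed-balanced Lindbladian -/

section Lindbladian

variable {Λ : Type} [Fintype Λ] [DecidableEq Λ]

/-- The Gibbs state `e^{-βH} / Tr e^{-βH}`. -/
def gibbs (H : Op Λ) (β : ℝ) : Op Λ :=
  (NormedSpace.exp (-(β : ℂ) • H)).trace⁻¹ • NormedSpace.exp (-(β : ℂ) • H)

/-- The Heisenberg evolution `e^{iHt} A e^{-iHt}`. -/
def heisenberg (H A : Op Λ) (t : ℝ) : Op Λ :=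
  NormedSpace.exp ((Complex.I * (t : ℂ)) • H) * A * NormedSpace.exp ((-(Complex.I * (t : ℂ))) • H)

/-- The Gaussian filter `f(t) = e^{-σ²t²} √(σ √(2/π))`. -/
def gaussFilter (σ t : ℝ) : ℝ :=
  Real.exp (-(σ ^ 2 * t ^ 2)) * Real.sqrt (σ * Real.sqrt (2 / Real.pi))

/-- The operator Fourier transform
`Â(ω) = (2π)^{-1/2} ∫ e^{iHt} A e^{-iHt} e^{-iωt} f(t) dt`. -/
def opFourier (H : Op Λ) (σ : ℝ) (A : Op Λ) (ω : ℝ) : Op Λ :=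
  ((Real.sqrt (2 * Real.pi) : ℂ))⁻¹ •
    ∫ t : ℝ, (Complex.exp (-(Complex.I * (ω : ℂ) * (t : ℂ))) * (gaussFilter σ t : ℂ)) •
      heisenberg H A t

/-- The Metropolis weight `γ(ω) = exp(-β max(ω + βσ²/2, 0))`. -/
def metropolis (β σ ω : ℝ) : ℝ :=
  Real.exp (-(β * max (ω + β * σ ^ 2 / 2) 0))

/-- The superoperator `X ↦ ½ {M, X}`. -/
def halfAnticomm (M : Op Λ) : SuperOp Λ :=
  (1 / 2 : ℂ) •
    (ContinuousLinearMap.mul ℂ (Op Λ) M + (ContinuousLinearMap.mul ℂ (Op Λ)).flip M)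

/-- The superoperator `X ↦ -i [B, X]`. -/
def unitaryGenerator (B : Op Λ) : SuperOp Λ :=
  (-Complex.I) •
    (ContinuousLinearMap.mul ℂ (Op Λ) B - (ContinuousLinearMap.mul ℂ (Op Λ)).flip B)

/-- The dissipative part
`X ↦ ∫ γ(ω) (Â(ω) X Â(ω)† - ½ {Â(ω)† Â(ω), X}) dω`. -/
def dissipator (H : Op Λ) (β σ : ℝ) (A : Op Λ) : SuperOp Λ :=
  ∫ ω : ℝ, (metropolis β σ ω : ℂ) •
    (ContinuousLinearMap.mulLeftRight ℂ (Op Λ) (opFourier H σ A ω) (opFourier H σ A ω)ᴴ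
      - halfAnticomm ((opFourier H σ A ω)ᴴ * opFourier H σ A ω))

/-- The decay operator `N = ∫ γ(ω) Â(ω)† Â(ω) dω`. -/
def decayOp (H : Op Λ) (β σ : ℝ) (A : Op Λ) : Op Λ :=
  ∫ ω : ℝ, (metropolis β σ ω : ℂ) • ((opFourier H σ A ω)ᴴ * opFourier H σ A ω)

/-- The finite set of energies (eigenvalues) of `H`. -/
def energies {H : Op Λ} (hH : H.IsHermitian) : Finset ℝ :=
  Finset.univ.image hH.eigenvalues

/-- The eigenspace projector `P_E = ∑_{i : E_i = E} |ψ_i⟩⟨ψ_i|`. -/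
def energyProj {H : Op Λ} (hH : H.IsHermitian) (E : ℝ) : Op Λ :=
  ∑ i with hH.eigenvalues i = E,
    Matrix.vecMulVec (⇑(hH.eigenvectorBasis i)) (star (⇑(hH.eigenvectorBasis i)))

/-- The coherent term: its Bohr-frequency-`ν` component is `(i/2) tanh(βν/4)` times that of the
decay operator `N`, i.e. `B = ∑_{E₁,E₂} (i/2) tanh(β(E₂ - E₁)/4) P_{E₂} N P_{E₁}`. In terms of the
eigenoperators `A_ν`, with `N = ∑ α_{ν₁,ν₂} A_{ν₂}† A_{ν₁}`, this is
`B = ∑_{ν₁,ν₂} (2i)⁻¹ tanh(-β(ν₁ - ν₂)/4) α_{ν₁,ν₂} A_{ν₂}† A_{ν₁}`. -/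
def coherentTerm {H : Op Λ} (hH : H.IsHermitian) (β σ : ℝ) (A : Op Λ) : Op Λ :=
  ∑ E₁ ∈ energies hH, ∑ E₂ ∈ energies hH,
    (Complex.I / 2 * (Real.tanh (β * (E₂ - E₁) / 4) : ℂ)) •
      (energyProj hH E₂ * decayOp H β σ A * energyProj hH E₁)

/-- The Lindbladian with a single self-adjoint jump operator `A`. -/
def jumpLindbladian {H : Op Λ} (hH : H.IsHermitian) (β σ : ℝ) (A : Op Λ) : SuperOp Λ :=
  unitaryGenerator (coherentTerm hH β σ A) + dissipator H β σ A

/-- `𝓛_A = ∑_{a ∈ P_A¹} 𝓛_a`, the sum over the single-qubit Paulis on `A`, with `σ = 1/β`. -/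
def regionLindbladian {H : Op Λ} (hH : H.IsHermitian) (β : ℝ) (A : Finset Λ) : SuperOp Λ :=
  ∑ i ∈ A, ∑ a : Fin 3, jumpLindbladian hH β (1 / β) (siteOp i (pauli a))

/-- The time-averaged dynamics `(1/t) ∫₀ᵗ exp(s 𝓛_A) ds` for the Hamiltonian `H`. -/
def timeAverage {H : Op Λ} (hH : H.IsHermitian) (β : ℝ) (A : Finset Λ) (t : ℝ) : SuperOp Λ :=
  ((1 / t : ℝ) : ℂ) •
    ∫ s in (0 : ℝ)..t, NormedSpace.exp ((s : ℂ) • regionLindbladian hH β A)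

end Lindbladian

namespace LocalHamiltonian

variable {Λ Γ : Type} [Fintype Λ] [DecidableEq Λ] [Fintype Γ]

/-- The map `R_{A,t}`. -/
def recovery (I : LocalHamiltonian Λ Γ) (β : ℝ) (A : Finset Λ) (t : ℝ) : SuperOp Λ :=
  timeAverage I.ham_isHermitian β A t

/-- The map `R_{A,t,ℓ}`: the same construction from the patch `H_ℓ` instead of `H`. -/
def localRecovery (I : LocalHamiltonian Λ Γ) (β : ℝ) (A : Finset Λ) (t : ℝ) (ℓ : ℕ) : SuperOp Λ :=
  timeAverage (I.patch_isHermitian A ℓ) β A t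

end LocalHamiltonian

/-- The global recovery estimate `‖R_{A,t}[ρ_{β,-A}] - ρ_β‖₁ ≤ r e^{μ|A|} t^{-λ}`, for all systems
of interaction degree at most `d`, all regions `A` and all times `t > 0`. -/
def RecoveryBound (β : ℝ) (d : ℕ) (r μ lam : ℝ) : Prop :=
  ∀ (Λ Γ : Type) [Fintype Λ] [DecidableEq Λ] [Fintype Γ] (I : LocalHamiltonian Λ Γ),
    I.DegreeLE d → ∀ (A : Finset Λ) (t : ℝ), 0 < t →
      traceNorm (I.recovery β A t (resetRegion A (gibbs I.ham β)) - gibbs I.ham β)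
        ≤ r * Real.exp (μ * A.card) * t ^ (-lam)

end QGibbs

end

/-!
Trace-norm estimates for states become operator-norm estimates for observables: `superDual` passes
to the Heisenberg picture, and `traceNorm_le_of_forall` and `superNormOne_le` express both trace
norms through it. In the time unit `β`, with `K = βH`, the dual of the Lindbladian of a jump `V` is
`X ↦ ∫ γ(ω) V(ω)† X V(ω) dω - G X - X G†` (`jumpDual`, `superDual_jumpLindbladian`). Here
`G = N/2 - iB` combines decay and coherent term, and `tanh` disappears from it: the component of Bohr frequency
`ν` of `G` is `e^{ν/4} / (2 cosh (ν/4))` times that of `N`. The dual generator `𝓛*`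
annihilates the identity, and `1 + ε 𝓛*` is completely positive up to `O(ε²)`, so it is dissipative
(`dissipative_jumpDual`), and its exponentials and their time averages are contractions
(`norm_avgExp_le`).

*Locality.* The superoperators acting on a fixed region form a subalgebra, closed because the
dimension is finite, so they are stable under the integrals and exponentials that build the recovery
map from the patch Hamiltonian (`superActsOn_localRecovery`). For the error, a Lieb–Robinson bound
in the interaction picture (`norm_evolve_patch_sub_le`) compares the Heisenberg evolutions of a
single-qubit Pauli under the two Hamiltonians. The difference is small up to a factor `e^{|s|}` in
the time `s`, which the Gaussian filter absorbs. The operator `G` is an average, with the rapidly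
decaying kernel `1 / cosh (2πt)`, of products of Fourier components in Gaussian windows translated
by complex times (`effOp_eq_integral`). Plancherel's identity and the Cauchy–Schwarz inequality then
bound the difference of the generators (`norm_jumpDual_sub_le`), and Duhamel's formula that of the
recovery maps (`norm_superDual_localRecovery_sub_le`).

*Recovery.* In the inner product `tr (Y† ρ^{1/2} X ρ^{1/2})` the dual generator is symmetric, and
its form is, up to a constant, the integral of the inner products of the commutators of `Y` and `X`
with evolved Fourier components of `V`, against the positive weight `e^{-|ω|/2} / cosh (2πt)`
(`kms_form`). Taking `Y = 1` shows that `ρ` is stationary (`trace_jumpDual_gibbs`). For `X` averaged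
over a time `t` the generator applied to `X` is `O(1/t)`, hence so are these squared commutators
(`dirichlet_avgExp_le`). Single-qubit Paulis stay bounded over a short imaginary time
(`norm_bohr_exp_le`), which makes their components of high Bohr frequency exponentially small.
Truncating at a frequency of order `log t`, below which the weight is at least a small power of
`1/t`, shows that the averaged observable commutes with the Paulis of `A`, in the sense of
expectations in `ρ`, up to an error decaying with a power of `t` (`norm_trace_commutator_le`).
Depolarizing `A` is a composition of averages over conjugations by Paulis (`resetRegion_insert`), so
it hardly changes the expectation of the averaged observable (`norm_trace_resetRegion_sub_le`),
while undisturbed this expectation is that of the original observable. This is `recoveryBound`.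

*Local recovery.* At `t = t*` the recovery error `r e^{μ|A|} t^{-λ}` and the localization error, of
order `|A| t e^{-mℓ}`, have the same exponential size. When its exponent is nonnegative the estimate
is trivial, because both states have trace norm at most one; otherwise `1 / (λ + 1) ≥ 1/2` gives the
claim (`traceNorm_gibbs_sub_localRecovery_le`).
-/

noncomputable section

namespace QGibbs

/-! ### Matrices as operators on Euclidean space -/

section MatrixOperators

open MeasureTheory

variable {n : Type*} [Fintype n] [DecidableEq n]

/-- The action of a matrix on a vector of the Euclidean space `ℂⁿ`. -/
abbrev act (A : Matrix n n ℂ) : EuclideanSpace ℂ n →L[ℂ] EuclideanSpace ℂ n :=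
  Matrix.toEuclideanCLM (n := n) (𝕜 := ℂ) A

theorem norm_act_le (A : Matrix n n ℂ) (v : EuclideanSpace ℂ n) : ‖act A v‖ ≤ ‖A‖ * ‖v‖ :=
  (act A).le_opNorm v

theorem inner_act_conjTranspose (A : Matrix n n ℂ) (u v : EuclideanSpace ℂ n) :
    inner ℂ u (act Aᴴ v) = inner ℂ (act A u) v := by
  rw [act, ← Matrix.star_eq_conjTranspose, map_star, ContinuousLinearMap.star_eq_adjoint,
    ContinuousLinearMap.adjoint_inner_right]

theorem act_mul (A B : Matrix n n ℂ) (v : EuclideanSpace ℂ n) :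
    act (A * B) v = act A (act B v) := by
  simp [act, map_mul]

theorem norm_le_of_inner_unit {A : Matrix n n ℂ} {c : ℝ} (hc : 0 ≤ c)
    (h : ∀ u v : EuclideanSpace ℂ n, ‖u‖ = 1 → ‖v‖ = 1 → ‖inner ℂ u (act A v)‖ ≤ c) : ‖A‖ ≤ c := by
  refine ContinuousLinearMap.opNorm_le_of_unit_norm (f := act A) hc fun v hv => ?_
  by_cases h0 : act A v = 0
  · rw [h0, norm_zero]; exact hc
  have hn : ‖act A v‖ ≠ 0 := by simpa using h0
  have := h (((‖act A v‖⁻¹ : ℝ) : ℂ) • act A v) v (by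
    rw [norm_smul]; simp [hn]) hv
  rw [inner_smul_left, inner_self_eq_norm_sq_to_K] at this
  simpa [hn, pow_two] using this

/-- The linear functional `A ↦ A i j` on matrices. -/
def entryCLM (i j : n) : Matrix n n ℂ →L[ℂ] ℂ :=
  LinearMap.toContinuousLinearMap (Matrix.entryLinearMap ℂ ℂ i j)

/-- The trace as a continuous functional. -/
def traceCLM : Matrix n n ℂ →L[ℂ] ℂ :=
  LinearMap.toContinuousLinearMap (Matrix.traceLinearMap n ℂ ℂ)

/-- The matrix element `⟨u, A v⟩` as a continuous functional of `A`. -/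
def innerCLM (u v : EuclideanSpace ℂ n) : Matrix n n ℂ →L[ℂ] ℂ :=
  LinearMap.toContinuousLinearMap
    { toFun := fun A => inner ℂ u (act A v)
      map_add' := fun A B => by simp [act, map_add]
      map_smul' := fun c A => by simp [act, map_smul] }

variable {α : Type*} [MeasurableSpace α] {μ : Measure α}

theorem integrable_of_entries {F : α → Matrix n n ℂ}
    (h : ∀ i j, Integrable (fun a => F a i j) μ) : Integrable F μ := by
  have : F = fun a => ∑ i, ∑ j, F a i j • Matrix.single i j (1 : ℂ) := by
    funext a
    conv_lhs => rw [Matrix.matrix_eq_sum_single (F a)]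
    simp
  rw [this]
  exact integrable_finsetSum _ fun i _ => integrable_finsetSum _ fun j _ => (h i j).smul_const _

theorem integral_entry {F : α → Matrix n n ℂ} (h : Integrable F μ) (i j : n) :
    (∫ a, F a ∂μ) i j = ∫ a, F a i j ∂μ :=
  ((entryCLM i j).integral_comp_comm h).symm

theorem trace_integral {F : α → Matrix n n ℂ} (h : Integrable F μ) :
    (∫ a, F a ∂μ).trace = ∫ a, (F a).trace ∂μ :=
  (traceCLM.integral_comp_comm h).symm

theorem inner_act_integral {F : α → Matrix n n ℂ} (h : Integrable F μ)
    (u v : EuclideanSpace ℂ n) :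
    inner ℂ u (act (∫ a, F a ∂μ) v) = ∫ a, inner ℂ u (act (F a) v) ∂μ :=
  ((innerCLM u v).integral_comp_comm h).symm

theorem integrable_inner_act {F : α → Matrix n n ℂ} (h : Integrable F μ)
    (u v : EuclideanSpace ℂ n) : Integrable (fun a => inner ℂ u (act (F a) v)) μ :=
  (innerCLM u v).integrable_comp h

theorem integral_mul_left_right {F : α → Matrix n n ℂ} (h : Integrable F μ) (A B : Matrix n n ℂ) :
    A * (∫ a, F a ∂μ) * B = ∫ a, A * F a * B ∂μ :=
  ((ContinuousLinearMap.mulLeftRight ℂ (Matrix n n ℂ) A B).integral_comp_comm h).symm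

theorem conjTranspose_integral (F : α → Matrix n n ℂ) :
    (∫ a, F a ∂μ)ᴴ = ∫ a, (F a)ᴴ ∂μ :=
  ((starL' ℝ : Matrix n n ℂ ≃L[ℝ] Matrix n n ℂ).integral_comp_comm F).symm

/-- Cauchy–Schwarz for nonnegative functions. -/
theorem integral_mul_le_sqrt {f g : α → ℝ} (hf : 0 ≤ f) (hg : 0 ≤ g) {a b : ℝ} (ha : 0 ≤ a)
    (hb : 0 ≤ b) (hfm : AEStronglyMeasurable f μ) (hgm : AEStronglyMeasurable g μ)
    (hfi : Integrable (fun x => f x ^ 2) μ) (hgi : Integrable (fun x => g x ^ 2) μ)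
    (hfa : ∫ x, f x ^ 2 ∂μ ≤ a ^ 2) (hgb : ∫ x, g x ^ 2 ∂μ ≤ b ^ 2) :
    ∫ x, f x * g x ∂μ ≤ a * b := by
  have h2 : ENNReal.ofReal 2 = 2 := by simp
  have := integral_mul_le_Lp_mul_Lq_of_nonneg (μ := μ) Real.HolderConjugate.two_two
    (Filter.Eventually.of_forall hf) (Filter.Eventually.of_forall hg)
    (by rw [h2]; exact (memLp_two_iff_integrable_sq hfm).2 hfi)
    (by rw [h2]; exact (memLp_two_iff_integrable_sq hgm).2 hgi)
  refine this.trans ?_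
  simp only [Real.rpow_two, ← Real.sqrt_eq_rpow]
  gcongr
  · exact Real.sqrt_le_iff.2 ⟨ha, hfa⟩
  · exact Real.sqrt_le_iff.2 ⟨hb, hgb⟩

/-- If `∫ ‖P v‖² ≤ a² ‖v‖²` and `∫ ‖R v‖² ≤ b² ‖v‖²` for all `v`, then
`‖∫ w P† X R‖ ≤ a b ‖X‖` for a weight `0 ≤ w ≤ 1`. -/
theorem norm_integral_sandwich_le {P R : α → Matrix n n ℂ} {w : α → ℝ} {X : Matrix n n ℂ} {a b : ℝ}
    (ha : 0 ≤ a) (hb : 0 ≤ b) (hw0 : ∀ x, 0 ≤ w x) (hw1 : ∀ x, w x ≤ 1)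
    (hP : AEStronglyMeasurable P μ) (hR : AEStronglyMeasurable R μ)
    (hPi : ∀ v, Integrable (fun x => ‖act (P x) v‖ ^ 2) μ)
    (hRi : ∀ v, Integrable (fun x => ‖act (R x) v‖ ^ 2) μ)
    (hPa : ∀ v, ‖v‖ = 1 → ∫ x, ‖act (P x) v‖ ^ 2 ∂μ ≤ a ^ 2)
    (hRb : ∀ v, ‖v‖ = 1 → ∫ x, ‖act (R x) v‖ ^ 2 ∂μ ≤ b ^ 2)
    (hint : Integrable (fun x => (w x : ℂ) • ((P x)ᴴ * X * R x)) μ) :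
    ‖∫ x, (w x : ℂ) • ((P x)ᴴ * X * R x) ∂μ‖ ≤ a * b * ‖X‖ := by
  refine norm_le_of_inner_unit (by positivity) fun u v hu hv => ?_
  rw [inner_act_integral hint]
  have meas : ∀ {Q : α → Matrix n n ℂ} (_ : AEStronglyMeasurable Q μ) (v : EuclideanSpace ℂ n),
      AEStronglyMeasurable (fun x => ‖act (Q x) v‖) μ := fun {Q} hQ v => by
    have hc : Continuous fun A : Matrix n n ℂ => ‖act A v‖ := by
      have : Continuous fun A : Matrix n n ℂ => act A v :=
        LinearMap.continuous_of_finiteDimensional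
          (⟨⟨fun A => act A v, fun A B => by simp [act]⟩, fun c A => by simp [act]⟩ :
            Matrix n n ℂ →ₗ[ℂ] EuclideanSpace ℂ n)
      exact this.norm
    exact hc.comp_aestronglyMeasurable hQ
  have hfg : Integrable (fun x => ‖act (P x) u‖ * ‖act (R x) v‖) μ := by
    refine Integrable.mono' (((hPi u).add (hRi v))) ((meas hP u).mul (meas hR v)) ?_
    refine Filter.Eventually.of_forall fun x => ?_
    simp only [Pi.add_apply]
    rw [Real.norm_of_nonneg (by positivity)]
    nlinarith [sq_nonneg (‖act (P x) u‖ - ‖act (R x) v‖), sq_nonneg ‖act (P x) u‖,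
      sq_nonneg ‖act (R x) v‖]
  have hpt : ∀ x, ‖inner ℂ u (act ((w x : ℂ) • ((P x)ᴴ * X * R x)) v)‖ ≤
      (‖act (P x) u‖ * ‖act (R x) v‖) * ‖X‖ := fun x => by
    have h1 : act ((w x : ℂ) • ((P x)ᴴ * X * R x)) v
        = (w x : ℂ) • act (P x)ᴴ (act X (act (R x) v)) := by
      simp only [act, map_smul, map_mul]; rfl
    rw [h1, inner_smul_right, inner_act_conjTranspose, norm_mul, Complex.norm_real,
      Real.norm_of_nonneg (hw0 x)]
    calc w x * ‖inner ℂ (act (P x) u) (act X (act (R x) v))‖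
        ≤ 1 * (‖act (P x) u‖ * (‖X‖ * ‖act (R x) v‖)) := by
          gcongr
          · exact hw1 x
          · exact (norm_inner_le_norm _ _).trans (by gcongr; exact norm_act_le _ _)
      _ = _ := by ring
  calc ‖∫ x, inner ℂ u (act ((w x : ℂ) • ((P x)ᴴ * X * R x)) v) ∂μ‖
      ≤ ∫ x, (‖act (P x) u‖ * ‖act (R x) v‖) * ‖X‖ ∂μ :=
        norm_integral_le_of_norm_le (hfg.mul_const _) (Filter.Eventually.of_forall hpt)
    _ = (∫ x, ‖act (P x) u‖ * ‖act (R x) v‖ ∂μ) * ‖X‖ := integral_mul_const _ _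
    _ ≤ a * b * ‖X‖ := by
        gcongr
        exact integral_mul_le_sqrt (fun _ => norm_nonneg _) (fun _ => norm_nonneg _) ha hb
          (meas hP u) (meas hR v) (hPi u) (hRi v) (hPa u hu) (hRb v hv)

/-- A completely positive map attains its norm at the identity:
`‖M X M† + ε ∫ w A† X A‖ ≤ ‖X‖ ‖M M† + ε ∫ w A† A‖`. -/
theorem norm_cp_le {P : α → Matrix n n ℂ} {w : α → ℝ} (X M : Matrix n n ℂ) {ε : ℝ} (hε : 0 ≤ ε)
    (hw0 : ∀ x, 0 ≤ w x)
    (hint : ∀ X, Integrable (fun x => (w x : ℂ) • ((P x)ᴴ * X * P x)) μ) :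
    ‖M * X * Mᴴ + (ε : ℂ) • ∫ x, (w x : ℂ) • ((P x)ᴴ * X * P x) ∂μ‖ ≤
      ‖X‖ * ‖M * Mᴴ + (ε : ℂ) • ∫ x, (w x : ℂ) • ((P x)ᴴ * 1 * P x) ∂μ‖ := by
  set Z := M * Mᴴ + (ε : ℂ) • ∫ x, (w x : ℂ) • ((P x)ᴴ * 1 * P x) ∂μ with hZ
  refine norm_le_of_inner_unit (by positivity) fun u v hu hv => ?_
  have h1 : ∀ x X (u v : EuclideanSpace ℂ n), inner ℂ u (act ((w x : ℂ) • ((P x)ᴴ * X * P x)) v)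
      = (w x : ℂ) * inner ℂ (act (P x) u) (act X (act (P x) v)) := fun x X u v => by
    have : act ((w x : ℂ) • ((P x)ᴴ * X * P x)) v
        = (w x : ℂ) • act (P x)ᴴ (act X (act (P x) v)) := by
      simp only [act, map_smul, map_mul]; rfl
    rw [this, inner_smul_right, inner_act_conjTranspose]
  have h2 : ∀ X (u v : EuclideanSpace ℂ n), inner ℂ u (act (M * X * Mᴴ +
      (ε : ℂ) • ∫ x, (w x : ℂ) • ((P x)ᴴ * X * P x) ∂μ) v) =
      inner ℂ (act Mᴴ u) (act X (act Mᴴ v)) +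
      ε * ∫ x, (w x : ℂ) * inner ℂ (act (P x) u) (act X (act (P x) v)) ∂μ := fun X u v => by
    have : act (M * X * Mᴴ + (ε : ℂ) • ∫ x, (w x : ℂ) • ((P x)ᴴ * X * P x) ∂μ) v =
        act Mᴴᴴ (act X (act Mᴴ v)) +
          (ε : ℂ) • act (∫ x, (w x : ℂ) • ((P x)ᴴ * X * P x) ∂μ) v := by
      simp only [act, map_smul, map_mul, map_add, Matrix.conjTranspose_conjTranspose]; rfl
    rw [this, inner_add_right, inner_act_conjTranspose, inner_smul_right,
      inner_act_integral (hint X)]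
    simp only [h1]
  have hself : ∀ p : EuclideanSpace ℂ n, inner ℂ p p = ((‖p‖ ^ 2 : ℝ) : ℂ) := fun p => by
    rw [inner_self_eq_norm_sq_to_K]; norm_cast
  have hsq : ∀ u : EuclideanSpace ℂ n, Integrable (fun x => w x * ‖act (P x) u‖ ^ 2) μ := fun u => by
    have := integrable_inner_act (hint 1) u u
    simp only [h1] at this
    have h3 := this.re
    refine h3.congr (Filter.Eventually.of_forall fun x => ?_)
    have h4 : act (1 : Matrix n n ℂ) (act (P x) u) = act (P x) u := by simp [act]
    simp only [h4, hself, RCLike.re_to_complex, ← Complex.ofReal_mul, Complex.ofReal_re]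
  have hz : ∀ u : EuclideanSpace ℂ n, ‖u‖ = 1 →
      ‖act Mᴴ u‖ ^ 2 + ε * ∫ x, w x * ‖act (P x) u‖ ^ 2 ∂μ ≤ ‖Z‖ := fun u hu => by
    have h5 : inner ℂ u (act Z u) =
        ((‖act Mᴴ u‖ ^ 2 + ε * ∫ x, w x * ‖act (P x) u‖ ^ 2 ∂μ : ℝ) : ℂ) := by
      have := h2 1 u u
      rw [mul_one] at this
      rw [hZ, this]
      have h4 : ∀ v, act (1 : Matrix n n ℂ) v = v := fun v => by simp [act]
      simp only [h4, hself, ← Complex.ofReal_mul]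
      rw [integral_complex_ofReal]
      push_cast; rfl
    have h6 : ‖inner ℂ u (act Z u)‖ ≤ ‖Z‖ := by
      refine (norm_inner_le_norm _ _).trans ?_
      rw [hu, one_mul]
      simpa [hu] using norm_act_le Z u
    rw [h5, Complex.norm_real] at h6
    exact (le_abs_self _).trans h6
  rw [h2]
  have hint2 : Integrable (fun x => w x * ‖act (P x) u‖ ^ 2 + w x * ‖act (P x) v‖ ^ 2) μ :=
    (hsq u).add (hsq v)
  have hamgm : ∀ p q : EuclideanSpace ℂ n, ‖inner ℂ p (act X q)‖ ≤ ‖X‖ / 2 * (‖p‖ ^ 2 + ‖q‖ ^ 2) :=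
    fun p q => by
    refine (norm_inner_le_norm _ _).trans ?_
    have := norm_act_le X q
    have h7 : ‖p‖ * ‖act X q‖ ≤ ‖p‖ * (‖X‖ * ‖q‖) := by gcongr
    nlinarith [mul_nonneg (norm_nonneg X) (sq_nonneg (‖p‖ - ‖q‖))]
  have hI : ‖∫ x, (w x : ℂ) * inner ℂ (act (P x) u) (act X (act (P x) v)) ∂μ‖ ≤
      ‖X‖ / 2 * (∫ x, w x * ‖act (P x) u‖ ^ 2 ∂μ + ∫ x, w x * ‖act (P x) v‖ ^ 2 ∂μ) := by
    rw [← integral_add (hsq u) (hsq v), ← integral_const_mul]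
    refine norm_integral_le_of_norm_le (hint2.const_mul _) (Filter.Eventually.of_forall fun x => ?_)
    rw [norm_mul, Complex.norm_real, Real.norm_of_nonneg (hw0 x)]
    have := mul_le_mul_of_nonneg_left (hamgm (act (P x) u) (act (P x) v)) (hw0 x)
    linarith
  have hu' := mul_le_mul_of_nonneg_left (hz u hu) (norm_nonneg X)
  have hv' := mul_le_mul_of_nonneg_left (hz v hv) (norm_nonneg X)
  calc _ ≤ ‖inner ℂ (act Mᴴ u) (act X (act Mᴴ v))‖ +
        ε * ‖∫ x, (w x : ℂ) * inner ℂ (act (P x) u) (act X (act (P x) v)) ∂μ‖ := by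
        refine (norm_add_le _ _).trans ?_
        rw [norm_mul, Complex.norm_real, Real.norm_of_nonneg hε]
    _ ≤ ‖X‖ / 2 * (‖act Mᴴ u‖ ^ 2 + ‖act Mᴴ v‖ ^ 2) + ε * (‖X‖ / 2 *
        (∫ x, w x * ‖act (P x) u‖ ^ 2 ∂μ + ∫ x, w x * ‖act (P x) v‖ ^ 2 ∂μ)) := by
        gcongr
        exact hamgm _ _
    _ ≤ ‖X‖ * ‖Z‖ := by linarith

end MatrixOperators

/-! ### The Hilbert–Schmidt norm -/

section HilbertSchmidt

variable {n : Type*} [Fintype n] [DecidableEq n]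

/-- The Hilbert–Schmidt norm. -/
def hs (A : Matrix n n ℂ) : ℝ := Real.sqrt (∑ i, ∑ j, ‖A i j‖ ^ 2)

omit [DecidableEq n] in
theorem hs_nonneg (A : Matrix n n ℂ) : 0 ≤ hs A := Real.sqrt_nonneg _

omit [DecidableEq n] in
theorem hs_sq (A : Matrix n n ℂ) : hs A ^ 2 = ∑ i, ∑ j, ‖A i j‖ ^ 2 :=
  Real.sq_sqrt (Finset.sum_nonneg fun _ _ => Finset.sum_nonneg fun _ _ => sq_nonneg _)

omit [DecidableEq n] in
theorem hs_conjTranspose (A : Matrix n n ℂ) : hs Aᴴ = hs A := by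
  unfold hs
  rw [Finset.sum_comm]
  simp [Matrix.conjTranspose_apply]

omit [DecidableEq n] in
theorem trace_conjTranspose_mul_self (A : Matrix n n ℂ) :
    (Aᴴ * A).trace = ((hs A ^ 2 : ℝ) : ℂ) := by
  rw [hs_sq, Finset.sum_comm]
  simp only [Matrix.trace, Matrix.diag, Matrix.mul_apply, Matrix.conjTranspose_apply]
  push_cast
  refine Finset.sum_congr rfl fun i _ => Finset.sum_congr rfl fun j _ => ?_
  rw [RCLike.star_def, Complex.conj_mul']

omit [DecidableEq n] in
theorem norm_trace_mul_le (A B : Matrix n n ℂ) : ‖(A * B).trace‖ ≤ hs A * hs B := by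
  have h1 : ‖(A * B).trace‖ ≤ ∑ p : n × n, ‖A p.1 p.2‖ * ‖B p.2 p.1‖ := by
    simp only [Matrix.trace, Matrix.diag, Matrix.mul_apply, Fintype.sum_prod_type]
    refine (norm_sum_le _ _).trans (Finset.sum_le_sum fun i _ => (norm_sum_le _ _).trans
      (Finset.sum_le_sum fun j _ => (norm_mul _ _).le))
  refine h1.trans ((Real.sum_mul_le_sqrt_mul_sqrt _ _ _).trans (le_of_eq ?_))
  unfold hs
  simp only [Fintype.sum_prod_type]
  rw [Finset.sum_comm (f := fun i j => ‖B j i‖ ^ 2)]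

theorem hs_mul_le (A B : Matrix n n ℂ) : hs (A * B) ≤ ‖A‖ * hs B := by
  refine Real.sqrt_le_iff.2 ⟨mul_nonneg (norm_nonneg _) (hs_nonneg _), ?_⟩
  rw [mul_pow, hs_sq, Finset.sum_comm, Finset.sum_comm (f := fun i j => ‖B i j‖ ^ 2),
    Finset.mul_sum]
  refine Finset.sum_le_sum fun j _ => ?_
  have h := norm_act_le A (WithLp.toLp 2 fun k => B k j)
  have h2 := pow_le_pow_left₀ (norm_nonneg _) h 2
  rw [mul_pow, EuclideanSpace.norm_sq_eq, EuclideanSpace.norm_sq_eq] at h2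
  simpa [act, Matrix.toEuclideanCLM_toLp, Matrix.mulVec, dotProduct, Matrix.mul_apply] using h2

theorem hs_mul_le' (A B : Matrix n n ℂ) : hs (A * B) ≤ hs A * ‖B‖ := by
  rw [← hs_conjTranspose, Matrix.conjTranspose_mul]
  refine (hs_mul_le _ _).trans (le_of_eq ?_)
  rw [hs_conjTranspose, Matrix.l2_opNorm_conjTranspose, mul_comm]

theorem norm_one_le : ‖(1 : Matrix n n ℂ)‖ ≤ 1 := by
  rw [Matrix.cstar_norm_def, map_one]
  exact ContinuousLinearMap.norm_id_le

end HilbertSchmidt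

/-! ### Duality between the trace norm and the operator norm -/

section TraceNorm

variable {Λ : Type} [Fintype Λ] [DecidableEq Λ]

/-- The singular values of `O`: in an eigenbasis of `O†O`, given by the columns of a unitary `U`,
the columns of `O U` are orthogonal with squared lengths `w k`. -/
theorem exists_singular_values (O : Op Λ) :
    ∃ (U : Matrix.unitaryGroup (Λ → Fin 2) ℂ) (w : (Λ → Fin 2) → ℝ), (∀ k, 0 ≤ w k) ∧
      (O * (U : Op Λ))ᴴ * (O * (U : Op Λ)) = Matrix.diagonal (fun k => (w k : ℂ)) ∧
      traceNorm O = ∑ k, Real.sqrt (w k) := by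
  have h := Matrix.isHermitian_conjTranspose_mul_self O
  have hsp := h.spectral_theorem
  rw [Unitary.conjStarAlgAut_apply] at hsp
  have hUU := Unitary.coe_star_mul_self h.eigenvectorUnitary
  refine ⟨h.eigenvectorUnitary, h.eigenvalues,
    Matrix.eigenvalues_conjTranspose_mul_self_nonneg O, ?_, rfl⟩
  have h2 := congrArg (fun M => star (h.eigenvectorUnitary : Op Λ) * M *
    (h.eigenvectorUnitary : Op Λ)) hsp
  simp only [mul_assoc] at h2
  rw [hUU, mul_one, ← mul_assoc (star (h.eigenvectorUnitary : Op Λ))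
    (h.eigenvectorUnitary : Op Λ), hUU, one_mul] at h2
  rw [Matrix.conjTranspose_mul, ← Matrix.star_eq_conjTranspose (h.eigenvectorUnitary : Op Λ),
    mul_assoc]
  exact h2

theorem entry_eq_inner {n : Type*} [Fintype n] [DecidableEq n] (M : Matrix n n ℂ) (k l : n) :
    M k l = inner ℂ (EuclideanSpace.single k (1 : ℂ)) (act M (EuclideanSpace.single l 1)) := by
  simp [act, EuclideanSpace.inner_single_left, Matrix.ofLp_toEuclideanCLM]

/-- Hölder's inequality, from the expansion of the trace in the eigenbasis of `O†O`. -/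
theorem norm_trace_mul_le_traceNorm (X O : Op Λ) : ‖(X * O).trace‖ ≤ ‖X‖ * traceNorm O := by
  obtain ⟨U, w, hw, hQ, htn⟩ := exists_singular_values O
  have hUU' : (U : Op Λ) * star (U : Op Λ) = 1 := Unitary.coe_mul_star_self U
  generalize hQdef : O * (U : Op Λ) = Q at hQ
  have htr : (X * O).trace = (star (U : Op Λ) * X * Q).trace := by
    rw [mul_assoc (star (U : Op Λ)), Matrix.trace_mul_comm (star (U : Op Λ)), ← hQdef]
    simp only [mul_assoc, hUU', mul_one]
  rw [htr, htn, Finset.mul_sum]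
  refine (norm_sum_le _ _).trans (Finset.sum_le_sum fun k _ => ?_)
  have hek : ‖(EuclideanSpace.single k (1 : ℂ) : EuclideanSpace ℂ (Λ → Fin 2))‖ = 1 := by simp
  have hq : ‖act Q (EuclideanSpace.single k 1)‖ = Real.sqrt (w k) := by
    have h1 : inner ℂ (EuclideanSpace.single k (1 : ℂ)) (act (Qᴴ * Q) (EuclideanSpace.single k 1)) =
        ((‖act Q (EuclideanSpace.single k 1)‖ ^ 2 : ℝ) : ℂ) := by
      rw [act_mul, inner_act_conjTranspose, inner_self_eq_norm_sq_to_K]; norm_cast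
    rw [← entry_eq_inner, hQ, Matrix.diagonal_apply_eq] at h1
    rw [Complex.ofReal_injective h1, Real.sqrt_sq (norm_nonneg _)]
  refine (congrArg norm (entry_eq_inner (star (U : Op Λ) * X * Q) k k)).le.trans ?_
  rw [act_mul]
  refine (norm_inner_le_norm _ _).trans ?_
  rw [hek, one_mul]
  refine (norm_act_le _ _).trans ?_
  rw [hq, ← Unitary.coe_star, CStarRing.norm_coe_unitary_mul]

/-- Hölder's inequality is attained at the adjoint of the partial isometry in the polar
decomposition of `O`. -/
theorem exists_trace_mul_eq_traceNorm (O : Op Λ) :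
    ∃ X : Op Λ, ‖X‖ ≤ 1 ∧ (X * O).trace = traceNorm O := by
  obtain ⟨U, w, hw, hQ, htn⟩ := exists_singular_values O
  generalize hQdef : O * (U : Op Λ) = Q at hQ
  -- the inverses of the singular values; the entries at vanishing ones are `0⁻¹ = 0`
  set D : Op Λ := Matrix.diagonal fun k => (((Real.sqrt (w k))⁻¹ : ℝ) : ℂ)
  have hD : Dᴴ = D := by
    simp only [D, Matrix.diagonal_conjTranspose]
    congr 1
    funext k
    simp
  refine ⟨U * D * Qᴴ, ?_, ?_⟩
  · have h1 : ‖(U : Op Λ) * D * Qᴴ‖ * ‖(U : Op Λ) * D * Qᴴ‖ ≤ 1 := by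
      rw [← Matrix.l2_opNorm_conjTranspose, ← Matrix.l2_opNorm_conjTranspose_mul_self,
        Matrix.conjTranspose_conjTranspose]
      have : (U : Op Λ) * D * Qᴴ * ((U : Op Λ) * D * Qᴴ)ᴴ =
          (U : Op Λ) * (D * (Qᴴ * Q) * D) * star (U : Op Λ) := by
        simp only [Matrix.conjTranspose_mul, Matrix.conjTranspose_conjTranspose, hD,
          Matrix.star_eq_conjTranspose, mul_assoc]
      rw [this, ← Unitary.coe_star, CStarRing.norm_mul_coe_unitary,
        CStarRing.norm_coe_unitary_mul,
        hQ, Matrix.diagonal_mul_diagonal, Matrix.diagonal_mul_diagonal, Matrix.l2_opNorm_diagonal,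
        pi_norm_le_iff_of_nonneg zero_le_one]
      intro k
      rw [← Complex.ofReal_mul, ← Complex.ofReal_mul, Complex.norm_real]
      rcases (hw k).eq_or_lt with h1 | h1
      · rw [← h1]; simp
      · have : Real.sqrt (w k) ≠ 0 := (Real.sqrt_pos.2 h1).ne'
        have h2 : (Real.sqrt (w k))⁻¹ * w k * (Real.sqrt (w k))⁻¹ = 1 := by
          nth_rewrite 2 [← Real.mul_self_sqrt (hw k)]
          field_simp
        rw [h2]; simp
    nlinarith [norm_nonneg ((U : Op Λ) * D * Qᴴ)]
  · rw [mul_assoc, mul_assoc, Matrix.trace_mul_comm, mul_assoc, mul_assoc, hQdef, hQ,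
      Matrix.diagonal_mul_diagonal, Matrix.trace_diagonal, htn]
    push_cast
    refine Finset.sum_congr rfl fun k _ => ?_
    rcases (hw k).eq_or_lt with h1 | h1
    · rw [← h1]; simp
    · have : Real.sqrt (w k) ≠ 0 := (Real.sqrt_pos.2 h1).ne'
      rw [← Complex.ofReal_inv, ← Complex.ofReal_mul, ← div_eq_inv_mul, Real.div_sqrt]

theorem traceNorm_nonneg (O : Op Λ) : 0 ≤ traceNorm O :=
  Finset.sum_nonneg fun _ _ => Real.sqrt_nonneg _

theorem traceNorm_le_of_forall {O : Op Λ} {c : ℝ}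
    (h : ∀ X : Op Λ, ‖X‖ ≤ 1 → ‖(X * O).trace‖ ≤ c) : traceNorm O ≤ c := by
  obtain ⟨X, hX, hO⟩ := exists_trace_mul_eq_traceNorm O
  have := h X hX
  rw [hO, Complex.norm_real, Real.norm_of_nonneg (traceNorm_nonneg O)] at this
  exact this

theorem traceNorm_add_le (O O' : Op Λ) : traceNorm (O + O') ≤ traceNorm O + traceNorm O' := by
  refine traceNorm_le_of_forall fun X hX => ?_
  rw [mul_add, Matrix.trace_add]
  refine (norm_add_le _ _).trans (add_le_add ?_ ?_) <;>
  · refine (norm_trace_mul_le_traceNorm _ _).trans ?_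
    exact mul_le_of_le_one_left (traceNorm_nonneg _) hX

theorem traceNorm_neg (O : Op Λ) : traceNorm (-O) = traceNorm O := by
  have h : ∀ O : Op Λ, traceNorm (-O) ≤ traceNorm O := fun O => by
    refine traceNorm_le_of_forall fun X hX => ?_
    rw [mul_neg, Matrix.trace_neg, norm_neg]
    exact (norm_trace_mul_le_traceNorm _ _).trans (mul_le_of_le_one_left (traceNorm_nonneg _) hX)
  exact le_antisymm (h O) (by simpa using h (-O))

end TraceNorm

/-! ### The Heisenberg dual of a superoperator -/

section Dual

variable {n : Type*} [Fintype n] [DecidableEq n]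

/-- The dual `Φ ↦ Φ*` of superoperators with respect to the pairing `(X, O) ↦ Tr (X O)`, as a
continuous linear map. -/
def superDual : (Matrix n n ℂ →L[ℂ] Matrix n n ℂ) →L[ℂ] (Matrix n n ℂ →L[ℂ] Matrix n n ℂ) :=
  LinearMap.toContinuousLinearMap
    { toFun := fun Φ => LinearMap.toContinuousLinearMap
        { toFun := fun X => Matrix.of fun i j => (X * Φ (Matrix.single j i 1)).trace
          map_add' := fun X Y => by ext; simp [add_mul]
          map_smul' := fun c X => by ext; simp }
      map_add' := fun Φ Ψ => by ext; simp [mul_add]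
      map_smul' := fun c Φ => by ext; simp }

theorem trace_superDual_mul (Φ : Matrix n n ℂ →L[ℂ] Matrix n n ℂ) (X O : Matrix n n ℂ) :
    (superDual Φ X * O).trace = (X * Φ O).trace := by
  have h1 : ∀ i j, superDual Φ X i j = (X * Φ (Matrix.single j i 1)).trace := fun _ _ => rfl
  conv_rhs => rw [Matrix.matrix_eq_sum_single O]
  simp only [map_sum, Finset.mul_sum, Matrix.trace_sum]
  have h2 : ∀ i j, Φ (Matrix.single i j (O i j)) = O i j • Φ (Matrix.single i j 1) := fun i j => by
    rw [← map_smul, Matrix.smul_single, smul_eq_mul, mul_one]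
  simp only [h2, Matrix.mul_smul, Matrix.trace_smul, ← h1]
  simp only [Matrix.trace, Matrix.diag, Matrix.mul_apply, smul_eq_mul]
  rw [Finset.sum_comm]
  exact Finset.sum_congr rfl fun _ _ => Finset.sum_congr rfl fun _ _ => mul_comm _ _

theorem eq_of_trace_mul_eq {A B : Matrix n n ℂ}
    (h : ∀ O : Matrix n n ℂ, (A * O).trace = (B * O).trace) :
    A = B := by
  ext i j
  have := h (Matrix.single j i 1)
  simpa [Matrix.trace_mul_single] using this

theorem superDual_eq {Φ Ψ : Matrix n n ℂ →L[ℂ] Matrix n n ℂ}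
    (h : ∀ X O, (X * Φ O).trace = (Ψ X * O).trace) : superDual Φ = Ψ := by
  ext1 X
  exact eq_of_trace_mul_eq fun O => by rw [trace_superDual_mul, h]

theorem superDual_one : superDual (1 : Matrix n n ℂ →L[ℂ] Matrix n n ℂ) = 1 :=
  superDual_eq fun _ _ => rfl

theorem superDual_mul (Φ Ψ : Matrix n n ℂ →L[ℂ] Matrix n n ℂ) :
    superDual (Φ * Ψ) = superDual Ψ * superDual Φ :=
  superDual_eq fun X O => by
    change (X * Φ (Ψ O)).trace = (superDual Ψ (superDual Φ X) * O).trace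
    rw [trace_superDual_mul, trace_superDual_mul]

theorem superDual_pow (Φ : Matrix n n ℂ →L[ℂ] Matrix n n ℂ) (k : ℕ) :
    superDual (Φ ^ k) = superDual Φ ^ k := by
  induction k with
  | zero => simp [superDual_one]
  | succ k ih => rw [pow_succ, superDual_mul, ih, pow_succ']

/-- Duality reverses products, but an exponential only involves powers of a single element. -/
theorem superDual_exp (Φ : Matrix n n ℂ →L[ℂ] Matrix n n ℂ) :
    superDual (NormedSpace.exp Φ) = NormedSpace.exp (superDual Φ) := by
  have h1 := (NormedSpace.exp_series_hasSum_exp' (𝕂 := ℂ) Φ).mapL superDual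
  have h2 := NormedSpace.exp_series_hasSum_exp' (𝕂 := ℂ) (superDual Φ)
  refine h1.unique ?_
  simpa only [map_smul, superDual_pow] using h2

end Dual

theorem traceNorm_apply_le {Λ : Type} [Fintype Λ] [DecidableEq Λ] (Φ : SuperOp Λ) (O : Op Λ) :
    traceNorm (Φ O) ≤ ‖superDual Φ‖ * traceNorm O := by
  refine traceNorm_le_of_forall fun X hX => ?_
  rw [← trace_superDual_mul]
  refine (norm_trace_mul_le_traceNorm _ _).trans ?_
  gcongr
  · exact traceNorm_nonneg O
  · exact (ContinuousLinearMap.le_opNorm _ _).trans (mul_le_of_le_one_right (norm_nonneg _) hX)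

theorem superNormOne_le {Λ : Type} [Fintype Λ] [DecidableEq Λ] (Φ : SuperOp Λ) :
    superNormOne Φ ≤ ENNReal.ofReal ‖superDual Φ‖ := by
  refine iSup₂_le fun O _ => ENNReal.ofReal_le_ofReal ?_
  rcases (traceNorm_nonneg O).eq_or_lt with h | h
  · rw [← h, div_zero]; exact norm_nonneg _
  · rw [div_le_iff₀ h]; exact traceNorm_apply_le Φ O

/-! ### Contraction semigroups -/

section Semigroup

variable {𝔸 : Type*} [NormedRing 𝔸] [NormedAlgebra ℂ 𝔸]

/-- First-order dissipativity: `‖1 + ε L‖ ≤ 1 + O(ε²)` for `ε ≥ 0`. -/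
def Dissipative (L : 𝔸) : Prop := ∃ c : ℝ, ∀ ε : ℝ, 0 ≤ ε → ‖1 + (ε : ℂ) • L‖ ≤ 1 + c * ε ^ 2

theorem Dissipative.add {L L' : 𝔸} (h : Dissipative L) (h' : Dissipative L') :
    Dissipative (L + L') := by
  obtain ⟨c, hc⟩ := h
  obtain ⟨c', hc'⟩ := h'
  refine ⟨2 * c + 2 * c', fun ε hε => ?_⟩
  have h1 := hc (2 * ε) (by positivity)
  have h2 := hc' (2 * ε) (by positivity)
  -- the midpoint of the two flows run at double speed
  have h3 : (1 : 𝔸) + (ε : ℂ) • (L + L') =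
      (1 / 2 : ℂ) • (1 + ((2 * ε : ℝ) : ℂ) • L) + (1 / 2 : ℂ) • (1 + ((2 * ε : ℝ) : ℂ) • L') := by
    push_cast
    module
  rw [h3]
  refine (norm_add_le _ _).trans ?_
  have h4 : ‖(1 / 2 : ℂ)‖ = 1 / 2 := by norm_num
  rw [norm_smul, norm_smul, h4]
  linarith

theorem dissipative_zero (h1 : ‖(1 : 𝔸)‖ ≤ 1) : Dissipative (0 : 𝔸) :=
  ⟨0, fun ε _ => by simpa using h1⟩

theorem Dissipative.sum {ι : Type*} (h1 : ‖(1 : 𝔸)‖ ≤ 1) (s : Finset ι) {L : ι → 𝔸}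
    (h : ∀ i ∈ s, Dissipative (L i)) : Dissipative (∑ i ∈ s, L i) := by
  classical
  induction s using Finset.induction_on with
  | empty => simpa using dissipative_zero h1
  | insert a s ha ih =>
    rw [Finset.sum_insert ha]
    exact (h a (Finset.mem_insert_self a s)).add
      (ih fun i hi => h i (Finset.mem_insert_of_mem hi))

variable [CompleteSpace 𝔸]

theorem hasDerivAt_exp_real_smul (L : 𝔸) (s : ℝ) :
    HasDerivAt (fun u : ℝ => NormedSpace.exp ((u : ℂ) • L))
      (NormedSpace.exp ((s : ℂ) • L) * L) s := by
  simpa only [Complex.coe_smul] using hasDerivAt_exp_smul_const (𝕂 := ℝ) L s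

theorem hasDerivAt_exp_real_smul' (L : 𝔸) (s : ℝ) :
    HasDerivAt (fun u : ℝ => NormedSpace.exp ((u : ℂ) • L))
      (L * NormedSpace.exp ((s : ℂ) • L)) s := by
  simpa only [Complex.coe_smul] using hasDerivAt_exp_smul_const' (𝕂 := ℝ) L s

theorem continuous_exp_real_smul (L : 𝔸) :
    Continuous fun u : ℝ => NormedSpace.exp ((u : ℂ) • L) :=
  continuous_iff_continuousAt.2 fun s => (hasDerivAt_exp_real_smul L s).continuousAt

/-- A dissipative element generates a contraction semigroup, since
`‖exp (s L)‖ = ‖exp ((s/k) L)ᵏ‖ ≤ (1 + O(k⁻²))ᵏ → 1`. -/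
theorem Dissipative.norm_exp_le {L : 𝔸} (h1 : ‖(1 : 𝔸)‖ ≤ 1) (h : Dissipative L) {s : ℝ}
    (hs : 0 ≤ s) : ‖NormedSpace.exp ((s : ℂ) • L)‖ ≤ 1 := by
  let _ : NormedAlgebra ℚ 𝔸 := NormedAlgebra.restrictScalars ℚ ℂ 𝔸
  obtain ⟨c, hc⟩ := h
  rcases hs.eq_or_lt with rfl | hs
  · simpa [NormedSpace.exp_zero] using h1
  -- for every slope `δ > 0`, the norm is at most `exp (δ s)`
  have key : ∀ δ : ℝ, 0 < δ → ‖NormedSpace.exp ((s : ℂ) • L)‖ ≤ Real.exp (δ * s) := by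
    intro δ hδ
    have hd := (hasDerivAt_exp_real_smul L 0).isLittleO
    have h2 := hd.def (show (0 : ℝ) < δ / 2 by positivity)
    have h3 : ∀ᶠ u : ℝ in nhds 0, |c| * |u| < δ / 2 := by
      have : Filter.Tendsto (fun u : ℝ => |c| * |u|) (nhds 0) (nhds (|c| * |0|)) :=
        (continuous_const.mul continuous_abs).tendsto 0
      rw [abs_zero, mul_zero] at this
      exact this.eventually_lt_const (by positivity)
    have h4 : Filter.Tendsto (fun k : ℕ => s / ((k : ℝ) + 1)) Filter.atTop (nhds 0) :=
      tendsto_const_div_atTop_nhds_zero_nat s |>.comp (Filter.tendsto_add_atTop_nat 1) |>.congr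
        fun k => by simp
    obtain ⟨k, hk2, hk3⟩ := (h4.eventually (h2.and h3)).exists
    set u : ℝ := s / ((k : ℝ) + 1) with hu
    have hu0 : 0 < u := by positivity
    have h5 : ‖NormedSpace.exp ((u : ℂ) • L)‖ ≤ Real.exp (δ * u) := by
      have h6 : NormedSpace.exp ((u : ℂ) • L) =
          (NormedSpace.exp ((u : ℂ) • L) - NormedSpace.exp (((0 : ℝ) : ℂ) • L) -
            (u - 0) • (NormedSpace.exp (((0 : ℝ) : ℂ) • L) * L)) + (1 + (u : ℂ) • L) := by
        simp [NormedSpace.exp_zero]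
      rw [h6]
      refine (norm_add_le _ _).trans ((add_le_add hk2 (hc u hu0.le)).trans ?_)
      refine le_trans ?_ (Real.add_one_le_exp _)
      rw [sub_zero, Real.norm_of_nonneg hu0.le]
      rw [abs_of_pos hu0] at hk3
      nlinarith [le_abs_self c, mul_le_mul_of_nonneg_right hk3.le hu0.le,
        mul_le_mul_of_nonneg_right (le_abs_self c) (sq_nonneg u)]
    have h7 : (s : ℂ) • L = (k + 1) • ((u : ℂ) • L) := by
      rw [← Nat.cast_smul_eq_nsmul ℂ, smul_smul, hu]
      congr 1
      push_cast
      field_simp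
    rw [h7, NormedSpace.exp_nsmul]
    refine (norm_pow_le' _ k.succ_pos).trans ((pow_le_pow_left₀ (norm_nonneg _) h5 _).trans
      (le_of_eq ?_))
    rw [← Real.exp_nat_mul, hu]
    congr 1
    push_cast
    field_simp
  have hlim : Filter.Tendsto (fun δ : ℝ => Real.exp (δ * s)) (nhdsWithin 0 (Set.Ioi 0))
      (nhds 1) := by
    have : Continuous fun δ : ℝ => Real.exp (δ * s) := by fun_prop
    simpa using (this.tendsto 0).mono_left nhdsWithin_le_nhds
  exact ge_of_tendsto hlim (Filter.eventually_of_mem self_mem_nhdsWithin fun δ hδ => key δ hδ)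

/-- Duhamel's estimate for two contraction semigroups. -/
theorem norm_exp_sub_exp_le {L L' : 𝔸}
    (h : ∀ s : ℝ, 0 ≤ s → ‖NormedSpace.exp ((s : ℂ) • L)‖ ≤ 1)
    (h' : ∀ s : ℝ, 0 ≤ s → ‖NormedSpace.exp ((s : ℂ) • L')‖ ≤ 1) {t : ℝ} (ht : 0 ≤ t) :
    ‖NormedSpace.exp ((t : ℂ) • L) - NormedSpace.exp ((t : ℂ) • L')‖ ≤ t * ‖L - L'‖ := by
  let _ : NormedAlgebra ℚ 𝔸 := NormedAlgebra.restrictScalars ℚ ℂ 𝔸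
  have hder : ∀ s ∈ Set.Icc 0 t, HasDerivWithinAt
      (fun u : ℝ => NormedSpace.exp ((u : ℂ) • L) * NormedSpace.exp (((t - u : ℝ) : ℂ) • L'))
      (NormedSpace.exp ((s : ℂ) • L) * (L - L') * NormedSpace.exp (((t - s : ℝ) : ℂ) • L'))
      (Set.Icc 0 t) s := fun s _ => by
    have h1 := hasDerivAt_exp_real_smul L s
    have h2 : HasDerivAt (fun u : ℝ => NormedSpace.exp (((t - u : ℝ) : ℂ) • L'))
        (-(L' * NormedSpace.exp (((t - s : ℝ) : ℂ) • L'))) s := by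
      have h3 := (hasDerivAt_exp_real_smul' L' (t - s)).scomp s ((hasDerivAt_id s).const_sub t)
      rw [neg_one_smul] at h3
      exact h3
    refine ((h1.mul h2).congr_deriv ?_).hasDerivWithinAt
    noncomm_ring
  have := norm_image_sub_le_of_norm_deriv_le_segment' hder (C := ‖L - L'‖) (fun s hs => by
    refine (norm_mul_le _ _).trans ?_
    refine (mul_le_mul (norm_mul_le _ _) (h' (t - s) (by linarith [hs.2])) (norm_nonneg _)
      (by positivity)).trans ?_
    rw [mul_one]
    exact mul_le_of_le_one_left (norm_nonneg _) (h s hs.1)) t ⟨ht, le_rfl⟩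
  simpa [NormedSpace.exp_zero, mul_comm] using this

end Semigroup

/-! ### Functions of the Bohr frequencies -/

section Bohr

open MeasureTheory

variable {n : Type*} [Fintype n] [DecidableEq n]

/-- The matrix of `O` in the orthonormal basis given by the columns of `U`. -/
def rot (U : Matrix.unitaryGroup n ℂ) (O : Matrix n n ℂ) : Matrix n n ℂ :=
  star (U : Matrix n n ℂ) * O * (U : Matrix n n ℂ)

variable (U : Matrix.unitaryGroup n ℂ)

theorem rot_mul (A B : Matrix n n ℂ) : rot U (A * B) = rot U A * rot U B := by
  have h : (U : Matrix n n ℂ) * star (U : Matrix n n ℂ) = 1 := Unitary.coe_mul_star_self U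
  calc rot U (A * B) = star (U : Matrix n n ℂ) * A * 1 * B * (U : Matrix n n ℂ) := by
        simp only [rot, mul_one, mul_assoc]
    _ = rot U A * rot U B := by rw [← h]; simp only [rot, mul_assoc]

theorem rot_add (A B : Matrix n n ℂ) : rot U (A + B) = rot U A + rot U B := by
  simp only [rot, mul_add, add_mul]

theorem rot_sub (A B : Matrix n n ℂ) : rot U (A - B) = rot U A - rot U B := by
  simp only [rot, mul_sub, sub_mul]

theorem rot_smul (c : ℂ) (A : Matrix n n ℂ) : rot U (c • A) = c • rot U A := by
  simp only [rot, Matrix.mul_smul, Matrix.smul_mul]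

theorem rot_one : rot U 1 = 1 := by
  rw [rot, mul_one]; exact Unitary.coe_star_mul_self U

theorem rot_conjTranspose (A : Matrix n n ℂ) : rot U Aᴴ = (rot U A)ᴴ := by
  simp only [rot, Matrix.conjTranspose_mul, Matrix.star_eq_conjTranspose,
    Matrix.conjTranspose_conjTranspose, mul_assoc]

theorem trace_rot (A : Matrix n n ℂ) : (rot U A).trace = A.trace := by
  have h : (U : Matrix n n ℂ) * star (U : Matrix n n ℂ) = 1 := Unitary.coe_mul_star_self U
  rw [rot, mul_assoc, Matrix.trace_mul_comm, mul_assoc, h, mul_one]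

theorem rot_conj (A : Matrix n n ℂ) :
    rot U ((U : Matrix n n ℂ) * A * star (U : Matrix n n ℂ)) = A := by
  have h : star (U : Matrix n n ℂ) * (U : Matrix n n ℂ) = 1 := Unitary.coe_star_mul_self U
  rw [rot, mul_assoc (U : Matrix n n ℂ), ← mul_assoc (star (U : Matrix n n ℂ)), h, one_mul,
    mul_assoc, h, mul_one]

theorem conj_rot (A : Matrix n n ℂ) :
    (U : Matrix n n ℂ) * rot U A * star (U : Matrix n n ℂ) = A := by
  have h : (U : Matrix n n ℂ) * star (U : Matrix n n ℂ) = 1 := Unitary.coe_mul_star_self U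
  rw [rot, mul_assoc (star (U : Matrix n n ℂ)), ← mul_assoc (U : Matrix n n ℂ), h, one_mul,
    mul_assoc, h, mul_one]

theorem eq_of_rot {A B : Matrix n n ℂ} (h : ∀ i j, rot U A i j = rot U B i j) : A = B := by
  rw [← conj_rot U A, ← conj_rot U B, Matrix.ext h]

variable {α : Type*} [MeasurableSpace α] {μ : Measure α}

theorem rot_integral {F : α → Matrix n n ℂ} (h : Integrable F μ) :
    rot U (∫ a, F a ∂μ) = ∫ a, rot U (F a) ∂μ := integral_mul_left_right h _ _

theorem integrable_rot {F : α → Matrix n n ℂ} (h : Integrable F μ) :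
    Integrable (fun a => rot U (F a)) μ :=
  (ContinuousLinearMap.mulLeftRight ℂ (Matrix n n ℂ) (star (U : Matrix n n ℂ))
    (U : Matrix n n ℂ)).integrable_comp h

theorem integrable_of_rot {F : α → Matrix n n ℂ}
    (h : ∀ i j, Integrable (fun a => rot U (F a) i j) μ) : Integrable F μ := by
  have h1 : Integrable (fun a => rot U (F a)) μ := integrable_of_entries h
  have h2 : Integrable (fun a => (U : Matrix n n ℂ) * rot U (F a) * star (U : Matrix n n ℂ)) μ :=
    (h1.const_mul (U : Matrix n n ℂ)).mul_const (star (U : Matrix n n ℂ))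
  simpa only [conj_rot] using h2

theorem rot_integral_apply {F : α → Matrix n n ℂ} (h : Integrable F μ) (i j : n) :
    rot U (∫ a, F a ∂μ) i j = ∫ a, rot U (F a) i j ∂μ := by
  rw [rot_integral U h, integral_entry (integrable_rot U h)]

variable (e : n → ℝ)

/-- For a Hamiltonian with eigenvectors the columns of `U` and eigenvalues `e`, the map that
multiplies the component of `O` of Bohr frequency `ν` by `φ ν`. -/
def bohr (φ : ℝ → ℂ) : Matrix n n ℂ →L[ℂ] Matrix n n ℂ :=
  LinearMap.toContinuousLinearMap
    { toFun := fun O => (U : Matrix n n ℂ) * (Matrix.of fun i j => φ (e i - e j) * rot U O i j) *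
        star (U : Matrix n n ℂ)
      map_add' := fun A B => by
        rw [← add_mul, ← mul_add]
        congr 2
        ext i j
        simp [rot_add, mul_add]
      map_smul' := fun c A => by
        rw [RingHom.id_apply, ← Matrix.smul_mul, ← Matrix.mul_smul]
        congr 2
        ext i j
        simp [rot_smul, mul_left_comm] }

@[simp] theorem rot_bohr (φ : ℝ → ℂ) (O : Matrix n n ℂ) (i j : n) :
    rot U (bohr U e φ O) i j = φ (e i - e j) * rot U O i j := by
  have h : bohr U e φ O = (U : Matrix n n ℂ) * (Matrix.of fun i j => φ (e i - e j) * rot U O i j) *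
      star (U : Matrix n n ℂ) := rfl
  rw [h, rot_conj, Matrix.of_apply]

theorem bohr_bohr (φ ψ : ℝ → ℂ) (O : Matrix n n ℂ) :
    bohr U e φ (bohr U e ψ O) = bohr U e (fun ν => φ ν * ψ ν) O :=
  eq_of_rot U fun i j => by simp [mul_assoc]

theorem bohr_one (O : Matrix n n ℂ) : bohr U e (fun _ => 1) O = O :=
  eq_of_rot U fun i j => by simp

theorem bohr_add_fun (φ ψ : ℝ → ℂ) (O : Matrix n n ℂ) :
    bohr U e (fun ν => φ ν + ψ ν) O = bohr U e φ O + bohr U e ψ O :=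
  eq_of_rot U fun i j => by simp [rot_add, add_mul]

theorem bohr_const_mul (c : ℂ) (φ : ℝ → ℂ) (O : Matrix n n ℂ) :
    bohr U e (fun ν => c * φ ν) O = c • bohr U e φ O :=
  eq_of_rot U fun i j => by simp [rot_smul, mul_assoc]

theorem conjTranspose_bohr (φ : ℝ → ℂ) (O : Matrix n n ℂ) :
    (bohr U e φ O)ᴴ = bohr U e (fun ν => star (φ (-ν))) Oᴴ :=
  eq_of_rot U fun i j => by
    simp [rot_conjTranspose, Matrix.conjTranspose_apply]

theorem integrable_bohr {φ : α → ℝ → ℂ} (h : ∀ ν, Integrable (fun a => φ a ν) μ)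
    (O : Matrix n n ℂ) : Integrable (fun a => bohr U e (φ a) O) μ :=
  integrable_of_rot U fun i j => by
    simp only [rot_bohr]
    exact (h _).mul_const _

theorem bohr_integral {φ : α → ℝ → ℂ} (h : ∀ ν, Integrable (fun a => φ a ν) μ)
    (O : Matrix n n ℂ) :
    bohr U e (fun ν => ∫ a, φ a ν ∂μ) O = ∫ a, bohr U e (φ a) O ∂μ :=
  eq_of_rot U fun i j => by
    rw [rot_integral_apply U (integrable_bohr U e h O)]
    simp only [rot_bohr]
    rw [integral_mul_const]

/-- The operator `e^{zK}` for the Hamiltonian `K` with eigenvectors the columns of `U` and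
eigenvalues `e`. -/
def gexp (z : ℂ) : Matrix n n ℂ :=
  (U : Matrix n n ℂ) * Matrix.diagonal (fun i => Complex.exp (z * e i)) * star (U : Matrix n n ℂ)

theorem rot_gexp (z : ℂ) : rot U (gexp U e z) = Matrix.diagonal fun i => Complex.exp (z * e i) :=
  rot_conj U _

theorem gexp_mul (z w : ℂ) : gexp U e z * gexp U e w = gexp U e (z + w) :=
  eq_of_rot U fun i j => by
    simp only [rot_mul, rot_gexp, Matrix.diagonal_mul_diagonal, ← Complex.exp_add, add_mul]

theorem gexp_zero : gexp U e 0 = 1 :=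
  eq_of_rot U fun i j => by
    simp [rot_gexp, rot_one]

theorem gexp_conjTranspose (z : ℂ) : (gexp U e z)ᴴ = gexp U e (star z) :=
  eq_of_rot U fun i j => by
    rw [rot_conjTranspose, rot_gexp, rot_gexp, Matrix.diagonal_conjTranspose]
    congr 2
    funext k
    simp [← Complex.exp_conj]

/-- An exponential function of the Bohr frequency amounts to evolution to a complex time. -/
theorem bohr_exp (z : ℂ) (O : Matrix n n ℂ) :
    bohr U e (fun ν => Complex.exp (z * ν)) O = gexp U e z * O * gexp U e (-z) :=
  eq_of_rot U fun i j => by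
    rw [rot_bohr, rot_mul, rot_mul, rot_gexp, rot_gexp, Matrix.mul_diagonal, Matrix.diagonal_mul]
    rw [mul_right_comm, ← Complex.exp_add]
    congr 2
    push_cast; ring

theorem bohr_exp_mul (z : ℂ) (A B : Matrix n n ℂ) :
    bohr U e (fun ν => Complex.exp (z * ν)) (A * B) =
      bohr U e (fun ν => Complex.exp (z * ν)) A * bohr U e (fun ν => Complex.exp (z * ν)) B := by
  simp only [bohr_exp]
  calc _ = gexp U e z * A * 1 * B * gexp U e (-z) := by simp only [mul_one, mul_assoc]
    _ = _ := by
      rw [← gexp_zero U e, ← neg_add_cancel z, ← gexp_mul]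
      simp only [mul_assoc]

theorem bohr_exp_one (z : ℂ) : bohr U e (fun ν => Complex.exp (z * ν)) 1 = 1 := by
  rw [bohr_exp, mul_one, gexp_mul, add_neg_cancel, gexp_zero]

/-- The Heisenberg evolution in the time unit of the Hamiltonian `K = U diag(e) U†`. -/
def heis (s : ℝ) (O : Matrix n n ℂ) : Matrix n n ℂ :=
  bohr U e (fun ν => Complex.exp (Complex.I * s * ν)) O

theorem heis_eq (s : ℝ) (O : Matrix n n ℂ) :
    heis U e s O = gexp U e (Complex.I * s) * O * gexp U e (-(Complex.I * s)) :=
  bohr_exp U e _ O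

/-- The unitary `e^{isK}`. -/
def evolution (s : ℝ) : Matrix.unitaryGroup n ℂ :=
  ⟨gexp U e (Complex.I * s), by
    rw [Matrix.mem_unitaryGroup_iff, Matrix.star_eq_conjTranspose, gexp_conjTranspose, gexp_mul]
    simp [gexp_zero]⟩

theorem star_evolution (s : ℝ) :
    star (evolution U e s : Matrix n n ℂ) = gexp U e (-(Complex.I * s)) := by
  change star (gexp U e (Complex.I * s)) = _
  rw [Matrix.star_eq_conjTranspose, gexp_conjTranspose]
  simp

theorem heis_eq_conj (s : ℝ) (O : Matrix n n ℂ) :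
    heis U e s O = evolution U e s * O * star (evolution U e s : Matrix n n ℂ) := by
  rw [heis_eq, star_evolution]; rfl

theorem norm_heis (s : ℝ) (O : Matrix n n ℂ) : ‖heis U e s O‖ = ‖O‖ := by
  rw [heis_eq_conj, ← Unitary.coe_star, CStarRing.norm_mul_coe_unitary,
    CStarRing.norm_coe_unitary_mul]

theorem rot_heis (s : ℝ) (O : Matrix n n ℂ) (i j : n) :
    rot U (heis U e s O) i j = Complex.exp (Complex.I * s * ((e i - e j : ℝ) : ℂ)) * rot U O i j :=
  rot_bohr U e _ O i j

theorem heis_mul (s : ℝ) (A B : Matrix n n ℂ) :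
    heis U e s (A * B) = heis U e s A * heis U e s B := bohr_exp_mul U e _ A B

theorem heis_conjTranspose (s : ℝ) (A : Matrix n n ℂ) :
    (heis U e s A)ᴴ = heis U e s Aᴴ := by
  rw [heis, conjTranspose_bohr, heis]
  congr 2
  funext ν
  simp [← Complex.exp_conj]

theorem integrable_mul_phase {κ : ℝ → ℂ} (hκ : Integrable κ) (ν : ℝ) :
    Integrable fun s : ℝ => κ s * Complex.exp (Complex.I * s * ν) := by
  refine hκ.norm.mono' (hκ.aestronglyMeasurable.mul
    (Continuous.aestronglyMeasurable (by fun_prop))) (Filter.Eventually.of_forall fun s => ?_)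
  rw [norm_mul, show Complex.I * s * ν = ((s * ν : ℝ) : ℂ) * Complex.I by push_cast; ring,
    Complex.norm_exp_ofReal_mul_I, mul_one]

theorem integrable_smul_heis {κ : ℝ → ℂ} (hκ : Integrable κ) (O : Matrix n n ℂ) :
    Integrable fun s : ℝ => κ s • heis U e s O := by
  refine (integrable_bohr U e (φ := fun s ν => κ s * Complex.exp (Complex.I * s * ν))
    (fun ν => integrable_mul_phase hκ ν) O).congr (Filter.Eventually.of_forall fun s => ?_)
  exact bohr_const_mul U e _ _ O

/-- A function of the Bohr frequencies that is a Fourier transform is an average of Heisenberg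
evolutions. -/
theorem bohr_fourier {κ : ℝ → ℂ} (hκ : Integrable κ) (O : Matrix n n ℂ) :
    bohr U e (fun ν => ∫ s, κ s * Complex.exp (Complex.I * s * ν)) O =
      ∫ s, κ s • heis U e s O := by
  rw [bohr_integral U e (φ := fun s ν => κ s * Complex.exp (Complex.I * s * ν))
    (fun ν => integrable_mul_phase hκ ν) O]
  exact integral_congr_ae (Filter.Eventually.of_forall fun s => bohr_const_mul U e _ _ O)

theorem norm_bohr_fourier_le {κ : ℝ → ℂ} (hκ : Integrable κ) (O : Matrix n n ℂ) :
    ‖bohr U e (fun ν => ∫ s, κ s * Complex.exp (Complex.I * s * ν)) O‖ ≤ (∫ s, ‖κ s‖) * ‖O‖ := by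
  rw [bohr_fourier U e hκ, ← integral_mul_const]
  refine norm_integral_le_of_norm_le (hκ.norm.mul_const _) (Filter.Eventually.of_forall fun s => ?_)
  rw [norm_smul, norm_heis]

end Bohr

/-! ### The spectral decomposition of a Hermitian matrix -/

section Spectral

variable {n : Type*} [Fintype n] [DecidableEq n]

theorem exp_smul_eq_gexp {H : Matrix n n ℂ} (hH : H.IsHermitian) (z : ℂ) (β : ℝ) :
    NormedSpace.exp ((z * β) • H) =
      gexp hH.eigenvectorUnitary (fun i => β * hH.eigenvalues i) z := by
  have hsp := hH.spectral_theorem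
  rw [Unitary.conjStarAlgAut_apply] at hsp
  have h2 := Matrix.exp_units_conj (Unitary.toUnits hH.eigenvectorUnitary)
    ((z * β) • Matrix.diagonal (RCLike.ofReal ∘ hH.eigenvalues))
  have h3 : (z * β) • H = ((Unitary.toUnits hH.eigenvectorUnitary : (Matrix n n ℂ)ˣ) :
      Matrix n n ℂ) * ((z * β) • Matrix.diagonal (RCLike.ofReal ∘ hH.eigenvalues)) *
      (((Unitary.toUnits hH.eigenvectorUnitary)⁻¹ : (Matrix n n ℂ)ˣ) : Matrix n n ℂ) := by
    conv_lhs => rw [hsp]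
    rw [Matrix.mul_smul, Matrix.smul_mul]; rfl
  rw [h3, h2, ← Matrix.diagonal_smul, Matrix.exp_diagonal, gexp]
  congr 3
  funext i
  rw [Pi.coe_exp]
  simp [Complex.exp_eq_exp_ℂ, mul_assoc]

variable {Λ : Type} [Fintype Λ] [DecidableEq Λ]

/-- Measuring time in units of `β` replaces the Hamiltonian `H` by `K = βH`. -/
theorem heisenberg_eq_heis {H : Op Λ} (hH : H.IsHermitian) (A : Op Λ) (β s : ℝ) :
    heisenberg H A (β * s) = heis hH.eigenvectorUnitary (fun i => β * hH.eigenvalues i) s A := by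
  rw [heis_eq, ← exp_smul_eq_gexp, ← exp_smul_eq_gexp, heisenberg]
  congr 4 <;> push_cast <;> ring

theorem gibbs_eq_gexp {H : Op Λ} (hH : H.IsHermitian) (β : ℝ) :
    gibbs H β = (gexp hH.eigenvectorUnitary (fun i => β * hH.eigenvalues i) (-1)).trace⁻¹ •
      gexp hH.eigenvectorUnitary (fun i => β * hH.eigenvalues i) (-1) := by
  rw [gibbs, ← exp_smul_eq_gexp, neg_one_mul]

theorem rot_energyProj {H : Op Λ} (hH : H.IsHermitian) (E : ℝ) :
    rot hH.eigenvectorUnitary (energyProj hH E) =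
      Matrix.diagonal fun i => if hH.eigenvalues i = E then 1 else 0 := by
  have h : energyProj hH E = (hH.eigenvectorUnitary : Op Λ) *
      (Matrix.diagonal fun i => if hH.eigenvalues i = E then 1 else 0) *
      star (hH.eigenvectorUnitary : Op Λ) := by
    ext a b
    rw [Matrix.mul_apply]
    simp only [Matrix.mul_diagonal, energyProj, Matrix.sum_apply, Matrix.vecMulVec_apply,
      Matrix.star_apply, Matrix.IsHermitian.eigenvectorUnitary_apply, Finset.sum_filter,
      Pi.star_apply]
    exact Finset.sum_congr rfl fun k _ => by split_ifs <;> simp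
  rw [h, rot_conj]

/-- The double sum over the spectral projectors multiplies the component of Bohr frequency `ν` of
the decay operator by `(i/2) tanh (ν/4)`. -/
theorem coherentTerm_eq_bohr {H : Op Λ} (hH : H.IsHermitian) (β σ : ℝ) (A : Op Λ) :
    coherentTerm hH β σ A = bohr hH.eigenvectorUnitary (fun i => β * hH.eigenvalues i)
      (fun ν => Complex.I / 2 * (Real.tanh (ν / 4) : ℂ)) (decayOp H β σ A) := by
  refine eq_of_rot hH.eigenvectorUnitary fun i j => ?_
  have hsum : ∀ {ι : Type} (s : Finset ι) (F : ι → Op Λ),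
      rot hH.eigenvectorUnitary (∑ k ∈ s, F k) = ∑ k ∈ s, rot hH.eigenvectorUnitary (F k) :=
    fun s F => by simp only [rot, Finset.mul_sum, Finset.sum_mul]
  have hmem : ∀ k, hH.eigenvalues k ∈ energies hH := fun k =>
    Finset.mem_image_of_mem _ (Finset.mem_univ k)
  rw [rot_bohr, coherentTerm]
  simp only [hsum, rot_smul, rot_mul, rot_energyProj, Matrix.sum_apply, Matrix.smul_apply,
    Matrix.mul_diagonal, Matrix.diagonal_mul, smul_eq_mul]
  rw [Finset.sum_eq_single_of_mem _ (hmem j), Finset.sum_eq_single_of_mem _ (hmem i)]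
  · simp only [if_true, one_mul, mul_one]
    rw [mul_sub]
  · intro E _ hE; simp [hE.symm]
  · intro E _ hE; simp [hE.symm]

end Spectral

/-! ### Gaussian and hyperbolic Fourier transforms -/

section Fourier

open MeasureTheory

/-- The substitution `x = 1 / (1 + e⁻ᵗ)` turns the Beta integral `B(1/2 + is, 1/2 - is)` into the
Fourier transform of the hyperbolic secant. -/
theorem integral_exp_div_cosh (s : ℝ) :
    ∫ t : ℝ, Complex.exp (Complex.I * s * t) / (2 * Complex.cosh (t / 2)) =
      Real.pi / Complex.cosh (Real.pi * s) := by
  have hB := Complex.Gamma_mul_Gamma_eq_betaIntegral (s := 1 / 2 + Complex.I * s)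
    (t := 1 - (1 / 2 + Complex.I * s)) (by simp) (by norm_num)
  rw [Complex.Gamma_mul_Gamma_one_sub, add_sub_cancel, Complex.Gamma_one, one_mul] at hB
  have hsin : Complex.sin (Real.pi * (1 / 2 + Complex.I * s)) = Complex.cosh (Real.pi * s) := by
    rw [← Complex.cos_mul_I, ← Complex.sin_add_pi_div_two]
    congr 1; ring
  rw [hsin] at hB
  rw [hB, Complex.betaIntegral, intervalIntegral.integral_of_le zero_le_one,
    integral_Ioc_eq_integral_Ioo, ← Real.range_sigmoid, ← Set.image_univ,
    integral_image_eq_integral_abs_deriv_smul MeasurableSet.univ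
      (fun x _ => (Real.hasDerivAt_sigmoid x).hasDerivWithinAt) Real.sigmoid_injective.injOn,
    Measure.restrict_univ]
  refine integral_congr_ae (Filter.Eventually.of_forall fun t => ?_)
  have hx0 := Real.sigmoid_pos t
  have hx1 : 0 < 1 - Real.sigmoid t := sub_pos.2 (Real.sigmoid_lt_one t)
  have hl0 : Real.log (Real.sigmoid t) = -Real.log (1 + Real.exp (-t)) := by
    rw [Real.sigmoid_def, Real.log_inv]
  have hl1 : Real.log (1 - Real.sigmoid t) = -t - Real.log (1 + Real.exp (-t)) := by
    rw [← Real.sigmoid_neg, ← Real.sigmoid_mul_rexp_neg, Real.log_mul hx0.ne' (Real.exp_ne_zero _),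
      Real.log_exp, hl0]
    ring
  simp only [Complex.real_smul]
  rw [abs_of_pos (mul_pos hx0 hx1), show (1 : ℂ) - (Real.sigmoid t : ℂ) =
      ((1 - Real.sigmoid t : ℝ) : ℂ) by push_cast; rfl,
    Complex.cpow_def_of_ne_zero (by exact_mod_cast hx0.ne'),
    Complex.cpow_def_of_ne_zero (by exact_mod_cast hx1.ne'), ← Complex.ofReal_log hx0.le,
    ← Complex.ofReal_log hx1.le]
  have e0 : ((Real.sigmoid t * (1 - Real.sigmoid t) : ℝ) : ℂ) =
      Complex.exp (Real.log (Real.sigmoid t)) * Complex.exp (Real.log (1 - Real.sigmoid t)) := by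
    rw [← Complex.ofReal_exp, ← Complex.ofReal_exp, Real.exp_log hx0, Real.exp_log hx1]
    push_cast; rfl
  rw [e0, ← Complex.exp_add, ← Complex.exp_add, ← Complex.exp_add, hl0, hl1, Complex.cosh]
  set L : ℝ := Real.log (1 + Real.exp (-t)) with hL
  have hpos : (0 : ℝ) < 1 + Real.exp (-t) := by positivity
  have hexpL : Complex.exp (L : ℂ) = 1 + Complex.exp (-(t : ℂ)) := by
    rw [← Complex.ofReal_exp, hL, Real.exp_log hpos]
    push_cast; rfl
  have hden : 2 * ((Complex.exp ((t : ℂ) / 2) + Complex.exp (-((t : ℂ) / 2))) / 2) =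
      Complex.exp ((t : ℂ) / 2 + L) := by
    rw [Complex.exp_add, hexpL, mul_add, mul_one, ← Complex.exp_add]
    rw [show (t : ℂ) / 2 + -(t : ℂ) = -((t : ℂ) / 2) by ring]
    ring
  rw [hden, ← Complex.exp_sub]
  congr 1
  push_cast
  ring

/-- The kernel `1 / cosh (2πt)`. -/
def sechKernel (t : ℝ) : ℝ := (Real.cosh (2 * Real.pi * t))⁻¹

theorem sechKernel_pos (t : ℝ) : 0 < sechKernel t := inv_pos.2 (Real.cosh_pos _)

theorem continuous_sechKernel : Continuous sechKernel :=
  (Real.continuous_cosh.comp (by fun_prop)).inv₀ fun t => (Real.cosh_pos _).ne'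

theorem sechKernel_mul_exp_le (t : ℝ) : sechKernel t * Real.exp |t| ≤ 2 * (1 + t ^ 2)⁻¹ := by
  have h1 : Real.exp (6 * |t|) ≤ 2 * Real.cosh (2 * Real.pi * t) := by
    rw [← Real.cosh_abs, Real.cosh_eq, abs_mul, abs_of_pos Real.two_pi_pos]
    have : Real.exp (6 * |t|) ≤ Real.exp (2 * Real.pi * |t|) := by
      gcongr
      linarith [Real.pi_gt_three]
    linarith [Real.exp_pos (-(2 * Real.pi * |t|))]
  have h2 : 1 + t ^ 2 ≤ Real.exp (5 * |t|) := by
    have := Real.quadratic_le_exp_of_nonneg (show 0 ≤ 5 * |t| by positivity)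
    nlinarith [sq_abs t, abs_nonneg t]
  have h3 : Real.exp (6 * |t|) = Real.exp (5 * |t|) * Real.exp |t| := by
    rw [← Real.exp_add]; ring_nf
  rw [sechKernel, inv_mul_eq_div, div_le_iff₀ (Real.cosh_pos _), ← div_eq_mul_inv,
    div_mul_eq_mul_div, le_div_iff₀ (by positivity)]
  calc Real.exp |t| * (1 + t ^ 2) ≤ Real.exp |t| * Real.exp (5 * |t|) := by gcongr
    _ ≤ _ := by linarith

theorem integrable_sechKernel_mul_exp : Integrable fun t => sechKernel t * Real.exp |t| := by
  refine (integrable_inv_one_add_sq.const_mul 2).mono'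
    ((continuous_sechKernel.mul (by fun_prop)).aestronglyMeasurable)
    (Filter.Eventually.of_forall fun t => ?_)
  rw [Real.norm_of_nonneg (mul_nonneg (sechKernel_pos t).le (Real.exp_pos _).le)]
  exact sechKernel_mul_exp_le t

theorem integrable_sechKernel : Integrable sechKernel := by
  refine integrable_sechKernel_mul_exp.mono' continuous_sechKernel.aestronglyMeasurable
    (Filter.Eventually.of_forall fun t => ?_)
  rw [Real.norm_of_nonneg (sechKernel_pos t).le]
  exact le_mul_of_one_le_right (sechKernel_pos t).le (Real.one_le_exp (abs_nonneg t))

/-- The kernel `1 / cosh (2πt)` has Fourier transform `1 / (2 cosh (ν/4))`. -/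
theorem integral_sechKernel_mul_exp (ν : ℝ) :
    ∫ t : ℝ, (sechKernel t : ℂ) * Complex.exp (Complex.I * t * ν) =
      (2 * Complex.cosh (ν / 4))⁻¹ := by
  have hπ : (Real.pi : ℂ) ≠ 0 := by exact_mod_cast Real.pi_ne_zero
  have h := integral_exp_div_cosh (ν / (4 * Real.pi))
  have h2 := Measure.integral_comp_mul_left (fun t : ℝ => Complex.exp (Complex.I *
    (ν / (4 * Real.pi) : ℝ) * t) / (2 * Complex.cosh (t / 2))) (4 * Real.pi)
  rw [h, abs_of_pos (by positivity)] at h2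
  have h3 : ∀ t : ℝ, (sechKernel t : ℂ) * Complex.exp (Complex.I * t * ν) =
      2 * (Complex.exp (Complex.I * (ν / (4 * Real.pi) : ℝ) * (4 * Real.pi * t : ℝ)) /
        (2 * Complex.cosh ((4 * Real.pi * t : ℝ) / 2))) := fun t => by
    rw [sechKernel]
    push_cast
    rw [show Complex.I * (ν / (4 * Real.pi)) * (4 * Real.pi * t) = Complex.I * t * ν by
        field_simp, show (4 * Real.pi * t : ℂ) / 2 = 2 * Real.pi * t by ring, inv_mul_eq_div]
    have : Complex.cosh (2 * Real.pi * t) ≠ 0 := by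
      have := (Real.cosh_pos (2 * Real.pi * t)).ne'
      intro h0
      exact this (by exact_mod_cast h0)
    field_simp
  simp_rw [h3]
  rw [integral_const_mul, h2, Complex.real_smul]
  push_cast
  rw [show (Real.pi : ℂ) * (ν / (4 * Real.pi)) = ν / 4 by field_simp]
  have : Complex.cosh (ν / 4) ≠ 0 := by
    have := (Real.cosh_pos (ν / 4)).ne'
    intro h0
    exact this (by exact_mod_cast h0)
  field_simp
  norm_num

/-- The Fourier transform `(2π)^{-1/4} e^{-y²/4}` of the Gaussian filter of unit width. -/
def gaussAmp (y : ℝ) : ℝ := Real.sqrt (Real.sqrt (2 * Real.pi))⁻¹ * Real.exp (-(y ^ 2 / 4))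

/-- The Gaussian filter of unit width, translated by the complex number `c`. -/
def window (c : ℂ) (s : ℝ) : ℂ :=
  (Real.sqrt (Real.sqrt (2 / Real.pi)) : ℂ) * Complex.exp (-(s + c) ^ 2)

/-- The Fourier transform of `window c`. -/
def windowAmp (c : ℂ) (y : ℝ) : ℂ := Complex.exp (Complex.I * y * c) * gaussAmp y

theorem continuous_window (c : ℂ) : Continuous (window c) := by unfold window; fun_prop

theorem continuous_windowAmp (c : ℂ) : Continuous (windowAmp c) := by
  unfold windowAmp gaussAmp; fun_prop

theorem integrable_window (c : ℂ) : Integrable (window c) := by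
  refine ((integrable_cexp_quadratic (b := 1) (by simp) (-2 * c) (-c ^ 2)).const_mul
    (Real.sqrt (Real.sqrt (2 / Real.pi)) : ℂ)).congr
    (Filter.Eventually.of_forall fun s => ?_)
  simp only [window]
  congr 2; ring

theorem integrable_windowAmp (c : ℂ) : Integrable (windowAmp c) := by
  refine ((integrable_cexp_quadratic (b := 1 / 4) (by norm_num) (Complex.I * c) 0).const_mul
    (Real.sqrt (Real.sqrt (2 * Real.pi))⁻¹ : ℂ)).congr
    (Filter.Eventually.of_forall fun s => ?_)
  simp only [windowAmp, gaussAmp]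
  push_cast
  rw [mul_left_comm, ← Complex.exp_add]
  congr 2; ring

theorem gauss_const : (Real.sqrt (2 * Real.pi))⁻¹ * Real.sqrt (Real.sqrt (2 / Real.pi)) *
    Real.sqrt Real.pi = Real.sqrt (Real.sqrt (2 * Real.pi))⁻¹ := by
  have hπ := Real.pi_pos
  rw [eq_comm, Real.sqrt_eq_iff_mul_self_eq (by positivity) (by positivity)]
  have h1 : Real.sqrt (2 / Real.pi) * Real.pi = Real.sqrt (2 * Real.pi) := by
    rw [eq_comm, Real.sqrt_eq_iff_mul_self_eq (by positivity) (by positivity)]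
    rw [mul_mul_mul_comm, Real.mul_self_sqrt (by positivity)]
    field_simp
  have h2 : Real.sqrt (Real.sqrt (2 / Real.pi)) * Real.sqrt (Real.sqrt (2 / Real.pi)) =
      Real.sqrt (2 / Real.pi) := Real.mul_self_sqrt (Real.sqrt_nonneg _)
  have h3 : Real.sqrt Real.pi * Real.sqrt Real.pi = Real.pi := Real.mul_self_sqrt hπ.le
  symm
  calc _ = ((Real.sqrt (2 * Real.pi))⁻¹ * (Real.sqrt (2 * Real.pi))⁻¹) *
        ((Real.sqrt (Real.sqrt (2 / Real.pi)) * Real.sqrt (Real.sqrt (2 / Real.pi))) *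
        (Real.sqrt Real.pi * Real.sqrt Real.pi)) := by ring
    _ = _ := by
      rw [h2, h3, h1]
      have : Real.sqrt (2 * Real.pi) ≠ 0 := (Real.sqrt_pos.2 (by positivity)).ne'
      field_simp

theorem window_fourier (c : ℂ) (y : ℝ) :
    (Real.sqrt (2 * Real.pi) : ℂ)⁻¹ * ∫ s : ℝ, window c s * Complex.exp (-(Complex.I * y * s)) =
      windowAmp c y := by
  have h1 : ∀ s : ℝ, window c s * Complex.exp (-(Complex.I * y * s)) =
      (Real.sqrt (Real.sqrt (2 / Real.pi)) : ℂ) *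
        Complex.exp (-1 * s ^ 2 + (-2 * c - Complex.I * y) * s + -c ^ 2) := fun s => by
    rw [window, mul_assoc, ← Complex.exp_add]
    congr 2; ring
  simp_rw [h1]
  rw [integral_const_mul, integral_cexp_quadratic (by simp)]
  have h2 : ((Real.pi : ℂ) / - -1) ^ (1 / 2 : ℂ) = (Real.sqrt Real.pi : ℂ) := by
    rw [neg_neg, div_one, Real.sqrt_eq_rpow, Complex.ofReal_cpow Real.pi_pos.le]
    norm_num
  rw [h2, windowAmp, gaussAmp, ← gauss_const]
  push_cast
  have h3 : Complex.exp (-c ^ 2 - (-2 * c - Complex.I * y) ^ 2 / (4 * -1)) =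
      Complex.exp (Complex.I * y * c) * Complex.exp (-((y : ℂ) ^ 2 / 4)) := by
    rw [← Complex.exp_add]
    congr 1
    linear_combination (y : ℂ) ^ 2 / 4 * Complex.I_sq
  rw [h3]
  ring

theorem norm_window (c : ℂ) (s : ℝ) : ‖window c s‖ =
    Real.sqrt (Real.sqrt (2 / Real.pi)) * Real.exp (c.im ^ 2 - (s + c.re) ^ 2) := by
  rw [window, norm_mul, Complex.norm_real, Real.norm_of_nonneg (Real.sqrt_nonneg _),
    Complex.norm_exp]
  congr 2
  simp [pow_two]

/-- The exponential growth `e^{-y Im c}` of the phase factor is absorbed by the Gaussian. -/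
theorem norm_windowAmp_le (c : ℂ) (y : ℝ) : ‖windowAmp c y‖ ≤ Real.exp (c.im ^ 2) := by
  rw [windowAmp, gaussAmp, norm_mul, Complex.norm_exp, Complex.norm_real, norm_mul,
    Real.norm_of_nonneg (Real.sqrt_nonneg _), Real.norm_of_nonneg (Real.exp_pos _).le]
  have h1 : Real.sqrt (Real.sqrt (2 * Real.pi))⁻¹ ≤ 1 := by
    rw [Real.sqrt_le_one]
    refine inv_le_one_of_one_le₀ ?_
    rw [Real.one_le_sqrt]
    linarith [Real.pi_gt_three]
  calc _ ≤ Real.exp ((Complex.I * y * c).re) * (1 * Real.exp (-(y ^ 2 / 4))) := by gcongr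
    _ = Real.exp (-(y * c.im) - y ^ 2 / 4) := by
      rw [one_mul, ← Real.exp_add]; congr 1; simp; ring
    _ ≤ _ := by
      gcongr
      nlinarith [sq_nonneg (c.im + y / 2)]

/-- The Gaussian Plancherel identity on pairs of plane waves. -/
theorem windowAmp_plancherel (c : ℂ) (ν ν' : ℝ) :
    ∫ ω : ℝ, star (windowAmp c (ω - ν)) * windowAmp c (ω - ν') =
      ∫ s : ℝ, ((‖window c s‖ ^ 2 : ℝ) : ℂ) * Complex.exp (Complex.I * s * ((ν' - ν : ℝ) : ℂ)) := by
  have hπ := Real.pi_pos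
  have hc : c = c.re + c.im * Complex.I := (Complex.re_add_im c).symm
  have hc' : star c = c.re - c.im * Complex.I := by
    apply Complex.ext <;> simp
  have h1 : ∀ ω : ℝ, star (windowAmp c (ω - ν)) * windowAmp c (ω - ν') =
      (((Real.sqrt (2 * Real.pi))⁻¹ : ℝ) : ℂ) * Complex.exp (-(1 / 2) * ω ^ 2 +
        (-Complex.I * star c + Complex.I * c + (ν + ν') / 2) * ω +
        (Complex.I * ν * star c - Complex.I * ν' * c - (ν ^ 2 + ν' ^ 2) / 4)) := fun ω => by
    have h2 : star (windowAmp c (ω - ν)) =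
        Complex.exp (-(Complex.I * ((ω - ν : ℝ) : ℂ) * star c)) * gaussAmp (ω - ν) := by
      rw [windowAmp, star_mul', RCLike.star_def, ← Complex.exp_conj, Complex.conj_ofReal]
      simp
    have hamp := Real.mul_self_sqrt (show 0 ≤ (Real.sqrt (2 * Real.pi))⁻¹ by positivity)
    rw [h2, windowAmp, gaussAmp, gaussAmp]
    generalize Real.sqrt (Real.sqrt (2 * Real.pi))⁻¹ = q at hamp ⊢
    rw [← hamp]
    push_cast
    rw [show ∀ a b c d f : ℂ, a * (b * c) * (d * (b * f)) = b * b * (a * c * (d * f)) by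
      intros; ring]
    simp only [← Complex.exp_add]
    congr 2
    ring
  have h2 : ∀ s : ℝ, ((‖window c s‖ ^ 2 : ℝ) : ℂ) *
      Complex.exp (Complex.I * s * ((ν' - ν : ℝ) : ℂ)) =
      ((Real.sqrt (2 / Real.pi) : ℝ) : ℂ) * Complex.exp (-2 * s ^ 2 +
        (-4 * c.re + Complex.I * (ν' - ν)) * s + (2 * c.im ^ 2 - 2 * c.re ^ 2)) := fun s => by
    rw [norm_window, mul_pow, Real.sq_sqrt (Real.sqrt_nonneg _), ← Real.exp_nat_mul]
    push_cast
    rw [mul_assoc, ← Complex.exp_add]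
    congr 2
    ring
  simp_rw [h1, h2]
  rw [integral_const_mul, integral_const_mul, integral_cexp_quadratic (by norm_num),
    integral_cexp_quadratic (by norm_num)]
  have hs : ∀ x : ℝ, 0 ≤ x → (x : ℂ) ^ (1 / 2 : ℂ) = (Real.sqrt x : ℂ) := fun x hx => by
    rw [Real.sqrt_eq_rpow, Complex.ofReal_cpow hx]
    norm_num
  have h3 : ((Real.pi : ℂ) / - -(1 / 2)) ^ (1 / 2 : ℂ) = (Real.sqrt (2 * Real.pi) : ℂ) := by
    rw [← hs _ (by positivity)]
    congr 1; push_cast; ring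
  have h4 : ((Real.pi : ℂ) / - -2) ^ (1 / 2 : ℂ) = (Real.sqrt (Real.pi / 2) : ℂ) := by
    rw [← hs _ (by positivity)]
    congr 1; push_cast; ring
  rw [h3, h4, ← mul_assoc, ← mul_assoc, ← Complex.ofReal_mul, ← Complex.ofReal_mul,
    inv_mul_cancel₀ (Real.sqrt_pos.2 (by positivity)).ne', ← Real.sqrt_mul (by positivity),
    show 2 / Real.pi * (Real.pi / 2) = 1 by field_simp, Real.sqrt_one]
  congr 2
  have key : ∀ a b x y : ℂ, Complex.I * x * (a - b * Complex.I) -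
      Complex.I * y * (a + b * Complex.I) - (x ^ 2 + y ^ 2) / 4 -
      (-Complex.I * (a - b * Complex.I) + Complex.I * (a + b * Complex.I) + (x + y) / 2) ^ 2 /
        (4 * -(1 / 2)) =
      2 * b ^ 2 - 2 * a ^ 2 - (-4 * a + Complex.I * (y - x)) ^ 2 / (4 * -2) := fun a b x y => by
    have hI := Complex.I_sq
    have hI4 : Complex.I ^ 4 = 1 := by rw [show 4 = 2 * 2 by rfl, pow_mul, hI]; norm_num
    ring_nf
    simp only [hI, hI4]
    ring
  have h5 := key c.re c.im ν ν'
  rw [← hc, ← hc'] at h5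
  exact h5

end Fourier

/-! ### The windowed Fourier transform and Plancherel's identity -/

section Window

open MeasureTheory

/-- The function `s ↦ e^{iνs}`. -/
def planeWave (ν s : ℝ) : ℂ := Complex.exp (Complex.I * s * ν)

/-- Trigonometric polynomials: finite linear combinations of plane waves. -/
def IsTrig (p : ℝ → ℂ) : Prop := p ∈ Submodule.span ℂ (Set.range planeWave)

theorem isTrig_planeWave (ν : ℝ) : IsTrig (planeWave ν) := Submodule.subset_span ⟨ν, rfl⟩

theorem IsTrig.sub {p q : ℝ → ℂ} (hp : IsTrig p) (hq : IsTrig q) : IsTrig fun s => p s - q s :=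
  Submodule.sub_mem _ hp hq

theorem IsTrig.const_mul {p : ℝ → ℂ} (hp : IsTrig p) (c : ℂ) : IsTrig fun s => c * p s :=
  Submodule.smul_mem _ c hp

theorem IsTrig.mul_const {p : ℝ → ℂ} (hp : IsTrig p) (c : ℂ) : IsTrig fun s => p s * c := by
  simpa only [mul_comm] using hp.const_mul c

theorem IsTrig.sum {ι : Type*} {S : Finset ι} {p : ι → ℝ → ℂ} (hp : ∀ i ∈ S, IsTrig (p i)) :
    IsTrig fun s => ∑ i ∈ S, p i s := by
  have := Submodule.sum_mem (Submodule.span ℂ (Set.range planeWave)) hp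
  rw [IsTrig]
  convert this using 1
  funext s
  simp

theorem IsTrig.exists_sum {p : ℝ → ℂ} (hp : IsTrig p) :
    ∃ (S : Finset ℝ) (a : ℝ → ℂ), ∀ s, p s = ∑ k ∈ S, a k * planeWave k s := by
  obtain ⟨f, rfl⟩ := Finsupp.mem_span_range_iff_exists_finsupp.1 hp
  refine ⟨f.support, f, fun s => ?_⟩
  simp [Finsupp.sum, Finset.sum_apply]

/-- The Fourier transform of `p` in the Gaussian window translated by `c`. -/
def windowT (c : ℂ) (p : ℝ → ℂ) (ω : ℝ) : ℂ :=
  (Real.sqrt (2 * Real.pi) : ℂ)⁻¹ * ∫ s : ℝ, window c s * Complex.exp (-(Complex.I * ω * s)) * p s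

theorem norm_phase (x y : ℝ) : ‖Complex.exp (-(Complex.I * x * y))‖ = 1 := by
  rw [show -(Complex.I * x * y) = ((-(x * y) : ℝ) : ℂ) * Complex.I by push_cast; ring,
    Complex.norm_exp_ofReal_mul_I]

theorem integrable_window_phase (c : ℂ) (ω : ℝ) :
    Integrable fun s : ℝ => window c s * Complex.exp (-(Complex.I * ω * s)) := by
  refine (integrable_window c).norm.mono' ((continuous_window c).mul (by fun_prop)
    |>.aestronglyMeasurable) (Filter.Eventually.of_forall fun s => ?_)
  rw [norm_mul, norm_phase, mul_one]

theorem integrable_window_trig (c : ℂ) {p : ℝ → ℂ} (hp : IsTrig p) (ω : ℝ) :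
    Integrable fun s : ℝ => window c s * Complex.exp (-(Complex.I * ω * s)) * p s := by
  obtain ⟨S, a, h⟩ := hp.exists_sum
  simp only [h, Finset.mul_sum]
  refine integrable_finsetSum _ fun k _ => ?_
  refine ((integrable_window_phase c (ω - k)).const_mul (a k)).congr
    (Filter.Eventually.of_forall fun s => ?_)
  simp only [planeWave]
  rw [show -(Complex.I * ((ω - k : ℝ) : ℂ) * s) = -(Complex.I * ω * s) + Complex.I * s * k by
    push_cast; ring, Complex.exp_add]
  ring

theorem windowT_planeWave (c : ℂ) (k ω : ℝ) : windowT c (planeWave k) ω = windowAmp c (ω - k) := by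
  rw [← window_fourier, windowT]
  congr 2
  funext s
  rw [planeWave, mul_assoc, ← Complex.exp_add]
  congr 2
  push_cast; ring

theorem windowT_sum (c : ℂ) (S : Finset ℝ) (a : ℝ → ℂ) (ω : ℝ) :
    windowT c (fun s => ∑ k ∈ S, a k * planeWave k s) ω = ∑ k ∈ S, a k * windowAmp c (ω - k) := by
  simp only [← windowT_planeWave, windowT, Finset.mul_sum]
  rw [integral_finsetSum, Finset.mul_sum]
  · refine Finset.sum_congr rfl fun k _ => ?_
    rw [mul_left_comm, ← integral_const_mul (a k)]
    congr 2; funext s; ring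
  · intro k _
    exact integrable_window_trig c ((isTrig_planeWave k).const_mul (a k)) ω

theorem integrable_windowAmp_sub (c : ℂ) (ν : ℝ) : Integrable fun ω => windowAmp c (ω - ν) :=
  (integrable_windowAmp c).comp_sub_right ν

theorem integrable_star_windowAmp_mul (c c' : ℂ) (ν ν' : ℝ) :
    Integrable fun ω => star (windowAmp c (ω - ν)) * windowAmp c' (ω - ν') :=
  (integrable_windowAmp_sub c' ν').bdd_mul (c := Real.exp (c.im ^ 2))
    ((continuous_star.comp ((continuous_windowAmp c).comp (by fun_prop))).aestronglyMeasurable)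
    (Filter.Eventually.of_forall fun ω => by rw [norm_star]; exact norm_windowAmp_le _ _)

theorem integrable_norm_window_sq_mul (c : ℂ) (ν : ℝ) :
    Integrable fun s : ℝ => ((‖window c s‖ ^ 2 : ℝ) : ℂ) * Complex.exp (Complex.I * s * ν) := by
  have h : Integrable fun s : ℝ => ‖window c s‖ ^ 2 := by
    have h2 : ∀ s, ‖window c s‖ ≤ Real.sqrt (Real.sqrt (2 / Real.pi)) * Real.exp (c.im ^ 2) :=
      fun s => by
        rw [norm_window]
        gcongr
        nlinarith [sq_nonneg (s + c.re)]
    simp only [pow_two]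
    exact (integrable_window c).norm.bdd_mul ((continuous_window c).norm.aestronglyMeasurable)
      (Filter.Eventually.of_forall fun s => by rw [norm_norm]; exact h2 s)
  exact integrable_mul_phase h.ofReal ν

/-- Plancherel's identity for the windowed Fourier transform of a trigonometric polynomial. -/
theorem plancherel_scalar (c : ℂ) {p : ℝ → ℂ} (hp : IsTrig p) :
    Integrable (fun ω => ‖windowT c p ω‖ ^ 2) ∧ Integrable (fun s => ‖window c s‖ ^ 2 * ‖p s‖ ^ 2) ∧
      ∫ ω, ‖windowT c p ω‖ ^ 2 = ∫ s, ‖window c s‖ ^ 2 * ‖p s‖ ^ 2 := by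
  obtain ⟨S, a, h⟩ := hp.exists_sum
  obtain rfl : p = fun s => ∑ k ∈ S, a k * planeWave k s := funext h
  have hsq : ∀ z : ℂ, ((‖z‖ ^ 2 : ℝ) : ℂ) = star z * z := fun z => by
    rw [RCLike.star_def, Complex.conj_mul']; push_cast; rfl
  have h1 : ∀ ω, ((‖windowT c (fun s => ∑ k ∈ S, a k * planeWave k s) ω‖ ^ 2 : ℝ) : ℂ) =
      ∑ k ∈ S, ∑ l ∈ S, star (a k) * a l *
        (star (windowAmp c (ω - k)) * windowAmp c (ω - l)) := fun ω => by
    rw [hsq, windowT_sum, star_sum, Finset.sum_mul_sum]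
    refine Finset.sum_congr rfl fun k _ => Finset.sum_congr rfl fun l _ => ?_
    rw [star_mul']; ring
  have h2 : ∀ s, ((‖window c s‖ ^ 2 * ‖∑ k ∈ S, a k * planeWave k s‖ ^ 2 : ℝ) : ℂ) =
      ∑ k ∈ S, ∑ l ∈ S, star (a k) * a l *
        (((‖window c s‖ ^ 2 : ℝ) : ℂ) * Complex.exp (Complex.I * s * ((l - k : ℝ) : ℂ))) :=
    fun s => by
    rw [Complex.ofReal_mul, hsq (∑ k ∈ S, _), star_sum, Finset.sum_mul_sum, Finset.mul_sum]
    refine Finset.sum_congr rfl fun k _ => ?_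
    rw [Finset.mul_sum]
    refine Finset.sum_congr rfl fun l _ => ?_
    have h3 : Complex.exp (Complex.I * s * ((l - k : ℝ) : ℂ)) =
        star (planeWave k s) * planeWave l s := by
      rw [planeWave, planeWave, RCLike.star_def, ← Complex.exp_conj, ← Complex.exp_add]
      congr 1
      simp
      ring
    rw [h3, star_mul']; ring
  have i1 : Integrable fun ω => ∑ k ∈ S, ∑ l ∈ S, star (a k) * a l *
        (star (windowAmp c (ω - k)) * windowAmp c (ω - l)) :=
    integrable_finsetSum _ fun k _ => integrable_finsetSum _ fun l _ =>
      (integrable_star_windowAmp_mul c c k l).const_mul _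
  have i2 : Integrable fun s => ∑ k ∈ S, ∑ l ∈ S, star (a k) * a l *
        (((‖window c s‖ ^ 2 : ℝ) : ℂ) * Complex.exp (Complex.I * s * ((l - k : ℝ) : ℂ))) :=
    integrable_finsetSum _ fun k _ => integrable_finsetSum _ fun l _ =>
      (integrable_norm_window_sq_mul c (l - k)).const_mul _
  refine ⟨?_, ?_, ?_⟩
  · simp only [← h1] at i1
    exact i1.re
  · simp only [← h2] at i2
    exact i2.re
  · apply Complex.ofReal_injective
    rw [← integral_complex_ofReal, ← integral_complex_ofReal]
    simp only [h1, h2]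
    rw [integral_finsetSum _ fun k _ => integrable_finsetSum _ fun l _ =>
      (integrable_star_windowAmp_mul c c k l).const_mul _,
      integral_finsetSum _ fun k _ => integrable_finsetSum _ fun l _ =>
      (integrable_norm_window_sq_mul c (l - k)).const_mul _]
    refine Finset.sum_congr rfl fun k _ => ?_
    rw [integral_finsetSum _ fun l _ => (integrable_star_windowAmp_mul c c k l).const_mul _,
      integral_finsetSum _ fun l _ => (integrable_norm_window_sq_mul c (l - k)).const_mul _]
    refine Finset.sum_congr rfl fun l _ => ?_
    rw [integral_const_mul, integral_const_mul, windowAmp_plancherel]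

variable {n : Type*} [Fintype n] [DecidableEq n]

/-- The windowed Fourier transform of a family of matrices. -/
def windowFT (c : ℂ) (O : ℝ → Matrix n n ℂ) (ω : ℝ) : Matrix n n ℂ :=
  (Real.sqrt (2 * Real.pi) : ℂ)⁻¹ •
    ∫ s : ℝ, (window c s * Complex.exp (-(Complex.I * ω * s))) • O s

/-- Families of matrices whose entries are trigonometric polynomials. -/
def IsTrigFamily (O : ℝ → Matrix n n ℂ) : Prop := ∀ i j, IsTrig fun s => O s i j

omit [Fintype n] [DecidableEq n] in
theorem IsTrigFamily.sub {O O' : ℝ → Matrix n n ℂ} (h : IsTrigFamily O) (h' : IsTrigFamily O') :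
    IsTrigFamily fun s => O s - O' s := fun i j => (h i j).sub (h' i j)

theorem isTrigFamily_heis (U : Matrix.unitaryGroup n ℂ) (e : n → ℝ) (A : Matrix n n ℂ) :
    IsTrigFamily fun s => heis U e s A := fun i j => by
  have h : ∀ s, heis U e s A i j = ∑ k, (∑ l, (U : Matrix n n ℂ) i l *
      (rot U A l k * planeWave (e l - e k) s)) * star (U : Matrix n n ℂ) k j := fun s => by
    conv_lhs => rw [← conj_rot U (heis U e s A)]
    simp only [Matrix.mul_apply (M := (U : Matrix n n ℂ) * _), Matrix.mul_apply, rot_heis,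
      planeWave]
    refine Finset.sum_congr rfl fun k _ => ?_
    congr 1
    refine Finset.sum_congr rfl fun l _ => ?_
    ring
  simp only [h]
  exact IsTrig.sum fun k _ => IsTrig.mul_const (IsTrig.sum fun l _ =>
    ((isTrig_planeWave _).const_mul _).const_mul _) _

theorem integrable_windowFT (c : ℂ) {O : ℝ → Matrix n n ℂ} (hO : IsTrigFamily O) (ω : ℝ) :
    Integrable fun s : ℝ => (window c s * Complex.exp (-(Complex.I * ω * s))) • O s :=
  integrable_of_entries fun i j => by
    simpa using integrable_window_trig c (hO i j) ω

theorem windowFT_apply (c : ℂ) {O : ℝ → Matrix n n ℂ} (hO : IsTrigFamily O) (ω : ℝ) (i j : n) :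
    windowFT c O ω i j = windowT c (fun s => O s i j) ω := by
  rw [windowFT, Matrix.smul_apply, integral_entry (integrable_windowFT c hO ω)]
  simp [windowT]

theorem windowFT_sub (c : ℂ) {O O' : ℝ → Matrix n n ℂ} (hO : IsTrigFamily O)
    (hO' : IsTrigFamily O') (ω : ℝ) :
    windowFT c (fun s => O s - O' s) ω = windowFT c O ω - windowFT c O' ω := by
  simp only [windowFT, smul_sub]
  rw [integral_sub (integrable_windowFT c hO ω) (integrable_windowFT c hO' ω), smul_sub]

/-- Plancherel's identity for the windowed Fourier transform of operators. -/
theorem plancherel_act (c : ℂ) {O : ℝ → Matrix n n ℂ} (hO : IsTrigFamily O)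
    (v : EuclideanSpace ℂ n) :
    Integrable (fun ω => ‖act (windowFT c O ω) v‖ ^ 2) ∧
      Integrable (fun s => ‖window c s‖ ^ 2 * ‖act (O s) v‖ ^ 2) ∧
      ∫ ω, ‖act (windowFT c O ω) v‖ ^ 2 = ∫ s, ‖window c s‖ ^ 2 * ‖act (O s) v‖ ^ 2 := by
  have hact : ∀ (M : Matrix n n ℂ) i, act M v i = ∑ j, M i j * v j := fun M i => by
    simp [act, Matrix.ofLp_toEuclideanCLM, Matrix.mulVec, dotProduct]
  have htrig : ∀ i, IsTrig fun s => act (O s) v i := fun i => by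
    simp only [hact]
    exact IsTrig.sum fun j _ => (hO i j).mul_const _
  have hw : ∀ i ω, act (windowFT c O ω) v i = windowT c (fun s => act (O s) v i) ω := fun i ω => by
    simp only [hact, windowFT_apply c hO, windowT, Finset.mul_sum]
    rw [integral_finsetSum _ fun j _ => by
      simpa only [mul_assoc] using (integrable_window_trig c (hO i j) ω).mul_const (v j),
      Finset.mul_sum]
    refine Finset.sum_congr rfl fun j _ => ?_
    rw [mul_assoc, ← integral_mul_const]
    congr 2
    funext s; ring
  have hp := fun i => plancherel_scalar c (htrig i)
  simp only [EuclideanSpace.norm_sq_eq, Finset.mul_sum, hw]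
  refine ⟨integrable_finsetSum _ fun i _ => (hp i).1,
    integrable_finsetSum _ fun i _ => (hp i).2.1, ?_⟩
  rw [integral_finsetSum _ fun i _ => (hp i).1, integral_finsetSum _ fun i _ => (hp i).2.1]
  exact Finset.sum_congr rfl fun i _ => (hp i).2.2

theorem windowFT_heis (U : Matrix.unitaryGroup n ℂ) (e : n → ℝ) (A : Matrix n n ℂ) (c : ℂ) (ω : ℝ) :
    windowFT c (fun s => heis U e s A) ω = bohr U e (fun ν => windowAmp c (ω - ν)) A := by
  rw [windowFT, ← bohr_fourier U e (integrable_window_phase c ω), ← bohr_const_mul]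
  congr 2
  funext ν
  rw [← windowT_planeWave]; rfl

theorem norm_windowFT_heis_le (U : Matrix.unitaryGroup n ℂ) (e : n → ℝ) (A : Matrix n n ℂ) (c : ℂ)
    (ω : ℝ) : ‖windowFT c (fun s => heis U e s A) ω‖ ≤ (∫ s, ‖window c s‖) * ‖A‖ := by
  rw [windowFT, ← bohr_fourier U e (integrable_window_phase c ω), norm_smul]
  have h1 : ‖((Real.sqrt (2 * Real.pi) : ℂ))⁻¹‖ ≤ 1 := by
    rw [norm_inv, Complex.norm_real, Real.norm_of_nonneg (Real.sqrt_nonneg _)]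
    refine inv_le_one_of_one_le₀ (Real.one_le_sqrt.2 ?_)
    linarith [Real.pi_gt_three]
  refine (mul_le_of_le_one_left (norm_nonneg _) h1).trans ?_
  refine (norm_bohr_fourier_le U e (integrable_window_phase c ω) A).trans (le_of_eq ?_)
  simp only [norm_mul, norm_phase, mul_one]

theorem integrable_windowFT_heis (U : Matrix.unitaryGroup n ℂ) (e : n → ℝ) (A : Matrix n n ℂ)
    (c : ℂ) : Integrable fun ω => windowFT c (fun s => heis U e s A) ω := by
  simp only [windowFT_heis]
  exact integrable_bohr U e (fun ν => integrable_windowAmp_sub c ν) A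

end Window

/-! ### The dual generator in the time unit of the inverse temperature -/

section Generator

open MeasureTheory

/-- The Metropolis weight at unit inverse temperature. -/
def metro (ω : ℝ) : ℝ := Real.exp (-max (ω + 1 / 2) 0)

theorem metro_nonneg (ω : ℝ) : 0 ≤ metro ω := (Real.exp_pos _).le

theorem metro_le_one (ω : ℝ) : metro ω ≤ 1 := Real.exp_le_one_iff.2 (by simp)

theorem continuous_metro : Continuous metro := by unfold metro; fun_prop

variable {n : Type*} [Fintype n] [DecidableEq n] (U : Matrix.unitaryGroup n ℂ) (e : n → ℝ)

/-- The Fourier transform of the Heisenberg evolution of `A` in the Gaussian window translated by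
`c`, for the Hamiltonian `U diag(e) U†`. -/
def freqComp (c : ℂ) (A : Matrix n n ℂ) (ω : ℝ) : Matrix n n ℂ :=
  windowFT c (fun s => heis U e s A) ω

variable (A : Matrix n n ℂ)

theorem freqComp_eq_bohr (c : ℂ) (ω : ℝ) :
    freqComp U e c A ω = bohr U e (fun ν => windowAmp c (ω - ν)) A := windowFT_heis U e A c ω

theorem integrable_freqComp (c : ℂ) : Integrable (freqComp U e c A) :=
  integrable_windowFT_heis U e A c

theorem integrable_sandwich_mixed (U' : Matrix.unitaryGroup n ℂ) (e' : n → ℝ) (c c' : ℂ)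
    (X : Matrix n n ℂ) : Integrable fun ω =>
      (metro ω : ℂ) • ((freqComp U e c A ω)ᴴ * X * freqComp U' e' c' A ω) := by
  have h1 := (integrable_freqComp U e A c).aestronglyMeasurable
  have h2 : AEStronglyMeasurable (fun ω => (metro ω : ℂ) • ((freqComp U e c A ω)ᴴ * X)) volume :=
    (Complex.continuous_ofReal.comp continuous_metro).aestronglyMeasurable.smul
      ((continuous_star.comp_aestronglyMeasurable h1).mul_const X)
  refine ((integrable_freqComp U' e' A c').bdd_mul (c := (∫ s, ‖window c s‖) * ‖A‖ * ‖X‖) h2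
    (Filter.Eventually.of_forall fun ω => ?_)).congr (Filter.Eventually.of_forall fun ω => ?_)
  · rw [norm_smul, Complex.norm_real, Real.norm_of_nonneg (metro_nonneg ω)]
    refine (mul_le_of_le_one_left (norm_nonneg _) (metro_le_one ω)).trans ?_
    refine (norm_mul_le _ _).trans ?_
    gcongr
    rw [Matrix.l2_opNorm_conjTranspose]
    exact norm_windowFT_heis_le U e A c ω
  · simp only [Matrix.smul_mul]

theorem integrable_sandwich (c c' : ℂ) (X : Matrix n n ℂ) :
    Integrable fun ω => (metro ω : ℂ) • ((freqComp U e c A ω)ᴴ * X * freqComp U e c' A ω) :=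
  integrable_sandwich_mixed U e A U e c c' X

/-- The decay operator `∫ γ(ω) A(ω)† A(ω) dω`. -/
def decay : Matrix n n ℂ :=
  ∫ ω, (metro ω : ℂ) • ((freqComp U e 0 A ω)ᴴ * 1 * freqComp U e 0 A ω)

/-- The operator `G = N/2 - iB`, where `N` is the decay operator and `B` the coherent term: its
component of Bohr frequency `ν` is `(1 + tanh(ν/4))/2 = e^{ν/4} / (2 cosh(ν/4))` times that of `N`.
-/
def effOp : Matrix n n ℂ :=
  bohr U e (fun ν => Complex.exp (ν / 4) / (2 * Complex.cosh (ν / 4))) (decay U e A)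

/-- The dual generator `X ↦ ∫ γ(ω) A(ω)† X A(ω) dω - G X - X G†`. -/
def jumpDual : Matrix n n ℂ →L[ℂ] Matrix n n ℂ :=
  (∫ ω, (metro ω : ℂ) • ContinuousLinearMap.mulLeftRight ℂ (Matrix n n ℂ) (freqComp U e 0 A ω)ᴴ
      (freqComp U e 0 A ω)) -
    ContinuousLinearMap.mul ℂ (Matrix n n ℂ) (effOp U e A) -
    (ContinuousLinearMap.mul ℂ (Matrix n n ℂ)).flip (effOp U e A)ᴴ

omit [Fintype n] [DecidableEq n] in
theorem integrable_smulRight {E F : Type*} [NormedAddCommGroup E] [NormedSpace ℂ E]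
    [NormedAddCommGroup F] [NormedSpace ℂ F] {α : Type*}
    [MeasurableSpace α] {μ : Measure α} (c : E →L[ℂ] ℂ) {f : α → F} (h : Integrable f μ) :
    Integrable (fun a => c.smulRight (f a)) μ := by
  refine (h.norm.const_mul ‖c‖).mono ?_ (Filter.Eventually.of_forall fun a => ?_)
  · have : Continuous fun x : F => c.smulRight x :=
      (ContinuousLinearMap.smulRightL ℂ E F c).continuous
    exact this.comp_aestronglyMeasurable h.aestronglyMeasurable
  · rw [ContinuousLinearMap.norm_smulRight_apply, Real.norm_of_nonneg (by positivity)]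

omit [Fintype n] [DecidableEq n] in
/-- A family of linear maps out of a finite-dimensional space is integrable once it is integrable
at every vector. -/
theorem integrable_clm {E F : Type*} [NormedAddCommGroup E] [NormedSpace ℂ E]
    [FiniteDimensional ℂ E] [NormedAddCommGroup F] [NormedSpace ℂ F] {α : Type*}
    [MeasurableSpace α] {μ : Measure α} {Φ : α → E →L[ℂ] F}
    (h : ∀ O, Integrable (fun a => Φ a O) μ) : Integrable Φ μ := by
  let b := Module.finBasis ℂ E
  let c : ∀ k, E →L[ℂ] ℂ := fun k => LinearMap.toContinuousLinearMap (b.coord k)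
  have h1 : Φ = fun a => ∑ k, (c k).smulRight (Φ a (b k)) := by
    funext a
    ext O
    conv_lhs => rw [← b.sum_repr O]
    simp only [map_sum, map_smul, sum_apply]
    rfl
  have h2 : Integrable (fun a => ∑ k, (c k).smulRight (Φ a (b k))) μ :=
    integrable_finsetSum (f := fun k a => (c k).smulRight (Φ a (b k))) Finset.univ
      fun k _ => integrable_smulRight (c k) (h (b k))
  rwa [← h1] at h2

theorem integrable_superOp {α : Type*} [MeasurableSpace α] {μ : Measure α}
    {Φ : α → Matrix n n ℂ →L[ℂ] Matrix n n ℂ} (h : ∀ O, Integrable (fun a => Φ a O) μ) :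
    Integrable Φ μ :=
  integrable_clm (E := Matrix n n ℂ) (F := Matrix n n ℂ) (Φ := Φ) h

theorem jumpDual_apply (X : Matrix n n ℂ) :
    jumpDual U e A X =
      (∫ ω, (metro ω : ℂ) • ((freqComp U e 0 A ω)ᴴ * X * freqComp U e 0 A ω)) -
        effOp U e A * X - X * (effOp U e A)ᴴ := by
  have h : Integrable fun ω => (metro ω : ℂ) • ContinuousLinearMap.mulLeftRight ℂ (Matrix n n ℂ)
      (freqComp U e 0 A ω)ᴴ (freqComp U e 0 A ω) :=
    integrable_superOp fun O => by simpa using integrable_sandwich U e A 0 0 O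
  simp only [jumpDual, sub_apply, ContinuousLinearMap.integral_apply h,
    smul_apply, ContinuousLinearMap.mulLeftRight_apply,
    ContinuousLinearMap.mul_apply', ContinuousLinearMap.flip_apply]

theorem decay_conjTranspose : (decay U e A)ᴴ = decay U e A := by
  rw [decay, conjTranspose_integral]
  congr 1
  funext ω
  simp [Matrix.conjTranspose_mul]

theorem two_cosh_ne_zero (x : ℝ) : (2 * Complex.cosh ((x : ℂ) / 4)) ≠ 0 := by
  have h := (Real.cosh_pos (x / 4)).ne'
  intro h0
  refine h ?_
  have : Complex.cosh ((x : ℂ) / 4) = 0 := by simpa using h0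
  exact_mod_cast this

theorem effOp_add_conjTranspose : effOp U e A + (effOp U e A)ᴴ = decay U e A := by
  rw [effOp, conjTranspose_bohr, decay_conjTranspose, ← bohr_add_fun]
  conv_rhs => rw [← bohr_one U e (decay U e A)]
  congr 2
  funext ν
  have h := two_cosh_ne_zero ν
  have h1 : star (Complex.exp (((-ν : ℝ) : ℂ) / 4) / (2 * Complex.cosh (((-ν : ℝ) : ℂ) / 4))) =
      Complex.exp (-((ν : ℂ) / 4)) / (2 * Complex.cosh ((ν : ℂ) / 4)) := by
    rw [RCLike.star_def, map_div₀, map_mul, ← Complex.exp_conj, ← Complex.cosh_conj]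
    simp [neg_div, map_ofNat]
  rw [h1, ← add_div, div_eq_one_iff_eq h, Complex.cosh]
  ring

/-- The operator `e^{(1/4 + it)K} N e^{-(1/4 + it)K}`, written through Gaussian windows translated
by the complex times `∓ i/4 - t`. -/
def shiftedDecay (t : ℝ) : Matrix n n ℂ :=
  ∫ ω, (metro ω : ℂ) • ((freqComp U e (-(Complex.I / 4) - t) A ω)ᴴ * 1 *
    freqComp U e (Complex.I / 4 - t) A ω)

/-- Evolution of the decay operator to the complex time `t - i/4`: the Gaussian window can be
translated by a complex number, and the resulting factors `e^{±(1/4 + it)ω}` of `A(ω)` and `A(ω)†`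
cancel. -/
theorem bohr_exp_decay (t : ℝ) :
    bohr U e (fun ν => Complex.exp ((1 / 4 + Complex.I * t) * ν)) (decay U e A) =
      shiftedDecay U e A t := by
  rw [decay, shiftedDecay, ← ContinuousLinearMap.integral_comp_comm _
    (integrable_sandwich U e A 0 0 1)]
  congr 1
  funext ω
  have hw : ∀ (z : ℂ) (ν : ℝ), Complex.exp (z * ν) * windowAmp 0 (ω - ν) =
      Complex.exp (z * ω) * windowAmp (Complex.I * z) (ω - ν) := fun z ν => by
    rw [windowAmp, windowAmp, ← mul_assoc, ← mul_assoc, ← Complex.exp_add, ← Complex.exp_add]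
    congr 2
    push_cast
    linear_combination (-(z * (ω - ν))) * Complex.I_sq
  have h1 : bohr U e (fun ν => Complex.exp ((1 / 4 + Complex.I * t) * ν)) (freqComp U e 0 A ω) =
      Complex.exp ((1 / 4 + Complex.I * t) * ω) • freqComp U e (Complex.I / 4 - t) A ω := by
    rw [freqComp_eq_bohr, freqComp_eq_bohr, bohr_bohr, ← bohr_const_mul]
    congr 2
    funext ν
    rw [hw]
    congr 2
    linear_combination t * Complex.I_sq
  have h2 : bohr U e (fun ν => Complex.exp ((1 / 4 + Complex.I * t) * ν))
      (freqComp U e 0 A ω)ᴴ = Complex.exp (-((1 / 4 + Complex.I * t) * ω)) •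
        (freqComp U e (-(Complex.I / 4) - t) A ω)ᴴ := by
    have h3 : bohr U e (fun ν => Complex.exp ((-(1 / 4) + Complex.I * t) * ν))
        (freqComp U e 0 A ω) = Complex.exp ((-(1 / 4) + Complex.I * t) * ω) •
          freqComp U e (-(Complex.I / 4) - t) A ω := by
      rw [freqComp_eq_bohr, freqComp_eq_bohr, bohr_bohr, ← bohr_const_mul]
      congr 2
      funext ν
      rw [hw]
      congr 2
      linear_combination t * Complex.I_sq
    have h4 := congrArg Matrix.conjTranspose h3
    rw [conjTranspose_bohr, Matrix.conjTranspose_smul] at h4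
    convert h4 using 2
    · congr 1
      funext ν
      rw [RCLike.star_def, ← Complex.exp_conj]
      congr 1
      simp [map_ofNat]
      ring
    · rw [RCLike.star_def, ← Complex.exp_conj]
      congr 1
      simp [map_ofNat]
      ring
  rw [mul_one, mul_one, map_smul, bohr_exp_mul, h1, h2, Matrix.smul_mul, Matrix.mul_smul,
    smul_smul (Complex.exp _) (Complex.exp _), ← Complex.exp_add, neg_add_cancel, Complex.exp_zero,
    one_smul]

theorem sechKernel_phase_exp (t ν : ℝ) :
    (sechKernel t : ℂ) * Complex.exp (Complex.I * t * ν) * Complex.exp (ν / 4) =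
      (sechKernel t : ℂ) * Complex.exp ((1 / 4 + Complex.I * t) * ν) := by
  rw [mul_assoc, ← Complex.exp_add]
  congr 2; ring

theorem integrable_shiftedDecay :
    Integrable fun t => (sechKernel t : ℂ) • shiftedDecay U e A t := by
  simp only [← bohr_exp_decay, ← bohr_const_mul]
  refine integrable_bohr U e
    (φ := fun t ν => (sechKernel t : ℂ) * Complex.exp ((1 / 4 + Complex.I * t) * ν)) (fun ν => ?_) _
  simp only [← sechKernel_phase_exp]
  exact (integrable_mul_phase integrable_sechKernel.ofReal ν).mul_const _

/-- The multiplier of `effOp` is the Fourier transform of the time kernel times `e^{ν/4}`. The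
evolution to an imaginary time falls on the Gaussian windows, which keeps the integrand bounded. -/
theorem effOp_eq_integral :
    effOp U e A = ∫ t, (sechKernel t : ℂ) • shiftedDecay U e A t := by
  simp only [← bohr_exp_decay, ← bohr_const_mul]
  rw [← bohr_integral U e
    (φ := fun t ν => (sechKernel t : ℂ) * Complex.exp ((1 / 4 + Complex.I * t) * ν)), effOp]
  · congr 2
    funext ν
    simp only [← sechKernel_phase_exp]
    rw [integral_mul_const, integral_sechKernel_mul_exp, inv_mul_eq_div]
  · intro ν
    simp only [← sechKernel_phase_exp]
    exact (integrable_mul_phase integrable_sechKernel.ofReal ν).mul_const _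

/-- The dual generator is dissipative: up to the second-order term `ε² G X G†`, the map `1 + ε 𝓛*`
is completely positive with value `1 + ε² G G†` at the identity. -/
theorem dissipative_jumpDual : Dissipative (jumpDual U e A) := by
  set G := effOp U e A with hG
  refine ⟨2 * (‖G‖ * ‖G‖), fun ε hε => ContinuousLinearMap.opNorm_le_bound _
    (by positivity) fun X => ?_⟩
  have h1 : (1 + (ε : ℂ) • jumpDual U e A) X =
      ((1 - (ε : ℂ) • G) * X * (1 - (ε : ℂ) • G)ᴴ +
        (ε : ℂ) • ∫ ω, (metro ω : ℂ) • ((freqComp U e 0 A ω)ᴴ * X * freqComp U e 0 A ω)) -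
        ((ε ^ 2 : ℝ) : ℂ) • (G * X * Gᴴ) := by
    rw [add_apply, smul_apply, jumpDual_apply, ← hG,
      one_apply_eq_self]
    simp only [Matrix.conjTranspose_sub, Matrix.conjTranspose_one, Matrix.conjTranspose_smul,
      RCLike.star_def, Complex.conj_ofReal, sub_mul, mul_sub, mul_one, one_mul, Matrix.smul_mul,
      Matrix.mul_smul, smul_sub, smul_smul]
    push_cast
    rw [pow_two]
    abel
  have h2 : (1 - (ε : ℂ) • G) * (1 - (ε : ℂ) • G)ᴴ +
      (ε : ℂ) • ∫ ω, (metro ω : ℂ) • ((freqComp U e 0 A ω)ᴴ * 1 * freqComp U e 0 A ω) =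
      1 + ((ε ^ 2 : ℝ) : ℂ) • (G * Gᴴ) := by
    change _ + (ε : ℂ) • decay U e A = _
    rw [← effOp_add_conjTranspose, ← hG]
    simp only [Matrix.conjTranspose_sub, Matrix.conjTranspose_one, Matrix.conjTranspose_smul,
      RCLike.star_def, Complex.conj_ofReal, sub_mul, mul_sub, mul_one, one_mul, Matrix.smul_mul,
      Matrix.mul_smul, smul_smul, smul_add]
    push_cast
    rw [pow_two]
    abel
  have h3 := norm_cp_le (P := freqComp U e 0 A) (w := metro) X (1 - (ε : ℂ) • G) hε metro_nonneg
    (fun X => integrable_sandwich U e A 0 0 X)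
  rw [h2] at h3
  have hGG : ‖((ε ^ 2 : ℝ) : ℂ) • (G * Gᴴ)‖ ≤ ε ^ 2 * (‖G‖ * ‖G‖) := by
    rw [norm_smul, Complex.norm_real, Real.norm_of_nonneg (by positivity)]
    gcongr
    refine (norm_mul_le _ _).trans ?_
    rw [Matrix.l2_opNorm_conjTranspose]
  have hGXG : ‖((ε ^ 2 : ℝ) : ℂ) • (G * X * Gᴴ)‖ ≤ ε ^ 2 * (‖G‖ * ‖X‖ * ‖G‖) := by
    rw [norm_smul, Complex.norm_real, Real.norm_of_nonneg (by positivity)]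
    gcongr
    refine (norm_mul_le _ _).trans ?_
    rw [Matrix.l2_opNorm_conjTranspose]
    gcongr
    exact norm_mul_le _ _
  rw [h1]
  refine (norm_sub_le _ _).trans ((add_le_add h3 hGXG).trans ?_)
  have h4 := (norm_add_le (1 : Matrix n n ℂ) (((ε ^ 2 : ℝ) : ℂ) • (G * Gᴴ))).trans
    (add_le_add norm_one_le hGG)
  have h5 := mul_le_mul_of_nonneg_left h4 (norm_nonneg X)
  linarith

end Generator

/-! ### The Lindbladian in the time unit of the inverse temperature -/

section Rescaling

open MeasureTheory

theorem integral_eq_of_comp_div {E : Type*} [NormedAddCommGroup E] [NormedSpace ℝ E]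
    {g h : ℝ → E} {β : ℝ} (hβ : 0 < β) (hgh : ∀ x, g (x / β) = β • h x) :
    ∫ x, g x = ∫ x, h x := by
  have h1 := Measure.integral_comp_div g β
  simp only [hgh, integral_smul, abs_of_pos hβ] at h1
  exact (smul_right_injective E hβ.ne' h1).symm

variable {Λ : Type} [Fintype Λ] [DecidableEq Λ] {H : Op Λ} (hH : H.IsHermitian) {β : ℝ} (A : Op Λ)

theorem gaussFilter_mul (hβ : 0 < β) (s : ℝ) :
    ((gaussFilter (1 / β) (β * s) : ℝ) : ℂ) = ((Real.sqrt β)⁻¹ : ℝ) * window 0 s := by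
  have h1 : gaussFilter (1 / β) (β * s) =
      (Real.sqrt β)⁻¹ * (Real.sqrt (Real.sqrt (2 / Real.pi)) * Real.exp (-s ^ 2)) := by
    unfold gaussFilter
    rw [show (1 / β) ^ 2 * (β * s) ^ 2 = s ^ 2 by field_simp, Real.sqrt_mul (by positivity),
      one_div, Real.sqrt_inv]
    ring
  rw [h1, window]
  push_cast
  simp

theorem opFourier_div (hβ : 0 < β) (ω : ℝ) :
    opFourier H (1 / β) A (ω / β) = ((Real.sqrt β : ℝ) : ℂ) •
      freqComp hH.eigenvectorUnitary (fun i => β * hH.eigenvalues i) 0 A ω := by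
  have hb : ((Real.sqrt β : ℝ) : ℂ) ≠ 0 := by
    exact_mod_cast (Real.sqrt_pos.2 hβ).ne'
  have h1 := Measure.integral_comp_mul_left
    (fun t : ℝ => (Complex.exp (-(Complex.I * ((ω / β : ℝ) : ℂ) * (t : ℂ))) *
      (gaussFilter (1 / β) t : ℂ)) • heisenberg H A t) β
  have h2 : ∀ s : ℝ, (Complex.exp (-(Complex.I * ((ω / β : ℝ) : ℂ) * ((β * s : ℝ) : ℂ))) *
      (gaussFilter (1 / β) (β * s) : ℂ)) • heisenberg H A (β * s) =
      (((Real.sqrt β)⁻¹ : ℝ) : ℂ) • ((window 0 s * Complex.exp (-(Complex.I * ω * s))) •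
        heis hH.eigenvectorUnitary (fun i => β * hH.eigenvalues i) s A) := fun s => by
    have hβ' : (β : ℂ) ≠ 0 := by exact_mod_cast hβ.ne'
    rw [heisenberg_eq_heis hH, gaussFilter_mul hβ, smul_smul]
    congr 1
    rw [show Complex.I * ((ω / β : ℝ) : ℂ) * ((β * s : ℝ) : ℂ) = Complex.I * ω * s by
      push_cast; field_simp]
    ring
  simp only [h2] at h1
  rw [integral_smul, abs_of_pos (inv_pos.2 hβ)] at h1
  have h3 : (∫ t : ℝ, (Complex.exp (-(Complex.I * ((ω / β : ℝ) : ℂ) * (t : ℂ))) *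
      (gaussFilter (1 / β) t : ℂ)) • heisenberg H A t) = ((Real.sqrt β : ℝ) : ℂ) •
      ∫ s : ℝ, (window 0 s * Complex.exp (-(Complex.I * ω * s))) •
        heis hH.eigenvectorUnitary (fun i => β * hH.eigenvalues i) s A := by
    have h4 := congrArg (fun M => (β : ℂ) • M) h1
    simp only [smul_smul, ← Complex.coe_smul] at h4
    rw [Complex.ofReal_inv β, mul_inv_cancel₀ (by exact_mod_cast hβ.ne'), one_smul] at h4
    rw [← h4]
    congr 1
    have : (β : ℂ) = ((Real.sqrt β : ℝ) : ℂ) * ((Real.sqrt β : ℝ) : ℂ) := by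
      rw [← Complex.ofReal_mul, Real.mul_self_sqrt hβ.le]
    rw [Complex.ofReal_inv]
    field_simp
    rw [this]; ring
  rw [opFourier, h3, freqComp, windowFT, smul_comm]

theorem metropolis_div (hβ : 0 < β) (ω : ℝ) : metropolis β (1 / β) (ω / β) = metro ω := by
  unfold metropolis metro
  congr 2
  rw [mul_max_of_nonneg _ _ hβ.le, mul_zero]
  congr 1
  field_simp

theorem sqrt_smul_sandwich (hβ : 0 < β) (w : ℂ) (F G : Op Λ) :
    w • ((((Real.sqrt β : ℝ) : ℂ) • F) * (((Real.sqrt β : ℝ) : ℂ) • G)) =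
      β • (w • (F * G)) := by
  rw [Matrix.smul_mul, Matrix.mul_smul, smul_smul (((Real.sqrt β : ℝ) : ℂ)), ← Complex.ofReal_mul,
    Real.mul_self_sqrt hβ.le, smul_comm, Complex.coe_smul]

theorem decayOp_eq_decay (hβ : 0 < β) : decayOp H β (1 / β) A =
    decay hH.eigenvectorUnitary (fun i => β * hH.eigenvalues i) A := by
  refine integral_eq_of_comp_div hβ fun x => ?_
  rw [opFourier_div hH A hβ, metropolis_div hβ, Matrix.conjTranspose_smul, RCLike.star_def,
    Complex.conj_ofReal, sqrt_smul_sandwich hβ, mul_one]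

theorem dissipator_eq (hβ : 0 < β) : dissipator H β (1 / β) A =
    ∫ ω : ℝ, (metro ω : ℂ) •
      (ContinuousLinearMap.mulLeftRight ℂ (Op Λ)
          (freqComp hH.eigenvectorUnitary (fun i => β * hH.eigenvalues i) 0 A ω)
          (freqComp hH.eigenvectorUnitary (fun i => β * hH.eigenvalues i) 0 A ω)ᴴ
        - halfAnticomm
          ((freqComp hH.eigenvectorUnitary (fun i => β * hH.eigenvalues i) 0 A ω)ᴴ *
            freqComp hH.eigenvectorUnitary (fun i => β * hH.eigenvalues i) 0 A ω)) := by
  refine integral_eq_of_comp_div hβ fun x => ?_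
  rw [opFourier_div hH A hβ, metropolis_div hβ, Matrix.conjTranspose_smul, RCLike.star_def,
    Complex.conj_ofReal]
  set F := freqComp hH.eigenvectorUnitary (fun i => β * hH.eigenvalues i) 0 A x
  ext1 O
  have h2 : ((Real.sqrt β : ℝ) : ℂ) * ((Real.sqrt β : ℝ) : ℂ) = (β : ℂ) := by
    rw [← Complex.ofReal_mul, Real.mul_self_sqrt hβ.le]
  simp only [halfAnticomm, smul_apply, sub_apply, add_apply, ContinuousLinearMap.mulLeftRight_apply,
    ContinuousLinearMap.mul_apply', ContinuousLinearMap.flip_apply, Matrix.smul_mul,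
    Matrix.mul_smul, smul_smul, smul_sub, smul_add, ← Complex.coe_smul, ← h2]
  module

theorem effOp_eq (U : Matrix.unitaryGroup (Λ → Fin 2) ℂ) (e : (Λ → Fin 2) → ℝ) :
    effOp U e A = (1 / 2 : ℂ) • decay U e A -
      Complex.I • bohr U e (fun ν => Complex.I / 2 * (Real.tanh (ν / 4) : ℂ)) (decay U e A) := by
  conv_rhs => rw [← bohr_one U e (decay U e A), bohr_bohr, ← bohr_const_mul, ← bohr_const_mul]
  rw [sub_eq_add_neg, ← neg_one_smul ℂ, ← bohr_const_mul, ← bohr_add_fun, effOp]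
  congr 2
  funext ν
  have h := two_cosh_ne_zero ν
  have h' : Complex.cosh ((ν : ℂ) / 4) ≠ 0 := fun h0 => h (by rw [h0, mul_zero])
  rw [div_eq_iff h]
  push_cast
  rw [Complex.tanh_eq_sinh_div_cosh, ← Complex.cosh_add_sinh]
  field_simp
  linear_combination (Complex.sinh ((ν : ℂ) / 4)) * Complex.I_sq

/-- The coherent term is `B = i (G - N/2)`. -/
theorem coherentTerm_eq_effOp (hβ : 0 < β) : coherentTerm hH β (1 / β) A =
    Complex.I • (effOp hH.eigenvectorUnitary (fun i => β * hH.eigenvalues i) A -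
      (1 / 2 : ℂ) • decayOp H β (1 / β) A) := by
  rw [effOp_eq, coherentTerm_eq_bohr, decayOp_eq_decay hH A hβ, sub_right_comm, sub_self, zero_sub,
    smul_neg, smul_smul, Complex.I_mul_I, neg_one_smul, neg_neg]

theorem integrable_sandwich_conj (U : Matrix.unitaryGroup (Λ → Fin 2) ℂ) (e : (Λ → Fin 2) → ℝ)
    (X : Op Λ) : Integrable fun ω => (metro ω : ℂ) •
      (freqComp U e 0 A ω * X * (freqComp U e 0 A ω)ᴴ) := by
  have h1 := (integrable_freqComp U e A 0).aestronglyMeasurable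
  have h2 : AEStronglyMeasurable (fun ω => (metro ω : ℂ) • (freqComp U e 0 A ω * X)) volume :=
    (Complex.continuous_ofReal.comp continuous_metro).aestronglyMeasurable.smul (h1.mul_const X)
  have h3 : Integrable fun ω => (freqComp U e 0 A ω)ᴴ :=
    (starL' ℝ : Op Λ ≃L[ℝ] Op Λ).toContinuousLinearMap.integrable_comp (integrable_freqComp U e A 0)
  refine (h3.bdd_mul (c := (∫ s, ‖window 0 s‖) * ‖A‖ * ‖X‖) h2
    (Filter.Eventually.of_forall fun ω => ?_)).congr (Filter.Eventually.of_forall fun ω => ?_)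
  · rw [norm_smul, Complex.norm_real, Real.norm_of_nonneg (metro_nonneg ω)]
    refine (mul_le_of_le_one_left (norm_nonneg _) (metro_le_one ω)).trans ?_
    refine (norm_mul_le _ _).trans ?_
    gcongr
    exact norm_windowFT_heis_le U e A 0 ω
  · simp only [Matrix.smul_mul]

theorem dissipator_apply (hβ : 0 < β) (O : Op Λ) : dissipator H β (1 / β) A O =
    (∫ ω, (metro ω : ℂ) •
      (freqComp hH.eigenvectorUnitary (fun i => β * hH.eigenvalues i) 0 A ω * O *
        (freqComp hH.eigenvectorUnitary (fun i => β * hH.eigenvalues i) 0 A ω)ᴴ)) -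
      (1 / 2 : ℂ) • (decayOp H β (1 / β) A * O + O * decayOp H β (1 / β) A) := by
  set U := hH.eigenvectorUnitary with hU
  set e := fun i => β * hH.eigenvalues i with he
  have h1 := fun O => integrable_sandwich_conj A U e O
  have h2 := integrable_sandwich U e A 0 0 1
  have h3 : ∀ O : Op Λ, Integrable fun ω => (metro ω : ℂ) •
      ((freqComp U e 0 A ω)ᴴ * 1 * freqComp U e 0 A ω) * O := fun O => h2.mul_const O
  have h4 : ∀ O : Op Λ, Integrable fun ω => O * (metro ω : ℂ) •
      ((freqComp U e 0 A ω)ᴴ * 1 * freqComp U e 0 A ω) := fun O => h2.const_mul O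
  have h5 : ∀ O : Op Λ, (fun ω => ((metro ω : ℂ) •
      (ContinuousLinearMap.mulLeftRight ℂ (Op Λ) (freqComp U e 0 A ω) (freqComp U e 0 A ω)ᴴ
        - halfAnticomm ((freqComp U e 0 A ω)ᴴ * freqComp U e 0 A ω))) O) = fun ω =>
      (metro ω : ℂ) • (freqComp U e 0 A ω * O * (freqComp U e 0 A ω)ᴴ) -
      (1 / 2 : ℂ) • ((metro ω : ℂ) • ((freqComp U e 0 A ω)ᴴ * 1 * freqComp U e 0 A ω) * O +
        O * (metro ω : ℂ) • ((freqComp U e 0 A ω)ᴴ * 1 * freqComp U e 0 A ω)) := fun O => by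
    funext ω
    simp only [halfAnticomm, smul_apply, sub_apply, add_apply,
      ContinuousLinearMap.mulLeftRight_apply, ContinuousLinearMap.mul_apply',
      ContinuousLinearMap.flip_apply, mul_one, smul_sub, smul_add, Matrix.smul_mul,
      Matrix.mul_smul, smul_comm (metro ω : ℂ) (1 / 2 : ℂ)]
  have h6 : ∀ O : Op Λ, Integrable fun ω => (1 / 2 : ℂ) • ((metro ω : ℂ) •
      ((freqComp U e 0 A ω)ᴴ * 1 * freqComp U e 0 A ω) * O +
        O * (metro ω : ℂ) • ((freqComp U e 0 A ω)ᴴ * 1 * freqComp U e 0 A ω)) := fun O =>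
    ((h3 O).add (h4 O)).smul (1 / 2 : ℂ)
  rw [dissipator_eq hH A hβ, ContinuousLinearMap.integral_apply (integrable_superOp fun O => by
    rw [h5]; exact (h1 O).sub (h6 O)), h5, integral_sub (h1 O) (h6 O), integral_smul,
    integral_add (h3 O) (h4 O)]
  rw [decayOp_eq_decay hH A hβ]
  congr 3
  · exact integral_mul_const_of_integrable h2
  · exact integral_const_mul_of_integrable h2

omit hH in
theorem trace_integral_sandwich {F : ℝ → Op Λ} {w : ℝ → ℂ} {X O : Op Λ}
    (h : Integrable fun ω => w ω • (F ω * O * (F ω)ᴴ))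
    (h' : Integrable fun ω => w ω • ((F ω)ᴴ * X * F ω)) :
    (X * ∫ ω, w ω • (F ω * O * (F ω)ᴴ)).trace = ((∫ ω, w ω • ((F ω)ᴴ * X * F ω)) * O).trace := by
  have h5 : X * (∫ ω, w ω • (F ω * O * (F ω)ᴴ)) = ∫ ω, X * (w ω • (F ω * O * (F ω)ᴴ)) :=
    (integral_const_mul_of_integrable h).symm
  have h6 : (∫ ω, w ω • ((F ω)ᴴ * X * F ω)) * O = ∫ ω, w ω • ((F ω)ᴴ * X * F ω) * O :=
    (integral_mul_const_of_integrable h').symm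
  rw [h5, h6, trace_integral (h.const_mul X), trace_integral (h'.mul_const O)]
  congr 1
  funext ω
  rw [Matrix.mul_smul, Matrix.smul_mul, Matrix.trace_smul, Matrix.trace_smul]
  congr 1
  rw [← Matrix.mul_assoc, Matrix.trace_mul_comm]
  simp only [Matrix.mul_assoc]

/-- The duality between the generator `O ↦ -i[B, O] + J(O) - ½{N, O}` and its adjoint
`X ↦ J*(X) - G X - X G†`, where `B = i (G - N/2)` and `N = G + G†`. -/
theorem trace_lindblad_dual {X O G N J J' : Op Λ} {Gs : Op Λ} (hG : Gs = N - G)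
    (hJ : (X * J).trace = (J' * O).trace) :
    (X * (unitaryGenerator (Complex.I • (G - (1 / 2 : ℂ) • N)) O +
      (J - (1 / 2 : ℂ) • (N * O + O * N)))).trace = ((J' - G * X - X * Gs) * O).trace := by
  have hX : ∀ M : Op Λ, (X * (M * O)).trace = (X * M * O).trace := fun M => by
    rw [Matrix.mul_assoc]
  have hY : ∀ M : Op Λ, (X * (O * M)).trace = (M * X * O).trace := fun M => by
    rw [← Matrix.mul_assoc, Matrix.trace_mul_comm, Matrix.mul_assoc]
  subst hG
  simp only [unitaryGenerator, smul_apply, sub_apply, ContinuousLinearMap.mul_apply',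
    ContinuousLinearMap.flip_apply, mul_add, mul_sub, sub_mul, Matrix.mul_smul,
    Matrix.smul_mul, Matrix.trace_add, Matrix.trace_sub, Matrix.trace_smul, hX, hY, hJ, smul_eq_mul]
  linear_combination ((X * G * O).trace - (X * N * O).trace / 2 -
    (G * X * O).trace + (N * X * O).trace / 2) * (- Complex.I_sq)

/-- The dual of the Lindbladian of a jump is `jumpDual` for `K = βH`. -/
theorem superDual_jumpLindbladian (hβ : 0 < β) : superDual (jumpLindbladian hH β (1 / β) A) =
    jumpDual hH.eigenvectorUnitary (fun i => β * hH.eigenvalues i) A := by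
  refine superDual_eq fun X O => ?_
  rw [jumpLindbladian, add_apply, dissipator_apply hH A hβ, coherentTerm_eq_effOp hH A hβ,
    decayOp_eq_decay hH A hβ, jumpDual_apply]
  exact trace_lindblad_dual (eq_sub_of_add_eq' (effOp_add_conjTranspose _ _ A))
    (trace_integral_sandwich (integrable_sandwich_conj A _ _ O) (integrable_sandwich _ _ A 0 0 X))

end Rescaling

/-! ### Time averages of contraction semigroups -/

section TimeAverage

open MeasureTheory

section Abstract

variable {𝔸 : Type*} [NormedRing 𝔸] [NormedAlgebra ℂ 𝔸] [CompleteSpace 𝔸]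

/-- The time average `t⁻¹ ∫₀ᵗ exp(s L) ds`. -/
def avgExp (L : 𝔸) (t : ℝ) : 𝔸 :=
  ((1 / t : ℝ) : ℂ) • ∫ s in (0 : ℝ)..t, NormedSpace.exp ((s : ℂ) • L)

theorem norm_avgExp_le {L : 𝔸} (h1 : ‖(1 : 𝔸)‖ ≤ 1) (h : Dissipative L) {t : ℝ} (ht : 0 < t) :
    ‖avgExp L t‖ ≤ 1 := by
  have h2 : ‖∫ s in (0 : ℝ)..t, NormedSpace.exp ((s : ℂ) • L)‖ ≤ 1 * |t - 0| :=
    intervalIntegral.norm_integral_le_of_norm_le_const fun s hs => by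
      rw [Set.uIoc_of_le ht.le] at hs
      exact h.norm_exp_le h1 hs.1.le
  rw [avgExp, norm_smul, Complex.norm_real, Real.norm_of_nonneg (by positivity), one_div]
  rw [one_mul, sub_zero, abs_of_pos ht] at h2
  calc t⁻¹ * _ ≤ t⁻¹ * t := by gcongr
    _ = 1 := inv_mul_cancel₀ ht.ne'

/-- By Duhamel's formula the semigroups differ by at most `s ‖L - L'‖` at time `s`. -/
theorem norm_avgExp_sub_le {L L' : 𝔸} (h1 : ‖(1 : 𝔸)‖ ≤ 1) (h : Dissipative L)
    (h' : Dissipative L') {t : ℝ} (ht : 0 < t) :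
    ‖avgExp L t - avgExp L' t‖ ≤ t * ‖L - L'‖ := by
  have hi : ∀ M : 𝔸, IntervalIntegrable (fun s : ℝ => NormedSpace.exp ((s : ℂ) • M)) volume 0 t :=
    fun M => (continuous_exp_real_smul M).intervalIntegrable 0 t
  have h2 : ‖∫ s in (0 : ℝ)..t, (NormedSpace.exp ((s : ℂ) • L) - NormedSpace.exp ((s : ℂ) • L'))‖ ≤
      (t * ‖L - L'‖) * |t - 0| :=
    intervalIntegral.norm_integral_le_of_norm_le_const fun s hs => by
      rw [Set.uIoc_of_le ht.le] at hs
      refine (norm_exp_sub_exp_le (fun s hs => h.norm_exp_le h1 hs)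
        (fun s hs => h'.norm_exp_le h1 hs) hs.1.le).trans ?_
      gcongr
      exact hs.2
  rw [avgExp, avgExp, ← smul_sub, ← intervalIntegral.integral_sub (hi L) (hi L'), norm_smul,
    Complex.norm_real, Real.norm_of_nonneg (by positivity), one_div]
  rw [sub_zero, abs_of_pos ht] at h2
  calc t⁻¹ * _ ≤ t⁻¹ * (t * ‖L - L'‖ * t) := by gcongr
    _ = t * ‖L - L'‖ := by field_simp

theorem map_avgExp (T : 𝔸 →L[ℂ] 𝔸)
    (hT : ∀ M : 𝔸, T (NormedSpace.exp M) = NormedSpace.exp (T M)) (L : 𝔸) (t : ℝ) :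
    T (avgExp L t) = avgExp (T L) t := by
  have h : ∫ s in (0 : ℝ)..t, T (NormedSpace.exp ((s : ℂ) • L)) =
      T (∫ s in (0 : ℝ)..t, NormedSpace.exp ((s : ℂ) • L)) :=
    T.intervalIntegral_comp_comm ((continuous_exp_real_smul L).intervalIntegrable 0 t)
  rw [avgExp, avgExp, map_smul, ← h]
  simp only [hT, map_smul]

/-- The generator applied to a time average telescopes, which makes it `O(1/t)`. -/
theorem mul_avgExp (L : 𝔸) (t : ℝ) :
    L * avgExp L t = ((1 / t : ℝ) : ℂ) • (NormedSpace.exp ((t : ℂ) • L) - 1) := by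
  have hc : Continuous fun s : ℝ => L * NormedSpace.exp ((s : ℂ) • L) :=
    continuous_const.mul (continuous_exp_real_smul L)
  have h := intervalIntegral.integral_eq_sub_of_hasDerivAt
    (fun s _ => hasDerivAt_exp_real_smul' L s) (hc.intervalIntegrable 0 t)
  have h3 : ∫ s in (0 : ℝ)..t, L * NormedSpace.exp ((s : ℂ) • L) =
      L * ∫ s in (0 : ℝ)..t, NormedSpace.exp ((s : ℂ) • L) :=
    (ContinuousLinearMap.mul ℂ 𝔸 L).intervalIntegral_comp_comm
      ((continuous_exp_real_smul L).intervalIntegrable 0 t)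
  rw [avgExp, mul_smul_comm, ← h3, h]
  simp

end Abstract

section Region

variable {Λ : Type} [Fintype Λ] [DecidableEq Λ] {H : Op Λ} (hH : H.IsHermitian) (β : ℝ)
  (A : Finset Λ)

/-- The dual of the Lindbladian of a region. -/
def regionDual : SuperOp Λ :=
  ∑ i ∈ A, ∑ a : Fin 3, jumpDual hH.eigenvectorUnitary (fun j => β * hH.eigenvalues j)
    (siteOp i (pauli a))

theorem superDual_regionLindbladian (hβ : 0 < β) :
    superDual (regionLindbladian hH β A) = regionDual hH β A := by
  rw [regionLindbladian, regionDual, map_sum]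
  refine Finset.sum_congr rfl fun i _ => ?_
  rw [map_sum]
  exact Finset.sum_congr rfl fun a _ => superDual_jumpLindbladian hH _ hβ

theorem norm_one_superOp_le : ‖(1 : SuperOp Λ)‖ ≤ 1 := ContinuousLinearMap.norm_id_le

theorem dissipative_regionDual : Dissipative (regionDual hH β A) :=
  Dissipative.sum norm_one_superOp_le _ fun _ _ =>
    Dissipative.sum norm_one_superOp_le _ fun _ _ => dissipative_jumpDual _ _ _

theorem superDual_timeAverage (hβ : 0 < β) (t : ℝ) :
    superDual (timeAverage hH β A t) = avgExp (regionDual hH β A) t := by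
  rw [← superDual_regionLindbladian hH β A hβ]
  exact map_avgExp (𝔸 := SuperOp Λ) superDual superDual_exp _ t

theorem traceNorm_timeAverage_le (hβ : 0 < β) {t : ℝ} (ht : 0 < t) (O : Op Λ) :
    traceNorm (timeAverage hH β A t O) ≤ traceNorm O := by
  refine (traceNorm_apply_le _ O).trans (mul_le_of_le_one_left (traceNorm_nonneg O) ?_)
  rw [superDual_timeAverage hH β A hβ]
  exact norm_avgExp_le norm_one_superOp_le (dissipative_regionDual hH β A) ht

end Region

end TimeAverage

/-! ### Lieb–Robinson bounds -/

section LiebRobinson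

variable {n : Type*} [Fintype n] [DecidableEq n]

theorem norm_unitary_le (W : Matrix.unitaryGroup n ℂ) : ‖(W : Matrix n n ℂ)‖ ≤ 1 := by
  have h := CStarRing.norm_star_mul_self (x := (W : Matrix n n ℂ))
  rw [Matrix.mem_unitaryGroup_iff'.1 W.2] at h
  nlinarith [norm_one_le (n := n), norm_nonneg (W : Matrix n n ℂ)]

theorem norm_exp_I_smul_le {K : Matrix n n ℂ} (hK : K.IsHermitian) (s : ℝ) :
    ‖NormedSpace.exp ((s : ℂ) • (Complex.I • K))‖ ≤ 1 := by
  have h : (s : ℂ) • (Complex.I • K) = ((Complex.I * s) * ((1 : ℝ) : ℂ)) • K := by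
    rw [smul_smul]; congr 1; push_cast; ring
  rw [h, exp_smul_eq_gexp hK]
  exact norm_unitary_le (evolution hK.eigenvectorUnitary (fun i => 1 * hK.eigenvalues i) s)

theorem norm_exp_neg_I_smul_le {K : Matrix n n ℂ} (hK : K.IsHermitian) (s : ℝ) :
    ‖NormedSpace.exp ((s : ℂ) • (-(Complex.I • K)))‖ ≤ 1 := by
  rw [← smul_neg]; exact norm_exp_I_smul_le hK.neg s

/-- The Heisenberg evolution `e^{isK} O e^{-isK}`. -/
def evolve (K : Matrix n n ℂ) (s : ℝ) (O : Matrix n n ℂ) : Matrix n n ℂ :=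
  NormedSpace.exp ((s : ℂ) • (Complex.I • K)) * O * NormedSpace.exp ((s : ℂ) • (-(Complex.I • K)))

theorem exp_mul_exp_neg (L : Matrix n n ℂ) (s : ℝ) :
    NormedSpace.exp ((s : ℂ) • L) * NormedSpace.exp ((s : ℂ) • (-L)) = 1 := by
  rw [smul_neg, ← Matrix.exp_add_of_commute ((s : ℂ) • L) (-((s : ℂ) • L))
    (Commute.neg_right (Commute.refl _)), add_neg_cancel, NormedSpace.exp_zero]

theorem exp_neg_mul_exp (L : Matrix n n ℂ) (s : ℝ) :
    NormedSpace.exp ((s : ℂ) • (-L)) * NormedSpace.exp ((s : ℂ) • L) = 1 := by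
  have := exp_mul_exp_neg (-L) s
  rwa [neg_neg] at this

theorem norm_evolve_le {K : Matrix n n ℂ} (hK : K.IsHermitian) (s : ℝ) (O : Matrix n n ℂ) :
    ‖evolve K s O‖ ≤ ‖O‖ := by
  refine (norm_mul_le _ _).trans ((mul_le_of_le_one_right (norm_nonneg _)
    (norm_exp_neg_I_smul_le hK s)).trans ((norm_mul_le _ _).trans
      (mul_le_of_le_one_left (norm_nonneg _) (norm_exp_I_smul_le hK s))))

theorem evolve_neg (K : Matrix n n ℂ) (s : ℝ) (O : Matrix n n ℂ) :
    evolve (-K) s O = evolve K (-s) O := by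
  simp [evolve]

theorem evolve_sum {ι : Type*} (K : Matrix n n ℂ) (s : ℝ) (S : Finset ι) (O : ι → Matrix n n ℂ) :
    evolve K s (∑ i ∈ S, O i) = ∑ i ∈ S, evolve K s (O i) := by
  simp only [evolve, Finset.mul_sum, Finset.sum_mul]

theorem commute_exp_of_commute {K O : Matrix n n ℂ} (h : K * O = O * K) (z : ℂ) :
    NormedSpace.exp (z • K) * O = O * NormedSpace.exp (z • K) := by
  have : Commute (z • K) O := Commute.smul_left h z
  exact this.exp_left

/-- The derivative of `e^{iu(H-G)} e^{-iuH} e^{iuH'} e^{-iu(H'-G)}` in `u`, with the four factors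
abbreviated `a`, `b`, `c`, `d`: only the difference of the two evolutions of `G` remains. -/
theorem interaction_deriv {a b b' c c' d H H' G : Matrix n n ℂ} (h1 : b * b' = 1)
    (h2 : c' * c = 1) :
    (a * (Complex.I • (H - G)) * b + a * (-(Complex.I • H) * b)) * (c * d) +
        a * b * (c * (Complex.I • H') * d + c * (-(Complex.I • (H' - G)) * d)) =
      a * b * (Complex.I • (c * G * c' - b' * G * b)) * (c * d) := by
  have e1 : a * b * (c * G * c') * (c * d) = a * b * c * G * d := by
    rw [show a * b * (c * G * c') * (c * d) = a * b * c * G * (c' * c) * d by noncomm_ring, h2,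
      mul_one]
  have e2 : a * b * (b' * G * b) * (c * d) = a * G * b * (c * d) := by
    rw [show a * b * (b' * G * b) * (c * d) = a * (b * b') * G * b * (c * d) by noncomm_ring, h1,
      mul_one]
  rw [Matrix.mul_smul (a * b), Matrix.smul_mul, mul_sub (a * b) (c * G * c'),
    sub_mul (a * b * (c * G * c')), e1, e2]
  simp only [Matrix.mul_smul, Matrix.smul_mul, neg_mul, mul_neg, smul_sub, mul_sub, sub_mul,
    add_mul, mul_add, ← mul_assoc]
  abel

theorem interaction_sub {h h' k k' p p' q q' O : Matrix n n ℂ} (e1 : h * h' = 1)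
    (e2 : k' * k = 1) (e3 : p * p' = 1) (e4 : q' * q = 1) :
    h * k' * O * (k * h') - p * q' * O * (q * p') =
      h * k' * (O * (k * h' * (p * q') - 1) - (k * h' * (p * q') - 1) * O) * (q * p') := by
  have f1 : k * h' * (p * q') * (q * p') = k * h' := by
    rw [show k * h' * (p * q') * (q * p') = k * h' * (p * (q' * q) * p') by noncomm_ring, e4,
      mul_one, e3, mul_one]
  have f2 : h * k' * (k * h' * (p * q')) = p * q' := by
    rw [show h * k' * (k * h' * (p * q')) = h * (k' * k) * h' * (p * q') by noncomm_ring, e2,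
      mul_one, e1, one_mul]
  calc _ = h * k' * O * (k * h' * (p * q') * (q * p')) -
        h * k' * (k * h' * (p * q')) * O * (q * p') := by rw [f1, f2]
    _ = _ := by noncomm_ring

/-- The comparison of two evolutions in the interaction picture: when `H - G` and `H' - G` both
commute with `O`, the evolutions of `O` differ by at most twice the time integral of the difference
of the evolutions of `G`. -/
theorem norm_evolve_sub_le {H H' G O : Matrix n n ℂ} (hH : H.IsHermitian) (hH' : H'.IsHermitian)
    (hG : G.IsHermitian) (hO : ‖O‖ ≤ 1) (hc : (H - G) * O = O * (H - G))
    (hc' : (H' - G) * O = O * (H' - G)) {C : ℝ} {k : ℕ} {s : ℝ} (hs : 0 ≤ s)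
    (hb : ∀ u, 0 ≤ u → ‖evolve H u G - evolve H' u G‖ ≤ C * u ^ k) :
    ‖evolve H s O - evolve H' s O‖ ≤ 2 * (C * (s ^ (k + 1) / (k + 1))) := by
  set E : Matrix n n ℂ → ℝ → Matrix n n ℂ := fun L u => NormedSpace.exp ((u : ℂ) • L) with hE
  set V : ℝ → Matrix n n ℂ := fun u =>
    E (Complex.I • (H - G)) u * E (-(Complex.I • H)) u *
      (E (Complex.I • H') u * E (-(Complex.I • (H' - G))) u) with hV
  have hVd : ∀ u, HasDerivAt V (E (Complex.I • (H - G)) u * E (-(Complex.I • H)) u *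
      (Complex.I • (evolve H' u G - evolve H u G)) *
      (E (Complex.I • H') u * E (-(Complex.I • (H' - G))) u)) u := fun u => by
    have h := ((hasDerivAt_exp_real_smul (Complex.I • (H - G)) u).mul
      (hasDerivAt_exp_real_smul' (-(Complex.I • H)) u)).mul
      ((hasDerivAt_exp_real_smul (Complex.I • H') u).mul
      (hasDerivAt_exp_real_smul' (-(Complex.I • (H' - G))) u))
    refine h.congr_deriv ?_
    exact interaction_deriv (exp_neg_mul_exp (Complex.I • H) u) (exp_neg_mul_exp (Complex.I • H') u)
  have hprod : ∀ {L M : Matrix n n ℂ}, ‖L‖ ≤ 1 → ‖M‖ ≤ 1 → ‖L * M‖ ≤ 1 := fun hL hM =>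
    (norm_mul_le _ _).trans (mul_le_one₀ hL (norm_nonneg _) hM)
  have hl : ∀ u, ‖E (Complex.I • (H - G)) u * E (-(Complex.I • H)) u‖ ≤ 1 := fun u =>
    hprod (norm_exp_I_smul_le (hH.sub hG) u) (norm_exp_neg_I_smul_le hH u)
  have hr : ∀ u, ‖E (Complex.I • H') u * E (-(Complex.I • (H' - G))) u‖ ≤ 1 := fun u =>
    hprod (norm_exp_I_smul_le hH' u) (norm_exp_neg_I_smul_le (hH'.sub hG) u)
  have hB : ∀ u : ℝ, HasDerivAt (fun u : ℝ => C * (u ^ (k + 1) / (k + 1))) (C * u ^ k) u :=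
    fun u => by
      have h := ((hasDerivAt_pow (k + 1) u).div_const ((k : ℝ) + 1)).const_mul C
      refine h.congr_deriv ?_
      have : (k : ℝ) + 1 ≠ 0 := by positivity
      push_cast
      field_simp
  have h1 : ‖V s - 1‖ ≤ C * (s ^ (k + 1) / (k + 1)) := by
    refine image_norm_le_of_norm_deriv_right_le_deriv_boundary (f := fun u => V u - 1) (a := 0)
      (b := s) (f' := fun u => E (Complex.I • (H - G)) u * E (-(Complex.I • H)) u *
      (Complex.I • (evolve H' u G - evolve H u G)) *
      (E (Complex.I • H') u * E (-(Complex.I • (H' - G))) u))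
      (fun u _ => ((hVd u).sub_const 1).continuousAt.continuousWithinAt)
      (fun u _ => ((hVd u).sub_const 1).hasDerivWithinAt) ?_ hB ?_ ⟨hs, le_rfl⟩
    · simp [hV, hE]
    · intro u hu
      refine le_trans ?_ (hb u hu.1)
      refine (norm_mul_le _ _).trans ((mul_le_of_le_one_right (norm_nonneg _) (hr u)).trans
        ((norm_mul_le _ _).trans ((mul_le_of_le_one_left (norm_nonneg _) (hl u)).trans ?_)))
      rw [norm_smul, Complex.norm_I, one_mul, norm_sub_rev]
  -- the evolutions are `W O W†` and `W' O W'†` with `W† W' = V`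
  have h2 : ∀ {K : Matrix n n ℂ}, (K - G) * O = O * (K - G) → evolve K s O =
      E (Complex.I • K) s * E (-(Complex.I • (K - G))) s * O *
        (E (Complex.I • (K - G)) s * E (-(Complex.I • K)) s) := fun {K} hK => by
    have hcI : E (-(Complex.I • (K - G))) s * O = O * E (-(Complex.I • (K - G))) s := by
      simp only [hE, ← smul_neg, smul_smul]
      refine commute_exp_of_commute ?_ _
      rw [neg_mul, mul_neg, hK]
    have e1 : E (-(Complex.I • (K - G))) s * E (Complex.I • (K - G)) s = 1 := exp_neg_mul_exp _ _
    rw [mul_assoc (E (Complex.I • K) s), hcI, mul_assoc (E (Complex.I • K) s), mul_assoc O,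
      ← mul_assoc (E (-(Complex.I • (K - G))) s), e1, one_mul, ← mul_assoc]
    rfl
  have h3 : evolve H s O - evolve H' s O =
      E (Complex.I • H) s * E (-(Complex.I • (H - G))) s * (O * (V s - 1) - (V s - 1) * O) *
        (E (Complex.I • (H' - G)) s * E (-(Complex.I • H')) s) := by
    have e1 : E (Complex.I • H) s * E (-(Complex.I • H)) s = 1 := exp_mul_exp_neg _ _
    have e2 : E (-(Complex.I • (H - G))) s * E (Complex.I • (H - G)) s = 1 := exp_neg_mul_exp _ _
    have e3 : E (Complex.I • H') s * E (-(Complex.I • H')) s = 1 := exp_mul_exp_neg _ _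
    have e4 : E (-(Complex.I • (H' - G))) s * E (Complex.I • (H' - G)) s = 1 := exp_neg_mul_exp _ _
    rw [h2 hc, h2 hc']
    simp only [hV]
    exact interaction_sub e1 e2 e3 e4
  have hl' : ‖E (Complex.I • H) s * E (-(Complex.I • (H - G))) s‖ ≤ 1 :=
    hprod (norm_exp_I_smul_le hH s) (norm_exp_neg_I_smul_le (hH.sub hG) s)
  have hr' : ‖E (Complex.I • (H' - G)) s * E (-(Complex.I • H')) s‖ ≤ 1 :=
    hprod (norm_exp_I_smul_le (hH'.sub hG) s) (norm_exp_neg_I_smul_le hH' s)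
  rw [h3]
  refine (norm_mul_le _ _).trans ((mul_le_of_le_one_right (norm_nonneg _) hr').trans
    ((norm_mul_le _ _).trans ((mul_le_of_le_one_left (norm_nonneg _) hl').trans
      ((norm_sub_le _ _).trans ?_))))
  have h4 := (norm_mul_le O (V s - 1)).trans (mul_le_of_le_one_left (norm_nonneg _) hO)
  have h5 := (norm_mul_le (V s - 1) O).trans (mul_le_of_le_one_right (norm_nonneg _) hO)
  linarith

end LiebRobinson

section Locality

variable {Λ : Type} [Fintype Λ] [DecidableEq Λ]

theorem mul_apply_of_disjoint {S S' : Finset Λ} (hS : Disjoint S S') {O O' : Op Λ}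
    {K : Matrix (S → Fin 2) (S → Fin 2) ℂ} {K' : Matrix (S' → Fin 2) (S' → Fin 2) ℂ}
    (hO : ∀ x y : Λ → Fin 2,
      O x y = if ∀ i, i ∉ S → x i = y i then K (fun i => x i) (fun i => y i) else 0)
    (hO' : ∀ x y : Λ → Fin 2,
      O' x y = if ∀ i, i ∉ S' → x i = y i then K' (fun i => x i) (fun i => y i) else 0)
    (x z : Λ → Fin 2) :
    (O * O') x z = if ∀ i, i ∉ S → i ∉ S' → x i = z i then
      K (fun i => x i) (fun i => z i) * K' (fun i => x i) (fun i => z i) else 0 := by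
  have hd : ∀ i, i ∈ S → i ∉ S' := fun i h h' => Finset.disjoint_left.1 hS h h'
  rw [Matrix.mul_apply, Finset.sum_eq_single fun i => if i ∈ S then z i else x i]
  · rw [hO, hO']
    have e1 : (fun i : S => if (i : Λ) ∈ S then z i else x i) = fun i : S => z i := by
      funext i; simp
    have e2 : (fun i : S' => if (i : Λ) ∈ S then z i else x i) = fun i : S' => x i := by
      funext i
      exact if_neg fun h => hd i h i.2
    rw [if_pos fun i hi => by simp [hi], e1, e2, mul_ite, mul_zero]
    congr 1
    refine propext ⟨fun h i hi hi' => by simpa [hi] using h i hi', fun h i hi' => ?_⟩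
    by_cases hi : i ∈ S
    · simp [hi]
    · simpa [hi] using h i hi hi'
  · intro y _ hy
    rw [hO, hO']
    by_cases h1 : ∀ i, i ∉ S → x i = y i
    · by_cases h2 : ∀ i, i ∉ S' → y i = z i
      · refine absurd (funext fun i => ?_) hy
        by_cases hi : i ∈ S
        · rw [if_pos hi, h2 i (hd i hi)]
        · rw [if_neg hi, h1 i hi]
      · rw [if_neg h2, mul_zero]
    · rw [if_neg h1, zero_mul]
  · intro h; exact absurd (Finset.mem_univ _) h

theorem ActsOn.mul_comm_of_disjoint {S S' : Finset Λ} (hS : Disjoint S S') {O O' : Op Λ}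
    (h : ActsOn S O) (h' : ActsOn S' O') : O * O' = O' * O := by
  obtain ⟨K, hK⟩ := h
  obtain ⟨K', hK'⟩ := h'
  ext x z
  rw [mul_apply_of_disjoint hS hK hK', mul_apply_of_disjoint hS.symm hK' hK, mul_comm]
  congr 1
  exact propext ⟨fun h i hi hi' => h i hi' hi, fun h i hi hi' => h i hi' hi⟩

namespace LocalHamiltonian

variable {Γ : Type} [Fintype Γ] (I : LocalHamiltonian Λ Γ)

/-- The Hamiltonian with all terms negated; it reverses time. -/
def neg : LocalHamiltonian Λ Γ where
  term γ := -I.term γ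
  supp := I.supp
  isHermitian γ := (I.isHermitian γ).neg
  actsOn γ := by
    obtain ⟨K, hK⟩ := I.actsOn γ
    refine ⟨-K, fun x y => ?_⟩
    rw [Matrix.neg_apply, hK]
    split_ifs <;> simp
  norm_le_one γ := by rw [norm_neg]; exact I.norm_le_one γ

/-- The terms of `T` overlapping `S`. -/
def touching (T : Finset Γ) (S : Finset Λ) : Finset Γ :=
  T.filter fun γ => (S ∩ I.supp γ).Nonempty

/-- The sets of terms `T` and `T'` contain the same terms up to graph distance `k` from `S`. -/
def Agree (I : LocalHamiltonian Λ Γ) (T T' : Finset Γ) : ℕ → Finset Λ → Prop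
  | 0, _ => True
  | k + 1, S => ∀ γ, (S ∩ I.supp γ).Nonempty → (γ ∈ T ↔ γ ∈ T') ∧ I.Agree T T' k (I.supp γ)

theorem sum_isHermitian (T : Finset Γ) : (∑ γ ∈ T, I.term γ).IsHermitian := by
  unfold Matrix.IsHermitian
  rw [Matrix.conjTranspose_sum]
  exact Finset.sum_congr rfl fun γ _ => I.isHermitian γ

/-- Terms that do not overlap the support of `O` commute with it. -/
theorem sum_sub_touching_comm {S : Finset Λ} {O : Op Λ} (hO : ActsOn S O) (T : Finset Γ) :
    ((∑ γ ∈ T, I.term γ) - ∑ γ ∈ I.touching T S, I.term γ) * O =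
      O * ((∑ γ ∈ T, I.term γ) - ∑ γ ∈ I.touching T S, I.term γ) := by
  have h : (∑ γ ∈ T, I.term γ) - ∑ γ ∈ I.touching T S, I.term γ =
      ∑ γ ∈ T.filter fun γ => ¬(S ∩ I.supp γ).Nonempty, I.term γ := by
    rw [touching, ← Finset.sum_filter_add_sum_filter_not T fun γ => (S ∩ I.supp γ).Nonempty]
    abel
  rw [h, Finset.sum_mul, Finset.mul_sum]
  refine Finset.sum_congr rfl fun γ hγ => ?_
  have h1 := (Finset.mem_filter.1 hγ).2
  rw [Finset.not_nonempty_iff_eq_empty, ← Finset.disjoint_iff_inter_eq_empty] at h1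
  exact (I.actsOn γ).mul_comm_of_disjoint h1.symm hO

/-- A Lieb–Robinson bound: evolutions under two sets of terms that agree up to graph distance `k`
from the support of an observable differ by at most `2 (2ds)^k / k!` on it. -/
theorem norm_evolve_sub_le_of_agree {d : ℕ} (hd : I.DegreeLE d) {T T' : Finset Γ} (k : ℕ) :
    ∀ (S : Finset Λ) (O : Op Λ), ActsOn S O → ‖O‖ ≤ 1 →
      (I.touching Finset.univ S).card ≤ d → I.Agree T T' k S → ∀ s : ℝ, 0 ≤ s →
      ‖evolve (∑ γ ∈ T, I.term γ) s O - evolve (∑ γ ∈ T', I.term γ) s O‖ ≤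
        2 * ((2 * d * s) ^ k / k.factorial) := by
  induction k with
  | zero =>
    intro S O _ hO _ _ s _
    refine (norm_sub_le _ _).trans ?_
    have h1 := (norm_evolve_le (I.sum_isHermitian T) s O).trans hO
    have h2 := (norm_evolve_le (I.sum_isHermitian T') s O).trans hO
    simp
    linarith
  | succ k ih =>
    intro S O hS hO hc hA s hs
    have hG : I.touching T S = I.touching T' S := by
      ext γ
      simp only [touching, Finset.mem_filter]
      exact ⟨fun h => ⟨(hA γ h.2).1.1 h.1, h.2⟩, fun h => ⟨(hA γ h.2).1.2 h.1, h.2⟩⟩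
    have hcard : (I.touching T S).card ≤ d :=
      (Finset.card_le_card (Finset.filter_subset_filter _ (Finset.subset_univ T))).trans hc
    have h := norm_evolve_sub_le (I.sum_isHermitian T) (I.sum_isHermitian T')
      (I.sum_isHermitian (I.touching T S)) hO (I.sum_sub_touching_comm hS T)
      (by rw [hG]; exact I.sum_sub_touching_comm hS T') (k := k)
      (C := d * (2 * ((2 * d) ^ k / k.factorial))) hs (fun u hu => by
        rw [evolve_sum, evolve_sum, ← Finset.sum_sub_distrib]
        refine (norm_sum_le _ _).trans ((Finset.sum_le_card_nsmul _ _
          (2 * ((2 * d * u) ^ k / k.factorial)) fun γ hγ => ?_).trans ?_)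
        · exact ih (I.supp γ) (I.term γ) (I.actsOn γ) (I.norm_le_one γ) (hd γ)
            (hA γ (Finset.mem_filter.1 hγ).2).2 u hu
        · rw [nsmul_eq_mul, mul_pow _ u]
          have : ((I.touching T S).card : ℝ) ≤ d := by exact_mod_cast hcard
          calc _ ≤ (d : ℝ) * (2 * ((2 * d) ^ k * u ^ k / k.factorial)) := by gcongr
            _ = _ := by ring)
    refine h.trans (le_of_eq ?_)
    rw [Nat.factorial_succ]
    push_cast
    have h1 : (k : ℝ) + 1 ≠ 0 := by positivity
    have h2 : (k.factorial : ℝ) ≠ 0 := by positivity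
    field_simp
    ring

omit [Fintype Λ] in
theorem _root_.QGibbs.mem_of_singleton_inter {i : Λ} {S : Finset Λ} (h : ({i} ∩ S).Nonempty) :
    i ∈ S := by
  obtain ⟨j, hj⟩ := h
  rw [Finset.mem_inter, Finset.mem_singleton] at hj
  exact hj.1 ▸ hj.2

theorem card_touching_singleton_le {d : ℕ} (hd : I.DegreeLE d) (i : Λ) :
    (I.touching Finset.univ {i}).card ≤ d := by
  rcases (I.touching Finset.univ {i}).eq_empty_or_nonempty with h | ⟨γ, hγ⟩
  · rw [h]; simp
  · refine (Finset.card_le_card fun γ' hγ' => ?_).trans (hd γ)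
    simp only [touching, Finset.mem_filter, Finset.mem_univ, true_and] at hγ hγ' ⊢
    exact ⟨i, Finset.mem_inter.2 ⟨mem_of_singleton_inter hγ, mem_of_singleton_inter hγ'⟩⟩

open Classical in
/-- The terms of the patch around `A`. -/
def patchTerms (A : Finset Λ) (ℓ : ℕ) : Finset Γ :=
  Finset.univ.filter fun γ => I.dist (I.supp γ) A + 1 < (ℓ : ℕ∞)

theorem mem_patchTerms {A : Finset Λ} {ℓ k : ℕ} {γ : Γ} (h : I.Joined k (I.supp γ) A)
    (hk : k + 1 < ℓ) : γ ∈ I.patchTerms A ℓ := by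
  refine Finset.mem_filter.2 ⟨Finset.mem_univ _, ?_⟩
  have h1 : I.dist (I.supp γ) A ≤ (k : ℕ∞) := iInf₂_le k h
  calc I.dist (I.supp γ) A + 1 ≤ (k : ℕ∞) + 1 := by gcongr
    _ < (ℓ : ℕ∞) := by exact_mod_cast hk

theorem agree_patchTerms (A : Finset Λ) (ℓ : ℕ) (j : ℕ) : ∀ (k : ℕ) (γ : Γ),
    I.Joined k (I.supp γ) A → k + 1 + j < ℓ →
      I.Agree Finset.univ (I.patchTerms A ℓ) j (I.supp γ) := by
  induction j with
  | zero => intro _ _ _ _; trivial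
  | succ j ih =>
    intro k γ h hk γ' hγ'
    have h1 : I.Joined (k + 1) (I.supp γ') A := ⟨γ, by rwa [Finset.inter_comm], h⟩
    exact ⟨⟨fun _ => I.mem_patchTerms h1 (by omega), fun _ => Finset.mem_univ _⟩,
      ih (k + 1) γ' h1 (by omega)⟩

/-- Within distance less than `ℓ` of a site of `A`, the patch contains all terms of the Hamiltonian.
-/
theorem agree_patchTerms_singleton {A : Finset Λ} {i : Λ} (hi : i ∈ A) {ℓ j : ℕ} (hj : j < ℓ) :
    I.Agree Finset.univ (I.patchTerms A ℓ) j {i} := by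
  cases j with
  | zero => trivial
  | succ j =>
    intro γ hγ
    have h1 : I.Joined 0 (I.supp γ) A :=
      ⟨i, Finset.mem_inter.2 ⟨mem_of_singleton_inter hγ, hi⟩⟩
    exact ⟨⟨fun _ => I.mem_patchTerms h1 (by omega), fun _ => Finset.mem_univ _⟩,
      I.agree_patchTerms A ℓ j 0 γ h1 (by omega)⟩

/-- The Lieb–Robinson bound for the patch, at times of either sign: negating all terms reverses
time. -/
theorem norm_evolve_patch_sub_le {d : ℕ} (hd : I.DegreeLE d) {A : Finset Λ} {i : Λ} (hi : i ∈ A)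
    {O : Op Λ} (hO : ActsOn {i} O) (hO1 : ‖O‖ ≤ 1) {k ℓ : ℕ} (hk : k < ℓ) (s : ℝ) :
    ‖evolve I.ham s O - evolve (I.patch A ℓ) s O‖ ≤ 2 * ((2 * d * |s|) ^ k / k.factorial) := by
  have h0 : ∀ (J : LocalHamiltonian Λ Γ), J.DegreeLE d → ∀ s : ℝ, 0 ≤ s →
      ‖evolve J.ham s O - evolve (J.patch A ℓ) s O‖ ≤ 2 * ((2 * d * s) ^ k / k.factorial) :=
    fun J hJ s hs => J.norm_evolve_sub_le_of_agree hJ (T := Finset.univ)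
      (T' := J.patchTerms A ℓ) k {i} O hO hO1 (J.card_touching_singleton_le hJ i)
      (J.agree_patchTerms_singleton hi hk) s hs
  rcases le_total 0 s with hs | hs
  · rw [abs_of_nonneg hs]; exact h0 I hd s hs
  · have h := h0 I.neg hd (-s) (by linarith)
    have h1 : I.neg.ham = -I.ham := by
      simp only [ham, neg, Finset.sum_neg_distrib]
    have hJ : ∀ k S B, I.neg.Joined k S B ↔ I.Joined k S B := fun k => by
      induction k with
      | zero => intro S B; rfl
      | succ k ih => intro S B; simp only [Joined, ih]; rfl
    have hdist : ∀ S B, I.neg.dist S B = I.dist S B := fun S B => by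
      simp only [dist, hJ]
    have h2 : I.neg.patch A ℓ = -I.patch A ℓ := by
      simp only [patch, ← Finset.sum_neg_distrib, hdist]
      rfl
    rw [h1, h2, evolve_neg, evolve_neg, neg_neg] at h
    rwa [abs_of_nonpos hs]

end LocalHamiltonian

end Locality

/-! ### Single-site operators -/

section SiteOp

variable {Λ : Type} [Fintype Λ] [DecidableEq Λ] (i : Λ)

theorem siteOp_mul_apply (M : Matrix (Fin 2) (Fin 2) ℂ) (O : Op Λ) (x y : Λ → Fin 2) :
    (siteOp i M * O) x y = ∑ a, M (x i) a * O (Function.update x i a) y := by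
  rw [Matrix.mul_apply, ← Finset.sum_subset (Finset.subset_univ
    (Finset.univ.image fun a => Function.update x i a)), Finset.sum_image]
  · refine Finset.sum_congr rfl fun a _ => ?_
    rw [siteOp, Matrix.of_apply, if_pos fun j hj => (Function.update_of_ne hj _ _).symm,
      Function.update_self]
  · intro a _ b _ hab
    simpa using congrFun hab i
  · intro z _ hz
    rw [siteOp, Matrix.of_apply, if_neg, zero_mul]
    intro h
    refine hz (Finset.mem_image.2 ⟨z i, Finset.mem_univ _, funext fun j => ?_⟩)
    by_cases hj : j = i
    · subst hj; simp
    · rw [Function.update_of_ne hj, h j hj]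

theorem siteOp_conjTranspose (M : Matrix (Fin 2) (Fin 2) ℂ) : (siteOp i M)ᴴ = siteOp i Mᴴ := by
  ext x y
  simp only [siteOp, Matrix.conjTranspose_apply, Matrix.of_apply, eq_comm, apply_ite star,
    star_zero]

theorem mul_siteOp_apply (M : Matrix (Fin 2) (Fin 2) ℂ) (O : Op Λ) (x y : Λ → Fin 2) :
    (O * siteOp i M) x y = ∑ a, O x (Function.update y i a) * M a (y i) := by
  have h := congrArg star (siteOp_mul_apply i Mᴴ Oᴴ y x)
  rw [← siteOp_conjTranspose, ← Matrix.conjTranspose_mul, Matrix.conjTranspose_apply,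
    star_star] at h
  rw [h, star_sum]
  refine Finset.sum_congr rfl fun a _ => ?_
  simp [Matrix.conjTranspose_apply, mul_comm]

theorem siteOp_mul (M N : Matrix (Fin 2) (Fin 2) ℂ) :
    siteOp i M * siteOp i N = siteOp i (M * N) := by
  ext x y
  rw [siteOp_mul_apply]
  simp only [siteOp, Matrix.of_apply, Matrix.mul_apply, Function.update_self]
  have : ∀ a, (∀ j, j ≠ i → Function.update x i a j = y j) ↔ ∀ j, j ≠ i → x j = y j := fun a =>
    forall₂_congr fun j hj => by rw [Function.update_of_ne hj]
  simp only [this]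
  split_ifs <;> simp

theorem siteOp_one : siteOp i (1 : Matrix (Fin 2) (Fin 2) ℂ) = 1 := by
  ext x y
  by_cases h : x = y
  · subst h; simp [siteOp]
  · rw [Matrix.one_apply_ne h, siteOp, Matrix.of_apply]
    split_ifs with h1
    · rw [Matrix.one_apply_ne]
      intro h2
      exact h (funext fun j => by
        by_cases hj : j = i
        · rw [hj, h2]
        · exact h1 j hj)
    · rfl

theorem pauli_mul_self (a : Fin 3) : pauli a * pauli a = 1 := by
  fin_cases a <;> ext i j <;> fin_cases i <;> fin_cases j <;>
    simp [pauli, Matrix.mul_apply, Fin.sum_univ_two]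

theorem pauli_conjTranspose (a : Fin 3) : (pauli a)ᴴ = pauli a := by
  fin_cases a <;> ext i j <;> fin_cases i <;> fin_cases j <;>
    simp [pauli, Matrix.conjTranspose_apply]

theorem norm_siteOp_pauli_le (a : Fin 3) : ‖siteOp i (pauli a)‖ ≤ 1 := by
  refine norm_unitary_le ⟨siteOp i (pauli a), ?_⟩
  rw [Matrix.mem_unitaryGroup_iff, Matrix.star_eq_conjTranspose, siteOp_conjTranspose, siteOp_mul,
    pauli_conjTranspose, pauli_mul_self, siteOp_one]

theorem actsOn_siteOp (M : Matrix (Fin 2) (Fin 2) ℂ) : ActsOn {i} (siteOp i M) :=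
  ⟨Matrix.of fun u v => M (u ⟨i, Finset.mem_singleton_self i⟩) (v ⟨i, Finset.mem_singleton_self i⟩),
    fun x y => by simp [siteOp]⟩

end SiteOp

/-! ### The generator depends quasi-locally on the Hamiltonian -/

section QuasiLocal

open MeasureTheory

/-- The scalar optimisation of the Lieb–Robinson bound: `min(1, yᵏ/k!)` is at most
`2⁻ᵏ + e^{|s| - k/(4eb)}` for `y = 2b|s|`. -/
theorem lieb_robinson_scalar {D b s : ℝ} (hb : 0 < b) {ℓ : ℕ} (h2 : D ≤ 2)
    (h : ∀ k < ℓ, D ≤ 2 * ((2 * b * |s|) ^ k / k.factorial)) :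
    D ≤ 4 * (Real.exp (-(1 / (8 * Real.exp 1) * (ℓ / b))) + 1 / 2 ^ ℓ) * Real.exp |s| := by
  have hs : 1 ≤ Real.exp |s| := Real.one_le_exp (abs_nonneg s)
  have hp : 0 < Real.exp (-(1 / (8 * Real.exp 1) * (ℓ / b))) := Real.exp_pos _
  rcases Nat.lt_or_ge ℓ 2 with hℓ | hℓ
  · have h1 : (1 : ℝ) / 2 ≤ 1 / 2 ^ ℓ := by interval_cases ℓ <;> norm_num
    nlinarith
  obtain ⟨k, rfl⟩ : ∃ k, ℓ = k + 1 := ⟨ℓ - 1, by omega⟩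
  have hk : (1 : ℝ) ≤ k := by exact_mod_cast (by omega : 1 ≤ k)
  have hk0 : (0 : ℝ) < k := by linarith
  rcases le_total (2 * b * |s|) (k / (2 * Real.exp 1)) with hy | hy
  · have h1 := h k (by omega)
    have h3 : (2 * b * |s|) ^ k / k.factorial ≤ (1 / 2) ^ k := by
      have h4 := Real.pow_div_factorial_le_exp (x := (k : ℝ)) hk0.le k
      have h5 : (2 * b * |s|) ^ k ≤ (k / (2 * Real.exp 1)) ^ k := by
        gcongr
      calc (2 * b * |s|) ^ k / k.factorial ≤ (k / (2 * Real.exp 1)) ^ k / k.factorial := by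
            gcongr
        _ = (k ^ k / k.factorial) * (1 / (2 * Real.exp 1)) ^ k := by
            rw [div_pow, div_pow, one_pow]; field_simp
        _ ≤ Real.exp k * (1 / (2 * Real.exp 1)) ^ k := by gcongr
        _ = (1 / 2) ^ k := by
            rw [← Real.exp_one_pow, ← mul_pow]
            congr 1
            field_simp
    have h6 : (1 / 2 : ℝ) ^ k = 2 * (1 / 2 ^ (k + 1)) := by
      rw [pow_succ, one_div_pow]; field_simp
    have h7 : (0 : ℝ) < 1 / 2 ^ (k + 1) := by positivity
    rw [h6] at h3
    nlinarith
  · have h1 : 1 / (8 * Real.exp 1) * (((k + 1 : ℕ) : ℝ) / b) ≤ |s| := by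
      push_cast
      rw [div_le_iff₀ (by positivity)] at hy
      rw [div_mul_div_comm, div_le_iff₀ (by positivity)]
      nlinarith
    have h3 : 1 ≤ Real.exp (-(1 / (8 * Real.exp 1) * (((k + 1 : ℕ) : ℝ) / b))) * Real.exp |s| := by
      rw [← Real.exp_add]
      exact Real.one_le_exp (by linarith)
    have h7 : (0 : ℝ) < 1 / 2 ^ (k + 1) * Real.exp |s| := by positivity
    nlinarith

/-- The square of the constant controlling Gaussian windows against exponential growth. -/
def growthSq : ℝ :=
  ∫ s : ℝ, Real.sqrt (2 / Real.pi) * Real.exp (1 / 8) * Real.exp (2 * |s| - 2 * s ^ 2)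

theorem integrable_growth : Integrable fun s : ℝ =>
    Real.sqrt (2 / Real.pi) * Real.exp (1 / 8) * Real.exp (2 * |s| - 2 * s ^ 2) := by
  refine Integrable.const_mul ?_ _
  refine ((integrable_exp_neg_mul_sq (b := 1) one_pos).const_mul (Real.exp 1)).mono'
    (by fun_prop) (Filter.Eventually.of_forall fun s => ?_)
  rw [Real.norm_of_nonneg (Real.exp_pos _).le, ← Real.exp_add, Real.exp_le_exp]
  nlinarith [sq_abs s, sq_nonneg (|s| - 1)]

variable {n : Type*} [Fintype n] [DecidableEq n]

/-- By Plancherel's identity, a family growing at most like `m e^{a|s|}` has a windowed Fourier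
transform of square norm at most `m²` up to a constant and the growth at the centre `-Re c` of the
window. -/
theorem integral_windowFT_sq_le {O : ℝ → Matrix n n ℂ} (hO : IsTrigFamily O) {c : ℂ}
    (hc : c.im ^ 2 ≤ 1 / 16) {a m : ℝ} (ha : 0 ≤ a) (ha1 : a ≤ 1)
    (hm : ∀ s, ‖O s‖ ≤ m * Real.exp (a * |s|)) (v : EuclideanSpace ℂ n) (hv : ‖v‖ = 1) :
    ∫ ω, ‖act (windowFT c O ω) v‖ ^ 2 ≤ (m * Real.sqrt growthSq * Real.exp (a * |c.re|)) ^ 2 := by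
  obtain ⟨_, h1, h2⟩ := plancherel_act c hO v
  have hK : 0 ≤ growthSq := integral_nonneg fun s => by positivity
  have h4 : (m * Real.sqrt growthSq * Real.exp (a * |c.re|)) ^ 2 =
      ∫ s : ℝ, (m * Real.exp (a * |c.re|)) ^ 2 * (Real.sqrt (2 / Real.pi) * Real.exp (1 / 8) *
        Real.exp (2 * |s + c.re| - 2 * (s + c.re) ^ 2)) := by
    rw [integral_const_mul, integral_add_right_eq_self (fun s : ℝ =>
      Real.sqrt (2 / Real.pi) * Real.exp (1 / 8) * Real.exp (2 * |s| - 2 * s ^ 2)) c.re]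
    change _ = _ * growthSq
    rw [mul_right_comm, mul_pow _ (Real.sqrt growthSq), Real.sq_sqrt hK]
  rw [h2, h4]
  refine integral_mono h1 ((integrable_growth.comp_add_right c.re).const_mul _) fun s => ?_
  have h5 : ‖act (O s) v‖ ≤ m * Real.exp (a * |s|) := by
    have := (norm_act_le (O s) v).trans_eq (by rw [hv, mul_one])
    exact this.trans (hm s)
  have hm0 : 0 ≤ m := by
    have := (norm_nonneg _).trans (hm 0)
    simpa using this
  have h6 : ‖window c s‖ ^ 2 ≤ Real.sqrt (2 / Real.pi) * Real.exp (1 / 8) *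
      Real.exp (- 2 * (s + c.re) ^ 2) := by
    rw [norm_window, mul_pow, Real.sq_sqrt (by positivity), ← Real.exp_nat_mul, mul_assoc,
      ← Real.exp_add]
    gcongr
    push_cast
    linarith
  have h7 : Real.exp (a * |s|) ^ 2 ≤ Real.exp (a * |c.re|) ^ 2 * Real.exp (2 * |s + c.re|) := by
    rw [← Real.exp_nat_mul, ← Real.exp_nat_mul, ← Real.exp_add, Real.exp_le_exp]
    push_cast
    have : |s| ≤ |s + c.re| + |c.re| := by
      have := abs_sub (s + c.re) c.re
      rwa [add_sub_cancel_right] at this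
    nlinarith [abs_nonneg (s + c.re)]
  calc ‖window c s‖ ^ 2 * ‖act (O s) v‖ ^ 2
      ≤ (Real.sqrt (2 / Real.pi) * Real.exp (1 / 8) * Real.exp (- 2 * (s + c.re) ^ 2)) *
        (m * Real.exp (a * |s|)) ^ 2 := by gcongr
    _ = (Real.sqrt (2 / Real.pi) * Real.exp (1 / 8) * Real.exp (- 2 * (s + c.re) ^ 2)) *
        (m ^ 2 * Real.exp (a * |s|) ^ 2) := by ring
    _ ≤ (Real.sqrt (2 / Real.pi) * Real.exp (1 / 8) * Real.exp (- 2 * (s + c.re) ^ 2)) *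
        (m ^ 2 * (Real.exp (a * |c.re|) ^ 2 * Real.exp (2 * |s + c.re|))) := by gcongr
    _ = _ := by
      rw [sub_eq_add_neg, Real.exp_add, neg_mul]
      ring

variable (U U' : Matrix.unitaryGroup n ℂ) (e e' : n → ℝ) {A : Matrix n n ℂ}

theorem integral_freqComp_sq_le (hA : ‖A‖ ≤ 1) {c : ℂ} (hc : c.im ^ 2 ≤ 1 / 16)
    (v : EuclideanSpace ℂ n) (hv : ‖v‖ = 1) :
    ∫ ω, ‖act (freqComp U e c A ω) v‖ ^ 2 ≤ Real.sqrt growthSq ^ 2 := by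
  have h := integral_windowFT_sq_le (isTrigFamily_heis U e A) hc (a := 0) (m := 1) le_rfl zero_le_one
    (fun s => by rw [norm_heis]; simpa using hA) v hv
  rw [zero_mul, Real.exp_zero, one_mul, mul_one] at h
  exact h

theorem integral_freqComp_sub_sq_le {m : ℝ}
    (hm : ∀ s, ‖heis U e s A - heis U' e' s A‖ ≤ m * Real.exp |s|) {c : ℂ} (hc : c.im ^ 2 ≤ 1 / 16)
    (v : EuclideanSpace ℂ n) (hv : ‖v‖ = 1) :
    ∫ ω, ‖act (freqComp U e c A ω - freqComp U' e' c A ω) v‖ ^ 2 ≤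
      (m * Real.sqrt growthSq * Real.exp |c.re|) ^ 2 := by
  have h := integral_windowFT_sq_le ((isTrigFamily_heis U e A).sub (isTrigFamily_heis U' e' A)) hc
    (a := 1) (m := m) zero_le_one le_rfl (fun s => by simpa using hm s) v hv
  simp only [windowFT_sub c (isTrigFamily_heis U e A) (isTrigFamily_heis U' e' A), one_mul] at h
  exact h

/-- The integrals defining the generator depend on the Hamiltonian only through the evolution of the
jump: after telescoping the difference of the two products, Cauchy–Schwarz and Plancherel bound each
term. -/
theorem norm_sandwich_sub_le (hA : ‖A‖ ≤ 1) {m : ℝ}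
    (hm : ∀ s, ‖heis U e s A - heis U' e' s A‖ ≤ m * Real.exp |s|) {c c' : ℂ}
    (hc : c.im ^ 2 ≤ 1 / 16) (hc' : c'.im ^ 2 ≤ 1 / 16) (hcc : c.re = c'.re) (X : Matrix n n ℂ) :
    ‖(∫ ω, (metro ω : ℂ) • ((freqComp U e c A ω)ᴴ * X * freqComp U e c' A ω)) -
      ∫ ω, (metro ω : ℂ) • ((freqComp U' e' c A ω)ᴴ * X * freqComp U' e' c' A ω)‖ ≤
      2 * m * growthSq * Real.exp |c.re| * ‖X‖ := by
  have hK : 0 ≤ growthSq := integral_nonneg fun s => by positivity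
  have hm0 : 0 ≤ m := by
    have := (norm_nonneg _).trans (hm 0)
    simpa using this
  set P := fun ω => freqComp U e c A ω
  set P' := fun ω => freqComp U' e' c A ω
  set R := fun ω => freqComp U e c' A ω
  set R' := fun ω => freqComp U' e' c' A ω
  have hsq := fun (V : Matrix.unitaryGroup n ℂ) (f : n → ℝ) (z : ℂ) (v : EuclideanSpace ℂ n) =>
    (plancherel_act z (isTrigFamily_heis V f A) v).1
  have hsq' : ∀ (z : ℂ) (v : EuclideanSpace ℂ n), Integrable fun ω =>
      ‖act (freqComp U e z A ω - freqComp U' e' z A ω) v‖ ^ 2 := fun z v => by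
    have h := (plancherel_act z ((isTrigFamily_heis U e A).sub (isTrigFamily_heis U' e' A)) v).1
    simp only [windowFT_sub z (isTrigFamily_heis U e A) (isTrigFamily_heis U' e' A)] at h
    exact h
  have hd1 : Integrable fun ω => (metro ω : ℂ) • ((P ω - P' ω)ᴴ * X * R ω) := by
    refine ((integrable_sandwich U e A c c' X).sub
      (integrable_sandwich_mixed U' e' A U e c c' X)).congr (Filter.Eventually.of_forall fun ω => ?_)
    simp only [P, P', R, Matrix.conjTranspose_sub, sub_mul, smul_sub, Pi.sub_apply]
  have hd2 : Integrable fun ω => (metro ω : ℂ) • ((P' ω)ᴴ * X * (R ω - R' ω)) := by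
    refine ((integrable_sandwich_mixed U' e' A U e c c' X).sub
      (integrable_sandwich U' e' A c c' X)).congr (Filter.Eventually.of_forall fun ω => ?_)
    simp only [P', R, R', mul_sub, smul_sub, Pi.sub_apply]
  have h1 : (∫ ω, (metro ω : ℂ) • ((P ω)ᴴ * X * R ω)) -
      ∫ ω, (metro ω : ℂ) • ((P' ω)ᴴ * X * R' ω) =
      (∫ ω, (metro ω : ℂ) • ((P ω - P' ω)ᴴ * X * R ω)) +
        ∫ ω, (metro ω : ℂ) • ((P' ω)ᴴ * X * (R ω - R' ω)) := by
    rw [← integral_add hd1 hd2, ← integral_sub (integrable_sandwich U e A c c' X)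
      (integrable_sandwich U' e' A c c' X)]
    congr 1
    funext ω
    simp only [P, P', R, R', Matrix.conjTranspose_sub, sub_mul, mul_sub, smul_sub]
    abel
  have hme := fun (V : Matrix.unitaryGroup n ℂ) (f : n → ℝ) (z : ℂ) =>
    (integrable_freqComp V f A z).aestronglyMeasurable
  have h2 := norm_integral_sandwich_le (P := fun ω => P ω - P' ω) (R := R) (X := X)
    (a := m * Real.sqrt growthSq * Real.exp |c.re|) (b := Real.sqrt growthSq) (by positivity)
    (by positivity) metro_nonneg metro_le_one ((hme U e c).sub (hme U' e' c)) (hme U e c')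
    (hsq' c) (hsq U e c') (integral_freqComp_sub_sq_le U U' e e' hm hc)
    (integral_freqComp_sq_le U e hA hc') hd1
  have h3 := norm_integral_sandwich_le (P := P') (R := fun ω => R ω - R' ω) (X := X)
    (a := Real.sqrt growthSq) (b := m * Real.sqrt growthSq * Real.exp |c'.re|) (by positivity)
    (by positivity) metro_nonneg metro_le_one (hme U' e' c) ((hme U e c').sub (hme U' e' c'))
    (hsq U' e' c) (hsq' c') (integral_freqComp_sq_le U' e' hA hc)
    (integral_freqComp_sub_sq_le U U' e e' hm hc') hd2
  rw [h1]
  refine (norm_add_le _ _).trans ((add_le_add h2 h3).trans (le_of_eq ?_))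
  rw [← hcc]
  have := Real.mul_self_sqrt hK
  linear_combination 2 * m * Real.exp |c.re| * ‖X‖ * this

/-- The growth `e^{|t|}` of the difference of the evolutions is integrable against the time kernel.
-/
theorem norm_effOp_sub_le (hA : ‖A‖ ≤ 1) {m : ℝ}
    (hm : ∀ s, ‖heis U e s A - heis U' e' s A‖ ≤ m * Real.exp |s|) :
    ‖effOp U e A - effOp U' e' A‖ ≤
      2 * m * growthSq * ∫ t, sechKernel t * Real.exp |t| := by
  rw [effOp_eq_integral, effOp_eq_integral, ← integral_sub (integrable_shiftedDecay U e A)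
    (integrable_shiftedDecay U' e' A), ← integral_const_mul]
  refine norm_integral_le_of_norm_le (integrable_sechKernel_mul_exp.const_mul _)
    (Filter.Eventually.of_forall fun t => ?_)
  rw [← smul_sub, norm_smul, Complex.norm_real, Real.norm_of_nonneg (sechKernel_pos t).le]
  have h := norm_sandwich_sub_le U U' e e' hA hm (c := -(Complex.I / 4) - t)
    (c' := Complex.I / 4 - t) (by norm_num) (by norm_num) (by simp) 1
  have hK : 0 ≤ growthSq := integral_nonneg fun s => by positivity
  have hm0 : 0 ≤ m := by
    have := (norm_nonneg _).trans (hm 0)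
    simpa using this
  have h1 : ‖shiftedDecay U e A t - shiftedDecay U' e' A t‖ ≤
      2 * m * growthSq * Real.exp |t| := by
    refine h.trans ((mul_le_of_le_one_right (by positivity) norm_one_le).trans (le_of_eq ?_))
    simp
  calc sechKernel t * _ ≤ sechKernel t * (2 * m * growthSq * Real.exp |t|) :=
        mul_le_mul_of_nonneg_left h1 (sechKernel_pos t).le
    _ = _ := by ring

/-- The constant in the quasi-locality estimate for the generator of a single jump. -/
def jumpConst : ℝ := 2 * growthSq * (1 + 2 * ∫ t, sechKernel t * Real.exp |t|)

theorem jumpConst_nonneg : 0 ≤ jumpConst := by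
  have hK : 0 ≤ growthSq := integral_nonneg fun s => by positivity
  have hS : 0 ≤ ∫ t, sechKernel t * Real.exp |t| :=
    integral_nonneg fun t => mul_nonneg (sechKernel_pos t).le (Real.exp_pos _).le
  unfold jumpConst
  positivity

/-- The generator depends continuously on the Heisenberg evolution of its jump operator. -/
theorem norm_jumpDual_sub_le (hA : ‖A‖ ≤ 1) {m : ℝ}
    (hm : ∀ s, ‖heis U e s A - heis U' e' s A‖ ≤ m * Real.exp |s|) :
    ‖jumpDual U e A - jumpDual U' e' A‖ ≤ jumpConst * m := by
  have hm0 : 0 ≤ m := by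
    have := (norm_nonneg _).trans (hm 0)
    simpa using this
  refine ContinuousLinearMap.opNorm_le_bound _ (mul_nonneg jumpConst_nonneg hm0) fun X => ?_
  have h1 := norm_sandwich_sub_le U U' e e' hA hm (c := 0) (c' := 0) (by norm_num) (by norm_num)
    rfl X
  have h2 := norm_effOp_sub_le U U' e e' hA hm
  have h3 : (jumpDual U e A - jumpDual U' e' A) X =
      ((∫ ω, (metro ω : ℂ) • ((freqComp U e 0 A ω)ᴴ * X * freqComp U e 0 A ω)) -
        ∫ ω, (metro ω : ℂ) • ((freqComp U' e' 0 A ω)ᴴ * X * freqComp U' e' 0 A ω)) -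
      (effOp U e A - effOp U' e' A) * X - X * (effOp U e A - effOp U' e' A)ᴴ := by
    rw [sub_apply, jumpDual_apply, jumpDual_apply, Matrix.conjTranspose_sub, sub_mul, mul_sub]
    abel
  rw [h3]
  have h4 := (norm_mul_le (effOp U e A - effOp U' e' A) X).trans
    (mul_le_mul_of_nonneg_right h2 (norm_nonneg X))
  have h5 := (norm_mul_le X (effOp U e A - effOp U' e' A)ᴴ).trans_eq
    (by rw [Matrix.l2_opNorm_conjTranspose])
  have h6 := h5.trans (mul_le_mul_of_nonneg_left h2 (norm_nonneg X))
  refine (norm_sub_le _ _).trans ((add_le_add (norm_sub_le _ _) le_rfl).trans ?_)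
  refine (add_le_add (add_le_add h1 h4) h6).trans (le_of_eq ?_)
  simp [jumpConst]
  ring

end QuasiLocal

/-! ### Strictly local superoperators -/

section StrictLocality

open MeasureTheory

/-- Also true of a non-integrable family, whose integral is `0` by convention. -/
theorem integral_mem_submodule {E : Type*} [NormedAddCommGroup E] [NormedSpace ℂ E]
    [FiniteDimensional ℂ E] {α : Type*} [MeasurableSpace α] {μ : Measure α} (S : Submodule ℂ E)
    {f : α → E} (hf : ∀ a, f a ∈ S) : ∫ a, f a ∂μ ∈ S := by
  have : CompleteSpace E := FiniteDimensional.complete ℂ E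
  by_cases hi : Integrable f μ
  · rw [← Subspace.forall_mem_dualAnnihilator_apply_eq_zero_iff]
    intro φ hφ
    have h := (LinearMap.toContinuousLinearMap φ).integral_comp_comm hi
    have h0 : ∀ a, φ (f a) = 0 := fun a => (Submodule.mem_dualAnnihilator φ).1 hφ _ (hf a)
    simp only [LinearMap.coe_toContinuousLinearMap', h0, integral_zero] at h
    exact h.symm
  · rw [integral_undef hi]; exact S.zero_mem

theorem exp_mem_subalgebra {𝔸 : Type*} [NormedRing 𝔸] [NormedAlgebra ℂ 𝔸]
    [FiniteDimensional ℂ 𝔸] (S : Subalgebra ℂ 𝔸) {x : 𝔸} (hx : x ∈ S) :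
    NormedSpace.exp x ∈ S := by
  have : CompleteSpace 𝔸 := FiniteDimensional.complete ℂ 𝔸
  have hc : IsClosed (S : Set 𝔸) := (Subalgebra.toSubmodule S).closed_of_finiteDimensional
  have hs := NormedSpace.exp_series_hasSum_exp' (𝕂 := ℂ) x
  refine hc.mem_of_tendsto hs (Filter.Eventually.of_forall fun T => ?_)
  exact S.sum_mem fun k _ => S.smul_mem (S.pow_mem hx k) _

theorem avgExp_mem {𝔸 : Type*} [NormedRing 𝔸] [NormedAlgebra ℂ 𝔸]
    [FiniteDimensional ℂ 𝔸] (S : Subalgebra ℂ 𝔸) {L : 𝔸} (hL : L ∈ S) (t : ℝ) :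
    avgExp L t ∈ S := by
  rw [avgExp, intervalIntegral.intervalIntegral_eq_integral_uIoc]
  refine S.smul_mem ?_ _
  have h := integral_mem_submodule (μ := volume.restrict (Set.uIoc 0 t))
    (Subalgebra.toSubmodule S) (f := fun s : ℝ => NormedSpace.exp ((s : ℂ) • L))
    fun s => exp_mem_subalgebra S (S.smul_mem hL (s : ℂ))
  split_ifs
  · rw [one_smul]; exact h
  · rw [neg_smul, one_smul]; exact S.neg_mem h

variable {Λ : Type} [Fintype Λ] [DecidableEq Λ] (S : Finset Λ)

omit [Fintype Λ] in
theorem glue_glue (u v : S → Fin 2) (x : Λ → Fin 2) : glue S u (glue S v x) = glue S u x := by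
  funext i; unfold glue; split_ifs <;> rfl

omit [Fintype Λ] in
theorem glue_apply_mem (u : S → Fin 2) (x : Λ → Fin 2) : (fun i : S => glue S u x i) = u := by
  funext i; simp [glue]

omit [Fintype Λ] in
theorem glue_self (x : Λ → Fin 2) : glue S (fun i => x i) x = x := by
  funext i; unfold glue; split_ifs <;> rfl

theorem sum_glue (f : (Λ → Fin 2) → ℂ) (x : Λ → Fin 2)
    (hf : ∀ z, (¬∀ i, i ∉ S → x i = z i) → f z = 0) :
    ∑ z, f z = ∑ u : S → Fin 2, f (glue S u x) := by
  rw [← Finset.sum_subset (Finset.subset_univ (Finset.univ.image fun u => glue S u x)),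
    Finset.sum_image]
  · intro u _ v _ huv
    rw [← glue_apply_mem S u x, ← glue_apply_mem S v x]
    simp only at huv
    rw [huv]
  · intro z _ hz
    refine hf z fun h => hz (Finset.mem_image.2 ⟨fun i => z i, Finset.mem_univ _, funext fun i => ?_⟩)
    unfold glue
    split_ifs with hi
    · rfl
    · exact h i hi

/-- The superoperators strictly local on `S`, as a subalgebra. -/
def localSuperOps : Subalgebra ℂ (SuperOp Λ) where
  carrier := {Φ | SuperActsOn S Φ}
  mul_mem' := by
    rintro Φ Φ' ⟨Ψ, hΨ⟩ ⟨Ψ', hΨ'⟩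
    refine ⟨Ψ ∘ₗ Ψ', fun O x y => ?_⟩
    change Φ (Φ' O) x y = Ψ (Ψ' _) _ _
    have h : (Matrix.of fun u v => Φ' O (glue S u x) (glue S v y)) =
        Ψ' (Matrix.of fun u v => O (glue S u x) (glue S v y)) := by
      ext u v
      rw [Matrix.of_apply, hΨ']
      simp only [glue_glue, glue_apply_mem]
    rw [hΨ, h]
  add_mem' := by
    rintro Φ Φ' ⟨Ψ, hΨ⟩ ⟨Ψ', hΨ'⟩
    refine ⟨Ψ + Ψ', fun O x y => ?_⟩
    rw [add_apply, Matrix.add_apply, hΨ, hΨ']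
    rfl
  algebraMap_mem' c := by
    refine ⟨c • LinearMap.id, fun O x y => ?_⟩
    simp only [Algebra.algebraMap_eq_smul_one, smul_apply, one_apply_eq_self, LinearMap.smul_apply,
      LinearMap.id_apply, Matrix.smul_apply, Matrix.of_apply, glue_self]

theorem mul_mem_localSuperOps {M : Op Λ} (hM : ActsOn S M) :
    ContinuousLinearMap.mul ℂ (Op Λ) M ∈ localSuperOps S := by
  obtain ⟨K, hK⟩ := hM
  refine ⟨LinearMap.mulLeft ℂ K, fun O x y => ?_⟩
  rw [ContinuousLinearMap.mul_apply', Matrix.mul_apply, sum_glue S _ x fun z hz => by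
    rw [hK, if_neg hz, zero_mul], LinearMap.mulLeft_apply, Matrix.mul_apply]
  refine Finset.sum_congr rfl fun u _ => ?_
  rw [hK, if_pos fun i hi => by simp [glue, hi], glue_apply_mem, Matrix.of_apply, glue_self]

theorem mul_flip_mem_localSuperOps {M : Op Λ} (hM : ActsOn S M) :
    (ContinuousLinearMap.mul ℂ (Op Λ)).flip M ∈ localSuperOps S := by
  obtain ⟨K, hK⟩ := hM
  refine ⟨LinearMap.mulRight ℂ K, fun O x y => ?_⟩
  rw [ContinuousLinearMap.flip_apply, ContinuousLinearMap.mul_apply', Matrix.mul_apply,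
    sum_glue S _ y fun z hz => by
      rw [hK, if_neg fun h => hz fun i hi => (h i hi).symm, mul_zero],
    LinearMap.mulRight_apply, Matrix.mul_apply]
  refine Finset.sum_congr rfl fun u _ => ?_
  rw [hK, if_pos fun i hi => by simp [glue, hi], glue_apply_mem, Matrix.of_apply, glue_self]

/-- An operator acts on `S` exactly when left multiplication by it is strictly local on `S`. -/
theorem actsOn_iff {M : Op Λ} :
    ActsOn S M ↔ ContinuousLinearMap.mul ℂ (Op Λ) M ∈ localSuperOps S := by
  refine ⟨mul_mem_localSuperOps S, fun ⟨Ψ, hΨ⟩ => ⟨Ψ 1, fun x y => ?_⟩⟩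
  have h := hΨ 1 x y
  rw [ContinuousLinearMap.mul_apply', mul_one] at h
  rw [h]
  split_ifs with hxy
  · have : (Matrix.of fun u v => (1 : Op Λ) (glue S u x) (glue S v y)) = 1 := by
      ext u v
      rw [Matrix.of_apply]
      by_cases huv : u = v
      · subst huv
        rw [Matrix.one_apply_eq]
        have : glue S u x = glue S u y := by
          funext i
          unfold glue
          split_ifs with hi
          · rfl
          · exact hxy i hi
        rw [this, Matrix.one_apply_eq]
      · rw [Matrix.one_apply_ne huv, Matrix.one_apply_ne]
        intro h1
        apply huv
        rw [← glue_apply_mem S u x, ← glue_apply_mem S v y, h1]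
    rw [this]
  · have : (Matrix.of fun u v => (1 : Op Λ) (glue S u x) (glue S v y)) = 0 := by
      ext u v
      rw [Matrix.of_apply, Matrix.one_apply_ne, Matrix.zero_apply]
      intro h1
      refine hxy fun i hi => ?_
      have := congrFun h1 i
      simpa [glue, hi] using this
    rw [this, map_zero, Matrix.zero_apply]

/-- The operators acting on `S`, as a subalgebra. -/
def localOps : Subalgebra ℂ (Op Λ) where
  carrier := {M | ActsOn S M}
  mul_mem' {M M'} h h' := by
    refine (actsOn_iff S).2 ?_
    have := (localSuperOps S).mul_mem ((actsOn_iff S).1 h) ((actsOn_iff S).1 h')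
    convert this using 1
    ext1 O
    exact mul_assoc M M' O
  add_mem' {M M'} h h' := by
    refine (actsOn_iff S).2 ?_
    rw [map_add]
    exact (localSuperOps S).add_mem ((actsOn_iff S).1 h) ((actsOn_iff S).1 h')
  algebraMap_mem' c := by
    refine (actsOn_iff S).2 ?_
    rw [Algebra.algebraMap_eq_smul_one, map_smul]
    refine (localSuperOps S).smul_mem ?_ c
    convert (localSuperOps S).one_mem using 1
    ext1 O
    exact one_mul O

theorem ActsOn.conjTranspose {M : Op Λ} (h : ActsOn S M) : ActsOn S Mᴴ := by
  obtain ⟨K, hK⟩ := h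
  refine ⟨Kᴴ, fun x y => ?_⟩
  rw [Matrix.conjTranspose_apply, hK, Matrix.conjTranspose_apply, apply_ite star, star_zero]
  simp only [eq_comm]

variable {S}

theorem ActsOn.mono {T : Finset Λ} (hST : S ⊆ T) {M : Op Λ} (h : ActsOn S M) : ActsOn T M := by
  obtain ⟨K, hK⟩ := h
  refine ⟨Matrix.of fun u v => if ∀ i : T, (i : Λ) ∉ S → u i = v i then
    K (fun i => u ⟨i, hST i.2⟩) (fun i => v ⟨i, hST i.2⟩) else 0, fun x y => ?_⟩
  rw [hK, Matrix.of_apply, ← ite_and]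
  congr 1
  refine propext ⟨fun h => ⟨fun i hi => h i fun hS => hi (hST hS), fun i hi => h i hi⟩,
    fun h i hi => ?_⟩
  by_cases hT : i ∈ T
  · exact h.2 ⟨i, hT⟩ hi
  · exact h.1 i hT

theorem ActsOn.sum {ι : Type*} {T : Finset ι} {M : ι → Op Λ} (h : ∀ i ∈ T, ActsOn S (M i)) :
    ActsOn S (∑ i ∈ T, M i) := (localOps S).sum_mem h

theorem ActsOn.mul {M M' : Op Λ} (h : ActsOn S M) (h' : ActsOn S M') : ActsOn S (M * M') :=
  (localOps S).mul_mem h h'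

theorem ActsOn.smul {M : Op Λ} (h : ActsOn S M) (c : ℂ) : ActsOn S (c • M) :=
  (localOps S).smul_mem h c

theorem ActsOn.sub {M M' : Op Λ} (h : ActsOn S M) (h' : ActsOn S M') : ActsOn S (M - M') :=
  (localOps S).sub_mem h h'

theorem actsOn_integral {α : Type*} [MeasurableSpace α] {μ : Measure α} {M : α → Op Λ}
    (h : ∀ a, ActsOn S (M a)) : ActsOn S (∫ a, M a ∂μ) :=
  integral_mem_submodule (E := Op Λ) (Subalgebra.toSubmodule (localOps S)) h

variable {H A : Op Λ}

theorem ActsOn.heisenberg (hH : ActsOn S H) (hA : ActsOn S A) (t : ℝ) :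
    ActsOn S (heisenberg H A t) :=
  ((exp_mem_subalgebra (𝔸 := Op Λ) (localOps S) (hH.smul _)).mul hA).mul
    (exp_mem_subalgebra (𝔸 := Op Λ) (localOps S) (hH.smul _))

theorem ActsOn.opFourier (hH : ActsOn S H) (hA : ActsOn S A) (σ ω : ℝ) :
    ActsOn S (opFourier H σ A ω) :=
  ActsOn.smul (actsOn_integral fun t => (hH.heisenberg hA t).smul _) _

theorem ActsOn.decayOp (hH : ActsOn S H) (hA : ActsOn S A) (β σ : ℝ) :
    ActsOn S (decayOp H β σ A) :=
  actsOn_integral fun ω => ((hH.opFourier hA σ ω).conjTranspose.mul (hH.opFourier hA σ ω)).smul _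

/-- The spectral projectors of `H` are not local, but the coherent term is: by `effOp_eq_integral`
it is an integral of products of local evolutions. -/
theorem ActsOn.coherentTerm (hH' : H.IsHermitian) (hH : ActsOn S H) (hA : ActsOn S A) {β : ℝ}
    (hβ : 0 < β) : ActsOn S (coherentTerm hH' β (1 / β) A) := by
  have hh : ∀ s, ActsOn S (heis hH'.eigenvectorUnitary (fun i => β * hH'.eigenvalues i) s A) :=
    fun s => by
      rw [← heisenberg_eq_heis hH']
      exact hH.heisenberg hA _
  have hF : ∀ c ω, ActsOn S
      (freqComp hH'.eigenvectorUnitary (fun i => β * hH'.eigenvalues i) c A ω) := fun c ω =>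
    (actsOn_integral fun s => (hh s).smul _).smul _
  have hG : ∀ t, ActsOn S
      (shiftedDecay hH'.eigenvectorUnitary (fun i => β * hH'.eigenvalues i) A t) := fun t =>
    actsOn_integral fun ω => ActsOn.smul (by
      rw [mul_one]
      exact (hF _ ω).conjTranspose.mul (hF _ ω)) _
  rw [coherentTerm_eq_effOp hH' A hβ, effOp_eq_integral]
  exact ActsOn.smul (ActsOn.sub (actsOn_integral fun t => (hG t).smul _)
    ((hH.decayOp hA β _).smul _)) _

theorem jumpLindbladian_mem (hH' : H.IsHermitian) (hH : ActsOn S H) (hA : ActsOn S A) {β : ℝ}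
    (hβ : 0 < β) : jumpLindbladian hH' β (1 / β) A ∈ localSuperOps S := by
  have hm : ∀ {M : Op Λ}, ActsOn S M → ContinuousLinearMap.mul ℂ (Op Λ) M ∈ localSuperOps S :=
    mul_mem_localSuperOps S
  have hr : ∀ {M : Op Λ}, ActsOn S M →
      (ContinuousLinearMap.mul ℂ (Op Λ)).flip M ∈ localSuperOps S := mul_flip_mem_localSuperOps S
  refine (localSuperOps S).add_mem ?_ ?_
  · have hB := hH.coherentTerm hH' hA hβ
    exact (localSuperOps S).smul_mem ((localSuperOps S).sub_mem (hm hB) (hr hB)) _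
  · refine integral_mem_submodule (E := SuperOp Λ) (μ := (volume : Measure ℝ))
      (Subalgebra.toSubmodule (localSuperOps S)) fun ω => ?_
    have hF := hH.opFourier hA (1 / β) ω
    refine (localSuperOps S).smul_mem ((localSuperOps S).sub_mem ?_ ?_) _
    · have : ContinuousLinearMap.mulLeftRight ℂ (Op Λ) (opFourier H (1 / β) A ω)
          (opFourier H (1 / β) A ω)ᴴ = (ContinuousLinearMap.mul ℂ (Op Λ)).flip
            (opFourier H (1 / β) A ω)ᴴ * ContinuousLinearMap.mul ℂ (Op Λ)
              (opFourier H (1 / β) A ω) := by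
        ext1 O; rfl
      rw [this]
      exact (localSuperOps S).mul_mem (hr hF.conjTranspose) (hm hF)
    · have hN := hF.conjTranspose.mul hF
      exact (localSuperOps S).smul_mem ((localSuperOps S).add_mem (hm hN) (hr hN)) _

theorem superActsOn_timeAverage (hH' : H.IsHermitian) (hH : ActsOn S H) {A : Finset Λ}
    (hA : A ⊆ S) {β : ℝ} (hβ : 0 < β) (t : ℝ) : SuperActsOn S (timeAverage hH' β A t) := by
  refine avgExp_mem (𝔸 := SuperOp Λ) (localSuperOps S) ?_ t
  exact (localSuperOps S).sum_mem fun i hi => (localSuperOps S).sum_mem fun a _ =>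
    jumpLindbladian_mem hH' hH ((actsOn_siteOp i _).mono (Finset.singleton_subset_iff.2 (hA hi))) hβ

namespace LocalHamiltonian

variable {Γ : Type} [Fintype Γ] (I : LocalHamiltonian Λ Γ) (A : Finset Λ) (ℓ : ℕ)

theorem subset_neighborhood : A ⊆ I.neighborhood A ℓ := fun i hi => by
  classical
  refine Finset.mem_filter.2 ⟨Finset.mem_univ _, ?_⟩
  have h : I.Joined 0 {i} A := ⟨i, Finset.mem_inter.2 ⟨Finset.mem_singleton_self i, hi⟩⟩
  exact (iInf₂_le 0 h).trans (by simp)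

/-- A term within distance less than `ℓ - 1` of `A` acts on sites within distance less than `ℓ`. -/
theorem supp_subset_neighborhood {γ : Γ} (h : I.dist (I.supp γ) A + 1 < (ℓ : ℕ∞)) :
    I.supp γ ⊆ I.neighborhood A ℓ := fun i hi => by
  classical
  refine Finset.mem_filter.2 ⟨Finset.mem_univ _, le_trans ?_ h.le⟩
  rw [dist, dist, ENat.iInf_add]
  refine le_iInf fun k => ?_
  rw [ENat.iInf_add]
  refine le_iInf fun hk => ?_
  have h1 : I.Joined (k + 1) {i} A :=
    ⟨γ, ⟨i, Finset.mem_inter.2 ⟨Finset.mem_singleton_self i, hi⟩⟩, hk⟩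
  exact (iInf₂_le (k + 1) h1).trans (by simp)

theorem actsOn_patch : ActsOn (I.neighborhood A ℓ) (I.patch A ℓ) := by
  classical
  exact ActsOn.sum fun γ hγ =>
    (I.actsOn γ).mono (I.supp_subset_neighborhood A ℓ (Finset.mem_filter.1 hγ).2)

theorem superActsOn_localRecovery {β : ℝ} (hβ : 0 < β) (t : ℝ) :
    SuperActsOn (I.neighborhood A ℓ) (I.localRecovery β A t ℓ) :=
  superActsOn_timeAverage _ (I.actsOn_patch A ℓ) (I.subset_neighborhood A ℓ) hβ t

/-! ### Quasi-locality of the recovery map -/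

variable {d : ℕ} {A} {β : ℝ}

theorem norm_heis_patch_sub_le (hd : I.DegreeLE d) (hd1 : 1 ≤ d) (hβ : 0 < β) {i : Λ} (hi : i ∈ A)
    (a : Fin 3) (s : ℝ) :
    ‖heis I.ham_isHermitian.eigenvectorUnitary (fun j => β * I.ham_isHermitian.eigenvalues j) s
        (siteOp i (pauli a)) -
      heis (I.patch_isHermitian A ℓ).eigenvectorUnitary
        (fun j => β * (I.patch_isHermitian A ℓ).eigenvalues j) s (siteOp i (pauli a))‖ ≤
      4 * (Real.exp (-(1 / (8 * Real.exp 1) * (ℓ / (d * β)))) + 1 / 2 ^ ℓ) * Real.exp |s| := by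
  have hO := norm_siteOp_pauli_le i a
  have hd0 : (0 : ℝ) < d := by exact_mod_cast hd1
  refine lieb_robinson_scalar (by positivity) ?_ fun k hk => ?_
  · refine (norm_sub_le _ _).trans ?_
    rw [norm_heis, norm_heis]
    linarith
  · have h := I.norm_evolve_patch_sub_le hd hi (actsOn_siteOp i (pauli a)) hO hk (β * s)
    have he : ∀ H : Op Λ, evolve H (β * s) (siteOp i (pauli a)) =
        heisenberg H (siteOp i (pauli a)) (β * s) := fun H => by
      unfold evolve heisenberg
      congr 2
      · congr 1
        rw [smul_smul, mul_comm]
      · rw [smul_neg, ← neg_smul, smul_smul, mul_comm, mul_neg]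
    rw [he, he, heisenberg_eq_heis I.ham_isHermitian,
      heisenberg_eq_heis (I.patch_isHermitian A ℓ)] at h
    refine h.trans (le_of_eq ?_)
    rw [abs_mul, abs_of_pos hβ]
    ring

/-- The localization error of the recovery map, in the Heisenberg picture: each of the `3|A|` jumps
contributes its Lieb–Robinson error, and Duhamel's formula a factor `t`. -/
theorem norm_superDual_localRecovery_sub_le (hd : I.DegreeLE d) (hd1 : 1 ≤ d) (hβ : 0 < β) {t : ℝ}
    (ht : 0 < t) : ‖superDual (I.localRecovery β A t ℓ - I.recovery β A t)‖ ≤ 12 * jumpConst *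
      (A.card * t * (Real.exp (-(1 / (8 * Real.exp 1) * (ℓ / (d * β)))) + 1 / 2 ^ ℓ)) := by
  rw [map_sub, localRecovery, recovery, superDual_timeAverage _ β A hβ,
    superDual_timeAverage _ β A hβ, norm_sub_rev]
  refine (norm_avgExp_sub_le norm_one_superOp_le (dissipative_regionDual _ β A)
    (dissipative_regionDual _ β A) ht).trans ?_
  rw [regionDual, regionDual, ← Finset.sum_sub_distrib]
  have h : ‖∑ i ∈ A, ((∑ a : Fin 3, jumpDual I.ham_isHermitian.eigenvectorUnitary
        (fun j => β * I.ham_isHermitian.eigenvalues j) (siteOp i (pauli a))) -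
      ∑ a : Fin 3, jumpDual (I.patch_isHermitian A ℓ).eigenvectorUnitary
        (fun j => β * (I.patch_isHermitian A ℓ).eigenvalues j) (siteOp i (pauli a)))‖ ≤
      A.card • (3 • (jumpConst *
        (4 * (Real.exp (-(1 / (8 * Real.exp 1) * (ℓ / (d * β)))) + 1 / 2 ^ ℓ)))) := by
    refine (norm_sum_le _ _).trans (Finset.sum_le_card_nsmul _ _ _ fun i hi => ?_)
    rw [← Finset.sum_sub_distrib]
    refine (norm_sum_le _ _).trans ((Finset.sum_le_card_nsmul _ _ _ fun a _ => ?_).trans_eq (by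
      rw [Finset.card_univ, Fintype.card_fin]))
    exact norm_jumpDual_sub_le _ _ _ _ (norm_siteOp_pauli_le i a)
      fun s => I.norm_heis_patch_sub_le ℓ hd hd1 hβ hi a s
  refine (mul_le_mul_of_nonneg_left h ht.le).trans (le_of_eq ?_)
  simp only [nsmul_eq_mul]
  push_cast
  ring

end LocalHamiltonian

end StrictLocality

/-! ### Imaginary-time evolution of local operators -/

section ImaginaryTime

open Filter Topology

section Bohr

variable {n : Type*} [Fintype n] [DecidableEq n] (U : Matrix.unitaryGroup n ℂ) (e : n → ℝ)

theorem tendsto_bohr {ι : Type*} {l : Filter ι} {φ : ι → ℝ → ℂ} {ψ : ℝ → ℂ}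
    (h : ∀ ν, Tendsto (fun a => φ a ν) l (𝓝 (ψ ν))) (O : Matrix n n ℂ) :
    Tendsto (fun a => bohr U e (φ a) O) l (𝓝 (bohr U e ψ O)) := by
  have h1 : Tendsto (fun a => Matrix.of fun i j => φ a (e i - e j) * rot U O i j) l
      (𝓝 (Matrix.of fun i j => ψ (e i - e j) * rot U O i j)) :=
    tendsto_pi_nhds.2 fun i => tendsto_pi_nhds.2 fun j => (h _).mul_const _
  exact (h1.const_mul (U : Matrix n n ℂ)).mul_const (star (U : Matrix n n ℂ))

theorem continuous_bohr {φ : ℝ → ℝ → ℂ} (h : ∀ ν, Continuous fun t => φ t ν) (O : Matrix n n ℂ) :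
    Continuous fun t => bohr U e (φ t) O :=
  continuous_iff_continuousAt.2 fun _ => tendsto_bohr U e (fun ν => (h ν).continuousAt) O

theorem bohr_sum_fun {ι : Type*} (T : Finset ι) (φ : ι → ℝ → ℂ) (O : Matrix n n ℂ) :
    bohr U e (fun ν => ∑ k ∈ T, φ k ν) O = ∑ k ∈ T, bohr U e (φ k) O := by
  classical
  induction T using Finset.induction_on with
  | empty => simpa using bohr_const_mul U e 0 (fun _ => 0) O
  | insert k T hk ih => simp only [Finset.sum_insert hk, bohr_add_fun, ih]

/-- The commutator `O ↦ [H, O]`. -/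
def adj (H : Matrix n n ℂ) : Module.End ℂ (Matrix n n ℂ) :=
  LinearMap.mulLeft ℂ H - LinearMap.mulRight ℂ H

theorem adj_apply (H O : Matrix n n ℂ) : adj H O = H * O - O * H := rfl

/-- Multiplication by the Bohr frequency of `βH` is the commutator with `βH`. -/
theorem bohr_pow {H : Matrix n n ℂ} (hH : H.IsHermitian) (β : ℝ) (k : ℕ) (O : Matrix n n ℂ) :
    bohr hH.eigenvectorUnitary (fun i => β * hH.eigenvalues i) (fun ν => (ν : ℂ) ^ k) O =
      (β : ℂ) ^ k • (adj H ^ k) O := by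
  have hr : rot hH.eigenvectorUnitary H = Matrix.diagonal fun i => (hH.eigenvalues i : ℂ) := by
    have h := hH.conjStarAlgAut_star_eigenvectorUnitary
    rw [Unitary.conjStarAlgAut_star_apply] at h
    exact h
  have h1 : ∀ O, bohr hH.eigenvectorUnitary (fun i => β * hH.eigenvalues i) (fun ν => (ν : ℂ)) O =
      (β : ℂ) • adj H O := fun O => eq_of_rot hH.eigenvectorUnitary fun i j => by
    rw [rot_bohr, adj_apply, rot_smul, rot_sub, rot_mul, rot_mul, hr, Matrix.smul_apply,
      Matrix.sub_apply, Matrix.diagonal_mul, Matrix.mul_diagonal, smul_eq_mul]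
    push_cast; ring
  induction k generalizing O with
  | zero => simpa using bohr_one _ _ O
  | succ k ih =>
    have h2 := bohr_bohr hH.eigenvectorUnitary (fun i => β * hH.eigenvalues i)
      (fun ν => (ν : ℂ) ^ k) (fun ν => (ν : ℂ)) O
    simp only [← pow_succ] at h2
    rw [← h2, h1, map_smul, ih, smul_smul, pow_succ, pow_succ, mul_comm (β : ℂ)]
    rfl

end Bohr

namespace LocalHamiltonian

variable {Λ Γ : Type} [Fintype Λ] [DecidableEq Λ] [Fintype Γ] (I : LocalHamiltonian Λ Γ)

theorem adj_ham {S : Finset Λ} {O : Op Λ} (hO : ActsOn S O) :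
    adj I.ham O = ∑ γ ∈ I.touching Finset.univ S, (I.term γ * O - O * I.term γ) := by
  have h := I.sum_sub_touching_comm hO Finset.univ
  rw [sub_mul, mul_sub] at h
  rw [adj_apply, Finset.sum_sub_distrib, ← Finset.sum_mul, ← Finset.mul_sum]
  exact sub_eq_sub_iff_sub_eq_sub.1 h

/-- Nested commutators of a local operator with the Hamiltonian grow at most factorially, since each
commutator enlarges the support by a single term. -/
theorem norm_adj_pow_le {d : ℕ} (hd : I.DegreeLE d) (k : ℕ) : ∀ (m : ℕ) (S : Finset Λ) (O : Op Λ),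
    ActsOn S O → (I.touching Finset.univ S).card ≤ m * d →
      ‖(adj I.ham ^ k) O‖ ≤ (2 * d) ^ k * m.ascFactorial k * ‖O‖ := by
  induction k with
  | zero => intro m S O _ _; simp
  | succ k ih =>
    intro m S O hO hc
    rw [pow_succ, Module.End.mul_apply, I.adj_ham hO, map_sum]
    have h1 : ∀ γ ∈ I.touching Finset.univ S,
        ‖(adj I.ham ^ k) (I.term γ * O - O * I.term γ)‖ ≤
          (2 * d) ^ k * (m + 1).ascFactorial k * (2 * ‖O‖) := fun γ _ => by
      have ha : ActsOn (S ∪ I.supp γ) (I.term γ * O - O * I.term γ) := by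
        have h1 := (I.actsOn γ).mono (Finset.subset_union_right (s₁ := S))
        have h2 := hO.mono (Finset.subset_union_left (s₂ := I.supp γ))
        exact (h1.mul h2).sub (h2.mul h1)
      classical
      have hcard : (I.touching Finset.univ (S ∪ I.supp γ)).card ≤ (m + 1) * d := by
        have : I.touching Finset.univ (S ∪ I.supp γ) =
            I.touching Finset.univ S ∪ I.touching Finset.univ (I.supp γ) := by
          ext γ'
          simp only [touching, Finset.mem_filter, Finset.mem_union, Finset.mem_univ, true_and,
            Finset.union_inter_distrib_right, Finset.union_nonempty]
        rw [this, add_mul, one_mul]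
        exact (Finset.card_union_le _ _).trans (add_le_add hc (hd γ))
      refine (ih (m + 1) _ _ ha hcard).trans ?_
      gcongr
      have h2 := norm_mul_le (I.term γ) O
      have h3 := norm_mul_le O (I.term γ)
      have h4 := I.norm_le_one γ
      refine (norm_sub_le _ _).trans ?_
      nlinarith [norm_nonneg O]
    refine (norm_sum_le _ _).trans ((Finset.sum_le_card_nsmul _ _ _ h1).trans ?_)
    have hc' : ((I.touching Finset.univ S).card : ℝ) ≤ m * d := by exact_mod_cast hc
    have hm : (m : ℝ) * ((m + 1).ascFactorial k : ℕ) = (m.ascFactorial (k + 1) : ℕ) := by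
      rw [Nat.ascFactorial_succ]
      exact_mod_cast Nat.succ_ascFactorial m k
    rw [nsmul_eq_mul, ← hm]
    calc _ ≤ (m * d : ℝ) * ((2 * d) ^ k * (m + 1).ascFactorial k * (2 * ‖O‖)) := by gcongr
      _ = _ := by ring

/-- Evolution of a single-site operator to the imaginary time `z` at most doubles its norm when
`4dβ|z| ≤ 1`: the `k`-th term of the series of nested commutators is at most `(2dβ|z|)ᵏ ≤ 2⁻ᵏ`. -/
theorem norm_bohr_exp_le {d : ℕ} (hd : I.DegreeLE d) {β z : ℝ} (hβ : 0 < β)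
    (hz : 2 * d * β * |z| ≤ 1 / 2) {i : Λ} {O : Op Λ} (hO : ActsOn {i} O) :
    ‖bohr I.ham_isHermitian.eigenvectorUnitary (fun j => β * I.ham_isHermitian.eigenvalues j)
      (fun ν => Complex.exp (z * ν)) O‖ ≤ 2 * ‖O‖ := by
  set U := I.ham_isHermitian.eigenvectorUnitary
  set e := fun j => β * I.ham_isHermitian.eigenvalues j
  have h1 : Tendsto (fun N : ℕ => bohr U e (fun ν =>
      ∑ k ∈ Finset.range N, ((z : ℂ) ^ k / k.factorial) * (ν : ℂ) ^ k) O) atTop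
      (𝓝 (bohr U e (fun ν => Complex.exp (z * ν)) O)) := by
    refine tendsto_bohr U e (fun ν => ?_) O
    have h := (NormedSpace.expSeries_div_hasSum_exp ((z : ℂ) * ν)).tendsto_sum_nat
    rw [← Complex.exp_eq_exp_ℂ] at h
    refine h.congr fun N => Finset.sum_congr rfl fun k _ => ?_
    rw [mul_pow]; ring
  refine le_of_tendsto h1.norm (Eventually.of_forall fun N => ?_)
  rw [bohr_sum_fun]
  have h2 : ∀ k ∈ Finset.range N, ‖bohr U e (fun ν => ((z : ℂ) ^ k / k.factorial) * (ν : ℂ) ^ k) O‖ ≤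
      (1 / 2) ^ k * ‖O‖ := fun k _ => by
    rw [bohr_const_mul, bohr_pow, smul_smul, norm_smul]
    have h3 := I.norm_adj_pow_le hd k 1 {i} O hO (by
      rw [one_mul]; exact I.card_touching_singleton_le hd i)
    rw [Nat.one_ascFactorial] at h3
    have h4 : ‖(z : ℂ) ^ k / k.factorial * (β : ℂ) ^ k‖ = |z| ^ k / k.factorial * β ^ k := by
      rw [norm_mul, norm_div, norm_pow, norm_pow, Complex.norm_real, Complex.norm_real,
        Complex.norm_natCast, Real.norm_eq_abs, Real.norm_of_nonneg hβ.le]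
    rw [h4]
    have hk : (k.factorial : ℝ) ≠ 0 := by positivity
    calc |z| ^ k / k.factorial * β ^ k * ‖(adj I.ham ^ k) O‖
        ≤ |z| ^ k / k.factorial * β ^ k * ((2 * d) ^ k * k.factorial * ‖O‖) := by gcongr
      _ = (2 * d * β * |z|) ^ k * ‖O‖ := by
        rw [mul_pow _ |z|, mul_pow _ β]; field_simp
      _ ≤ (1 / 2) ^ k * ‖O‖ := by gcongr
  refine (norm_sum_le _ _).trans ((Finset.sum_le_sum h2).trans ?_)
  rw [← Finset.sum_mul]
  gcongr
  have h5 := (summable_geometric_of_lt_one (r := (1 / 2 : ℝ)) (by norm_num) (by norm_num)).sum_le_tsum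
    (Finset.range N) (fun _ _ => by positivity)
  rwa [tsum_geometric_two] at h5

end LocalHamiltonian

section Tame

variable {n : Type*} [Fintype n] [DecidableEq n] (U : Matrix.unitaryGroup n ℂ) (e : n → ℝ)

/-- A contraction whose evolutions to the imaginary times `± iη` have norm at most `m`. -/
structure Tame (η m : ℝ) (P : Matrix n n ℂ) : Prop where
  norm_le : ‖P‖ ≤ 1
  pos : ‖bohr U e (fun ν => Complex.exp ((η : ℂ) * ν)) P‖ ≤ m
  neg : ‖bohr U e (fun ν => Complex.exp (((-η : ℝ) : ℂ) * ν)) P‖ ≤ m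

variable {U e} {η m m' : ℝ} {P P' : Matrix n n ℂ}

theorem Tame.mono (h : Tame U e η m P) (hm : m ≤ m') : Tame U e η m' P :=
  ⟨h.norm_le, h.pos.trans hm, h.neg.trans hm⟩

theorem Tame.mul (h : Tame U e η m P) (h' : Tame U e η m' P') : Tame U e η (m * m') (P * P') := by
  refine ⟨(norm_mul_le _ _).trans (mul_le_one₀ h.norm_le (norm_nonneg _) h'.norm_le), ?_, ?_⟩
  · rw [bohr_exp_mul]
    exact (norm_mul_le _ _).trans (mul_le_mul h.pos h'.pos (norm_nonneg _)
      ((norm_nonneg _).trans h.pos))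
  · rw [bohr_exp_mul]
    exact (norm_mul_le _ _).trans (mul_le_mul h.neg h'.neg (norm_nonneg _)
      ((norm_nonneg _).trans h.neg))

theorem tame_one : Tame U e η 1 (1 : Matrix n n ℂ) :=
  ⟨norm_one_le, by rw [bohr_exp_one]; exact norm_one_le, by rw [bohr_exp_one]; exact norm_one_le⟩

end Tame

end ImaginaryTime

/-! ### The Dirichlet form of the generator -/

section Dirichlet

open MeasureTheory

variable {n : Type*} [Fintype n] [DecidableEq n] (U : Matrix.unitaryGroup n ℂ) (e : n → ℝ)

theorem trace_mul_integral {α : Type*} [MeasurableSpace α] {μ : Measure α} {f : α → Matrix n n ℂ}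
    (h : Integrable f μ) (L R : Matrix n n ℂ) :
    (L * (∫ a, f a ∂μ) * R).trace = ∫ a, (L * f a * R).trace ∂μ := by
  rw [integral_mul_left_right h, trace_integral ((h.const_mul L).mul_const R)]

theorem integrable_trace_mul {α : Type*} [MeasurableSpace α] {μ : Measure α}
    {f : α → Matrix n n ℂ} (h : Integrable f μ) (L R : Matrix n n ℂ) :
    Integrable (fun a => (L * f a * R).trace) μ :=
  traceCLM.integrable_comp ((h.const_mul L).mul_const R)

/-- `e^{-K/4} F e^{K/4}`. -/
def low (F : Matrix n n ℂ) : Matrix n n ℂ := bohr U e (fun ν => Complex.exp (-(1 / 4) * ν)) F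

/-- `e^{K/4} F e^{-K/4}`. -/
def high (F : Matrix n n ℂ) : Matrix n n ℂ := bohr U e (fun ν => Complex.exp (1 / 4 * ν)) F

/-- The component of `F` of Bohr frequency `ν` divided by `2 cosh(ν/4)`. -/
def sechMean (F : Matrix n n ℂ) : Matrix n n ℂ :=
  bohr U e (fun ν => (2 * Complex.cosh (ν / 4))⁻¹) F

/-- With `x = e^{-K/4} X e^{-K/4}`, the operator `e^{-K/4} [F, X] e^{-K/4}`. -/
def twist (F x : Matrix n n ℂ) : Matrix n n ℂ := low U e F * x - x * high U e F

theorem conjTranspose_low (F : Matrix n n ℂ) : (low U e F)ᴴ = high U e Fᴴ := by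
  rw [low, conjTranspose_bohr, high]
  congr 2
  funext ν
  rw [RCLike.star_def, ← Complex.exp_conj]
  congr 1
  simp [map_ofNat]

theorem conjTranspose_high (F : Matrix n n ℂ) : (high U e F)ᴴ = low U e Fᴴ := by
  have h := conjTranspose_low U e Fᴴ
  rw [Matrix.conjTranspose_conjTranspose] at h
  rw [← h, Matrix.conjTranspose_conjTranspose]

theorem low_eq (F : Matrix n n ℂ) :
    low U e F = gexp U e (-(1 / 4)) * F * gexp U e (1 / 4) := by
  rw [low, bohr_exp, neg_neg]

theorem high_eq (F : Matrix n n ℂ) :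
    high U e F = gexp U e (1 / 4) * F * gexp U e (-(1 / 4)) := bohr_exp U e _ F

theorem low_heis (t : ℝ) (F : Matrix n n ℂ) : low U e (heis U e t F) = heis U e t (low U e F) := by
  rw [low, heis, heis, low, bohr_bohr, bohr_bohr]
  simp only [mul_comm]

theorem high_heis (t : ℝ) (F : Matrix n n ℂ) :
    high U e (heis U e t F) = heis U e t (high U e F) := by
  rw [high, heis, heis, high, bohr_bohr, bohr_bohr]
  simp only [mul_comm]

theorem gexp_mul_gexp_neg (z : ℂ) : gexp U e z * gexp U e (-z) = 1 := by
  rw [gexp_mul, add_neg_cancel, gexp_zero]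

theorem gexp_neg_mul_gexp (z : ℂ) : gexp U e (-z) * gexp U e z = 1 := by
  rw [gexp_mul, neg_add_cancel, gexp_zero]

theorem twist_sandwich (F X : Matrix n n ℂ) :
    twist U e F (gexp U e (-(1 / 4)) * X * gexp U e (-(1 / 4))) =
      gexp U e (-(1 / 4)) * (F * X - X * F) * gexp U e (-(1 / 4)) := by
  rw [twist, low_eq, high_eq]
  have h1 := gexp_mul_gexp_neg U e (1 / 4)
  have h2 := gexp_neg_mul_gexp U e (1 / 4)
  set q := gexp U e (-(1 / 4))
  set p := gexp U e (1 / 4)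
  have e1 : q * F * p * (q * X * q) = q * (F * X) * q := by
    rw [show q * F * p * (q * X * q) = q * F * (p * q) * X * q by noncomm_ring, h1]
    noncomm_ring
  have e2 : q * X * q * (p * F * q) = q * (X * F) * q := by
    rw [show q * X * q * (p * F * q) = q * X * (q * p) * F * q by noncomm_ring, h2]
    noncomm_ring
  rw [e1, e2]
  noncomm_ring

/-- Averaging the evolutions over the time kernel divides by `2 cosh (ν/4)`. -/
theorem integral_sech_heis (M : Matrix n n ℂ) :
    ∫ t, (sechKernel t : ℂ) • heis U e t M = sechMean U e M := by
  refine (bohr_fourier U e (κ := fun t => (sechKernel t : ℂ)) integrable_sechKernel.ofReal M).symm.trans ?_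
  rw [sechMean]
  exact congrArg (fun φ => bohr U e φ M) (funext fun ν => integral_sechKernel_mul_exp ν)

theorem rot_sandwich_apply (F x F' : Matrix n n ℂ) (φ ψ : ℝ → ℂ) (k l : n) :
    rot U ((bohr U e φ F)ᴴ * x * bohr U e ψ F') k l =
      ∑ j, ∑ i, star (φ (e i - e k)) * ψ (e j - e l) *
        (star (rot U F i k) * rot U x i j * rot U F' j l) := by
  rw [rot_mul, rot_mul, rot_conjTranspose, Matrix.mul_apply]
  refine Finset.sum_congr rfl fun j _ => ?_
  rw [Matrix.mul_apply, Finset.sum_mul]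
  refine Finset.sum_congr rfl fun i _ => ?_
  rw [Matrix.conjTranspose_apply, rot_bohr, rot_bohr, star_mul']
  ring

/-- The two cross terms of the Dirichlet form, averaged over the time kernel, add up to `F† x F`. -/
theorem integral_sech_cross (F x : Matrix n n ℂ) :
    Integrable (fun t : ℝ => (sechKernel t : ℂ) •
      ((low U e (heis U e t F))ᴴ * x * high U e (heis U e t F) +
        (high U e (heis U e t F))ᴴ * x * low U e (heis U e t F))) ∧
    ∫ t : ℝ, (sechKernel t : ℂ) •
      ((low U e (heis U e t F))ᴴ * x * high U e (heis U e t F) +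
        (high U e (heis U e t F))ᴴ * x * low U e (heis U e t F)) = Fᴴ * x * F := by
  set G : ℝ → Matrix n n ℂ := fun t => (sechKernel t : ℂ) •
      ((low U e (heis U e t F))ᴴ * x * high U e (heis U e t F) +
        (high U e (heis U e t F))ᴴ * x * low U e (heis U e t F)) with hG
  have h1 : ∀ t k l, rot U (G t) k l = ∑ j, ∑ i, (sechKernel t : ℂ) *
      Complex.exp (Complex.I * t * (((e j - e l) - (e i - e k) : ℝ) : ℂ)) *
      ((2 * Complex.cosh ((((e j - e l) - (e i - e k) : ℝ) : ℂ) / 4)) *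
        (star (rot U F i k) * rot U x i j * rot U F j l)) := fun t k l => by
    simp only [hG, low, high, heis, bohr_bohr]
    rw [rot_smul, rot_add, Matrix.smul_apply, Matrix.add_apply, rot_sandwich_apply,
      rot_sandwich_apply, ← Finset.sum_add_distrib, smul_eq_mul, Finset.mul_sum]
    refine Finset.sum_congr rfl fun j _ => ?_
    rw [← Finset.sum_add_distrib, Finset.mul_sum]
    refine Finset.sum_congr rfl fun i _ => ?_
    have hc : ∀ a b : ℝ, star (Complex.exp (-(1 / 4) * a) * Complex.exp (Complex.I * t * a)) *
        (Complex.exp (1 / 4 * b) * Complex.exp (Complex.I * t * b)) +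
        star (Complex.exp (1 / 4 * a) * Complex.exp (Complex.I * t * a)) *
        (Complex.exp (-(1 / 4) * b) * Complex.exp (Complex.I * t * b)) =
        Complex.exp (Complex.I * t * ((b - a : ℝ) : ℂ)) *
          (2 * Complex.cosh (((b - a : ℝ) : ℂ) / 4)) := fun a b => by
      rw [Complex.cosh]
      simp only [RCLike.star_def, ← Complex.exp_conj, ← Complex.exp_add]
      rw [mul_div_cancel₀ _ (two_ne_zero' ℂ), mul_add, ← Complex.exp_add, ← Complex.exp_add]
      congr 1
      · congr 1
        simp [map_ofNat]
        ring
      · congr 1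
        simp [map_ofNat]
        ring
    rw [← add_mul, hc]
    ring
  have hi : ∀ (ν : ℝ) (c : ℂ), Integrable fun t : ℝ =>
      (sechKernel t : ℂ) * Complex.exp (Complex.I * t * ν) * c := fun ν c =>
    (integrable_mul_phase (κ := fun t => (sechKernel t : ℂ)) integrable_sechKernel.ofReal
      ν).mul_const c
  have h2 : Integrable G := integrable_of_rot U fun k l => by
    simp only [h1]
    exact integrable_finsetSum _ fun j _ => integrable_finsetSum _ fun i _ => hi _ _
  refine ⟨h2, eq_of_rot U fun k l => ?_⟩
  rw [rot_integral_apply U h2]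
  simp only [h1]
  have h3 := rot_sandwich_apply U e F x F (fun _ => 1) (fun _ => 1) k l
  rw [bohr_one] at h3
  rw [h3]
  refine (integral_finsetSum _ fun j _ => integrable_finsetSum _ fun i _ => hi _ _).trans
    (Finset.sum_congr rfl fun j _ => ?_)
  refine (integral_finsetSum _ fun i _ => hi _ _).trans (Finset.sum_congr rfl fun i _ => ?_)
  rw [integral_mul_const, integral_sechKernel_mul_exp, ← mul_assoc,
    inv_mul_cancel₀ (two_cosh_ne_zero _), star_one, one_mul, one_mul, one_mul]

theorem continuous_heis (O : Matrix n n ℂ) : Continuous fun t : ℝ => heis U e t O :=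
  continuous_bohr U e (fun ν => by fun_prop) O

omit [DecidableEq n] in
theorem hs_sub_le (A B : Matrix n n ℂ) : hs (A - B) ≤ hs A + hs B := by
  have h : ∀ C : Matrix n n ℂ,
      hs C = ‖(WithLp.toLp 2 fun p : n × n => C p.1 p.2 : EuclideanSpace ℂ (n × n))‖ := fun C => by
    rw [EuclideanSpace.norm_eq, hs, Fintype.sum_prod_type]
  rw [h, h, h]
  exact norm_sub_le (WithLp.toLp 2 fun p : n × n => A p.1 p.2 : EuclideanSpace ℂ (n × n))
    (WithLp.toLp 2 fun p : n × n => B p.1 p.2)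

theorem hs_twist_heis_le (F x : Matrix n n ℂ) (t : ℝ) :
    hs (twist U e (heis U e t F) x) ≤ (‖low U e F‖ + ‖high U e F‖) * hs x := by
  rw [twist, low_heis, high_heis]
  refine (hs_sub_le _ _).trans ((add_le_add (hs_mul_le _ _) (hs_mul_le' _ _)).trans (le_of_eq ?_))
  rw [norm_heis, norm_heis]
  ring

theorem continuous_twist_heis (F x : Matrix n n ℂ) :
    Continuous fun t : ℝ => twist U e (heis U e t F) x := by
  simp only [twist, low_heis, high_heis]
  exact ((continuous_heis U e _).mul continuous_const).sub
    (continuous_const.mul (continuous_heis U e _))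

theorem integrable_sech_twist (F y x : Matrix n n ℂ) : Integrable fun t : ℝ =>
    (sechKernel t : ℂ) * ((twist U e (heis U e t F) y)ᴴ * twist U e (heis U e t F) x).trace := by
  have hc : Continuous fun t : ℝ =>
      ((twist U e (heis U e t F) y)ᴴ * twist U e (heis U e t F) x).trace :=
    ((continuous_twist_heis U e F y).matrix_conjTranspose.mul
      (continuous_twist_heis U e F x)).matrix_trace
  have hκ : Integrable fun t : ℝ => (sechKernel t : ℂ) := integrable_sechKernel.ofReal
  refine hκ.mul_bdd (c := ((‖low U e F‖ + ‖high U e F‖) * hs y) *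
    ((‖low U e F‖ + ‖high U e F‖) * hs x)) hc.aestronglyMeasurable
    (Filter.Eventually.of_forall fun t => ?_)
  refine (norm_trace_mul_le _ _).trans ?_
  rw [hs_conjTranspose]
  exact mul_le_mul (hs_twist_heis_le U e F y t) (hs_twist_heis_le U e F x t) (hs_nonneg _)
    (mul_nonneg (by positivity) (hs_nonneg _))

/-- The time-averaged sesquilinear form `∫ p(t) tr (e^{-K/4}[F(t), Y]e^{-K/4})† (…) dt`. -/
def twistForm (F y x : Matrix n n ℂ) : ℂ :=
  ∫ t : ℝ, (sechKernel t : ℂ) *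
    ((twist U e (heis U e t F) y)ᴴ * twist U e (heis U e t F) x).trace

omit [DecidableEq n] in
theorem trace_twist_add {a b x y : Matrix n n ℂ} :
    ((a * y - y * b)ᴴ * (a * x - x * b)).trace + ((bᴴ * y - y * aᴴ)ᴴ * (bᴴ * x - x * aᴴ)).trace =
      (yᴴ * (aᴴ * a + b * bᴴ) * x).trace + (yᴴ * x * (aᴴ * a + b * bᴴ)).trace -
        ((yᴴ * (aᴴ * x * b + bᴴ * x * a)).trace + (yᴴ * (b * x * aᴴ + a * x * bᴴ)).trace) := by
  have c1 : (bᴴ * yᴴ * (a * x)).trace = (yᴴ * (a * x * bᴴ)).trace := by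
    rw [mul_assoc, Matrix.trace_mul_comm]; simp only [mul_assoc]
  have c2 : (bᴴ * yᴴ * (x * b)).trace = (yᴴ * x * (b * bᴴ)).trace := by
    rw [mul_assoc, Matrix.trace_mul_comm]; simp only [mul_assoc]
  have c3 : (a * yᴴ * (bᴴ * x)).trace = (yᴴ * (bᴴ * x * a)).trace := by
    rw [mul_assoc, Matrix.trace_mul_comm]; simp only [mul_assoc]
  have c4 : (a * yᴴ * (x * aᴴ)).trace = (yᴴ * x * (aᴴ * a)).trace := by
    rw [mul_assoc, Matrix.trace_mul_comm]; simp only [mul_assoc]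
  simp only [Matrix.conjTranspose_sub, Matrix.conjTranspose_mul, Matrix.conjTranspose_conjTranspose,
    sub_mul, mul_sub, mul_add, add_mul, Matrix.trace_sub, Matrix.trace_add, c1, c2, c3, c4]
  simp only [mul_assoc]
  ring

/-- The sum of the forms of `F` and `F†` has the structure of a generator: two anticommutator-like
terms minus the two jump terms `F† x F` and `F x F†`. -/
theorem twistForm_add (F y x : Matrix n n ℂ) :
    twistForm U e F y x + twistForm U e Fᴴ y x =
      (yᴴ * sechMean U e ((low U e F)ᴴ * low U e F + high U e F * (high U e F)ᴴ) * x).trace +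
      (yᴴ * x * sechMean U e ((low U e F)ᴴ * low U e F + high U e F * (high U e F)ᴴ)).trace -
      ((yᴴ * (Fᴴ * x * F)).trace + (yᴴ * (F * x * Fᴴ)).trace) := by
  set M := (low U e F)ᴴ * low U e F + high U e F * (high U e F)ᴴ with hM
  obtain ⟨hi1, hv1⟩ := integral_sech_cross U e F x
  obtain ⟨hi2, hv2⟩ := integral_sech_cross U e Fᴴ x
  rw [Matrix.conjTranspose_conjTranspose] at hv2
  have hi3 : Integrable fun t : ℝ => (sechKernel t : ℂ) • heis U e t M :=
    integrable_smul_heis U e (κ := fun t => (sechKernel t : ℂ)) integrable_sechKernel.ofReal M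
  have hMt : ∀ t, heis U e t M = (low U e (heis U e t F))ᴴ * low U e (heis U e t F) +
      high U e (heis U e t F) * (high U e (heis U e t F))ᴴ := fun t => by
    have hadd : ∀ A B : Matrix n n ℂ, heis U e t (A + B) = heis U e t A + heis U e t B :=
      fun A B => map_add _ A B
    rw [hM, hadd, heis_mul, heis_mul, ← heis_conjTranspose, ← heis_conjTranspose, low_heis,
      high_heis]
  rw [twistForm, twistForm, ← integral_add (integrable_sech_twist U e F y x)
    (integrable_sech_twist U e Fᴴ y x), ← integral_sech_heis U e M, ← hv1, ← hv2]
  have t1 := trace_mul_integral hi3 yᴴ x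
  have t2 := trace_mul_integral hi3 (yᴴ * x) 1
  have t3 := trace_mul_integral hi1 yᴴ 1
  have t4 := trace_mul_integral hi2 yᴴ 1
  have j1 := integrable_trace_mul hi3 yᴴ x
  have j2 := integrable_trace_mul hi3 (yᴴ * x) 1
  have j3 := integrable_trace_mul hi1 yᴴ 1
  have j4 := integrable_trace_mul hi2 yᴴ 1
  simp only [mul_one] at t2 t3 t4 j2 j3 j4
  rw [t1, t2, t3, t4]
  refine Eq.trans (integral_congr_ae (Filter.Eventually.of_forall fun t => ?_))
    ((integral_sub (j1.add j2) (j3.add j4)).trans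
      (congrArg₂ _ (integral_add j1 j2) (integral_add j3 j4)))
  simp only [Pi.add_apply]
  have h := trace_twist_add (a := low U e (heis U e t F)) (b := high U e (heis U e t F)) (x := x)
    (y := y)
  have hb : twist U e (heis U e t Fᴴ) = fun z =>
      (high U e (heis U e t F))ᴴ * z - z * (low U e (heis U e t F))ᴴ := by
    funext z
    rw [twist, ← heis_conjTranspose, ← conjTranspose_low, ← conjTranspose_high]
  rw [hb, ← mul_add]
  rw [twist, twist, h, ← heis_conjTranspose, ← conjTranspose_low, ← conjTranspose_high, ← hMt]
  simp only [Matrix.mul_smul, Matrix.smul_mul, Matrix.trace_smul, smul_eq_mul,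
    Matrix.conjTranspose_conjTranspose]
  ring

end Dirichlet

/-! ### The generator in the KMS inner product -/

section Dirichlet

open MeasureTheory

variable {n : Type*} [Fintype n] [DecidableEq n] (U : Matrix.unitaryGroup n ℂ) (e : n → ℝ)

/-- The frequency weight `e^{-|ω|/2}` of the Dirichlet form. -/
def freqWeight (ω : ℝ) : ℝ := Real.exp (-(|ω| / 2))

theorem freqWeight_pos (ω : ℝ) : 0 < freqWeight ω := Real.exp_pos _

theorem freqWeight_neg (ω : ℝ) : freqWeight (-ω) = freqWeight ω := by
  rw [freqWeight, abs_neg, freqWeight]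

/-- Detailed balance of the Metropolis weight: translated by half a unit and multiplied by
`e^{ω/2}`, it becomes the even weight `freqWeight`. -/
theorem metro_shift (ω : ℝ) :
    metro (ω - 1 / 2) * Real.exp (ω / 2 - 1 / 8) = Real.exp (-(1 / 8)) * freqWeight ω := by
  rw [metro, freqWeight, ← Real.exp_add, ← Real.exp_add, sub_add_cancel]
  congr 1
  rcases le_total 0 ω with h | h
  · rw [max_eq_left h, abs_of_nonneg h]; ring
  · rw [max_eq_right h, abs_of_nonpos h]; ring

variable (V : Matrix n n ℂ)

/-- Translating a Gaussian multiplies it by an exponential, which is an evolution to an imaginary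
time. -/
theorem freqComp_shift_low (ω : ℝ) :
    freqComp U e 0 V (ω - 1 / 2) =
      (Real.exp (ω / 4 - 1 / 16) : ℂ) • low U e (freqComp U e 0 V ω) := by
  rw [low, freqComp_eq_bohr, freqComp_eq_bohr, bohr_bohr, ← bohr_const_mul]
  refine congrArg (fun φ => bohr U e φ V) (funext fun ν => ?_)
  simp only [windowAmp, gaussAmp, mul_zero, Complex.exp_zero, one_mul]
  push_cast
  rw [← mul_assoc, ← Complex.exp_add, mul_left_comm, ← Complex.exp_add]
  congr 2
  ring

theorem freqComp_shift_high (ω : ℝ) :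
    high U e (freqComp U e 0 V (ω - 1 / 2)) =
      (Real.exp (ω / 4 - 1 / 16) : ℂ) • freqComp U e 0 V ω := by
  rw [freqComp_shift_low, low, high, map_smul, bohr_bohr]
  congr 1
  conv_rhs => rw [← bohr_one U e (freqComp U e 0 V ω)]
  refine congrArg (fun φ => bohr U e φ _) (funext fun ν => ?_)
  rw [← Complex.exp_add]
  simp

variable {V}

theorem freqComp_neg (hV : V.IsHermitian) (ω : ℝ) :
    freqComp U e 0 V (-ω) = (freqComp U e 0 V ω)ᴴ := by
  rw [freqComp_eq_bohr, freqComp_eq_bohr, conjTranspose_bohr, hV.eq]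
  refine congrArg (fun φ => bohr U e φ _) (funext fun ν => ?_)
  simp only [windowAmp, gaussAmp, mul_zero, Complex.exp_zero, one_mul, RCLike.star_def,
    Complex.conj_ofReal]
  congr 4
  ring

/-- The coherent term is chosen so that the imaginary-time evolution of `G = N/2 - iB` becomes the
self-adjoint operator `sechMean N`. -/
theorem low_effOp : low U e (effOp U e V) = sechMean U e (decay U e V) := by
  rw [low, effOp, bohr_bohr, sechMean]
  refine congrArg (fun φ => bohr U e φ _) (funext fun ν => ?_)
  rw [← mul_div_assoc, ← Complex.exp_add, show -(1 / 4) * (ν : ℂ) + ν / 4 = 0 by ring,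
    Complex.exp_zero, one_div]

theorem high_effOp_conjTranspose : high U e (effOp U e V)ᴴ = sechMean U e (decay U e V) := by
  rw [← conjTranspose_low, low_effOp, sechMean, conjTranspose_bohr, decay_conjTranspose]
  refine congrArg (fun φ => bohr U e φ _) (funext fun ν => ?_)
  rw [RCLike.star_def, map_inv₀, map_mul, ← Complex.cosh_conj]
  simp [neg_div, map_ofNat]

variable (V)

/-- The jump part of the generator, conjugated by `e^{-K/4}`, is an integral of `F(ω)† x F(ω)` with
an even weight. -/
theorem integrable_weight_sandwich (X : Matrix n n ℂ) :
    let x := gexp U e (-(1 / 4)) * X * gexp U e (-(1 / 4))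
    Integrable (fun ω => (freqWeight ω : ℂ) • ((freqComp U e 0 V ω)ᴴ * x * freqComp U e 0 V ω)) ∧
      gexp U e (-(1 / 4)) * (∫ ω, (metro ω : ℂ) • ((freqComp U e 0 V ω)ᴴ * X *
        freqComp U e 0 V ω)) * gexp U e (-(1 / 4)) =
      (Real.exp (-(1 / 8)) : ℂ) •
        ∫ ω, (freqWeight ω : ℂ) • ((freqComp U e 0 V ω)ᴴ * x * freqComp U e 0 V ω) := by
  intro x
  have hi := integrable_sandwich U e V 0 0 X
  set q := gexp U e (-(1 / 4)) with hq
  have hi2 := (hi.const_mul q).mul_const q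
  have hpt : ∀ ω : ℝ, q * ((metro (ω - 1 / 2) : ℂ) • ((freqComp U e 0 V (ω - 1 / 2))ᴴ * X *
        freqComp U e 0 V (ω - 1 / 2))) * q = (Real.exp (-(1 / 8)) : ℂ) •
          ((freqWeight ω : ℂ) • ((freqComp U e 0 V ω)ᴴ * x * freqComp U e 0 V ω)) := fun ω => by
    have h1 := freqComp_shift_high U e V ω
    set F := freqComp U e 0 V (ω - 1 / 2)
    have h2 := gexp_neg_mul_gexp U e (1 / 4)
    have h3 := gexp_mul_gexp_neg U e (1 / 4)
    have h4 : q * (Fᴴ * X * F) * q = (high U e F)ᴴ * x * high U e F := by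
      rw [conjTranspose_high, low_eq, high_eq, ← hq]
      calc _ = q * Fᴴ * 1 * X * 1 * F * q := by noncomm_ring
        _ = q * Fᴴ * (gexp U e (1 / 4) * q) * X * (q * gexp U e (1 / 4)) * F * q := by
          rw [h2, h3]
        _ = _ := by simp only [x]; noncomm_ring
    rw [Matrix.mul_smul, Matrix.smul_mul, h4, h1, Matrix.conjTranspose_smul, RCLike.star_def,
      Complex.conj_ofReal]
    simp only [Matrix.smul_mul, Matrix.mul_smul, smul_smul]
    congr 1
    have := metro_shift ω
    rw [show ω / 2 - 1 / 8 = (ω / 4 - 1 / 16) + (ω / 4 - 1 / 16) by ring, Real.exp_add] at this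
    exact_mod_cast this
  have hsh := hi2.comp_sub_right (1 / 2)
  simp only [hpt] at hsh
  have hne : (Real.exp (-(1 / 8)) : ℂ) ≠ 0 := by exact_mod_cast (Real.exp_pos _).ne'
  have hsm := hsh.smul ((Real.exp (-(1 / 8)) : ℂ)⁻¹)
  refine ⟨hsm.congr (Filter.Eventually.of_forall fun ω => ?_), ?_⟩
  · rw [Pi.smul_apply, smul_smul, inv_mul_cancel₀ hne, one_smul]
  rw [integral_mul_left_right hi, ← integral_sub_right_eq_self _ (1 / 2 : ℝ)]
  simp only [hpt]
  rw [integral_smul]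

/-- The decay operator as an integral with the same even weight. -/
theorem integrable_weight_low :
    Integrable (fun ω => (freqWeight ω : ℂ) • ((low U e (freqComp U e 0 V ω))ᴴ *
        low U e (freqComp U e 0 V ω))) ∧
      decay U e V = (Real.exp (-(1 / 8)) : ℂ) •
        ∫ ω, (freqWeight ω : ℂ) • ((low U e (freqComp U e 0 V ω))ᴴ *
          low U e (freqComp U e 0 V ω)) := by
  have hi := integrable_sandwich U e V 0 0 1
  have hpt : ∀ ω : ℝ, (metro (ω - 1 / 2) : ℂ) • ((freqComp U e 0 V (ω - 1 / 2))ᴴ * 1 *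
        freqComp U e 0 V (ω - 1 / 2)) = (Real.exp (-(1 / 8)) : ℂ) •
          ((freqWeight ω : ℂ) • ((low U e (freqComp U e 0 V ω))ᴴ *
            low U e (freqComp U e 0 V ω))) := fun ω => by
    rw [mul_one, freqComp_shift_low, Matrix.conjTranspose_smul, RCLike.star_def,
      Complex.conj_ofReal]
    simp only [Matrix.smul_mul, Matrix.mul_smul, smul_smul]
    congr 1
    have := metro_shift ω
    rw [show ω / 2 - 1 / 8 = (ω / 4 - 1 / 16) + (ω / 4 - 1 / 16) by ring, Real.exp_add] at this
    exact_mod_cast this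
  have hsh := hi.comp_sub_right (1 / 2)
  simp only [hpt] at hsh
  have hne : (Real.exp (-(1 / 8)) : ℂ) ≠ 0 := by exact_mod_cast (Real.exp_pos _).ne'
  have hsm := hsh.smul ((Real.exp (-(1 / 8)) : ℂ)⁻¹)
  refine ⟨hsm.congr (Filter.Eventually.of_forall fun ω => ?_), ?_⟩
  · rw [Pi.smul_apply, smul_smul, inv_mul_cancel₀ hne, one_smul]
  rw [decay, ← integral_sub_right_eq_self _ (1 / 2 : ℝ)]
  simp only [hpt]
  rw [integral_smul]

variable {V}

/-- The generator is symmetric for the inner product `⟨Y, X⟩ = tr (Y† ρ^{1/2} X ρ^{1/2})`, and its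
form is an integral of products of commutators with the frequency components of the jump. -/
theorem kms_form (hV : V.IsHermitian) (X Y : Matrix n n ℂ) :
    let x := gexp U e (-(1 / 4)) * X * gexp U e (-(1 / 4))
    let y := gexp U e (-(1 / 4)) * Y * gexp U e (-(1 / 4))
    Integrable (fun ω => (freqWeight ω : ℂ) * (twistForm U e (freqComp U e 0 V ω) y x +
      twistForm U e (freqComp U e 0 V ω)ᴴ y x)) ∧
    -2 * (Yᴴ * gexp U e (-(1 / 2)) * jumpDual U e V X * gexp U e (-(1 / 2))).trace =
      Real.exp (-(1 / 8)) * ∫ ω, (freqWeight ω : ℂ) * (twistForm U e (freqComp U e 0 V ω) y x +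
        twistForm U e (freqComp U e 0 V ω)ᴴ y x) := by
  intro x y
  obtain ⟨i1, v1⟩ := integrable_weight_sandwich U e V X
  obtain ⟨i2, v2⟩ := integrable_weight_low U e V
  change Integrable (fun ω => (freqWeight ω : ℂ) • ((freqComp U e 0 V ω)ᴴ * x *
    freqComp U e 0 V ω)) at i1
  change _ = (Real.exp (-(1 / 8)) : ℂ) • ∫ ω, (freqWeight ω : ℂ) • ((freqComp U e 0 V ω)ᴴ * x *
    freqComp U e 0 V ω) at v1
  set g1 : ℝ → Matrix n n ℂ := fun ω =>
    (freqWeight ω : ℂ) • ((freqComp U e 0 V ω)ᴴ * x * freqComp U e 0 V ω) with hg1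
  set g2 : ℝ → Matrix n n ℂ := fun ω => (freqWeight ω : ℂ) •
    ((low U e (freqComp U e 0 V ω))ᴴ * low U e (freqComp U e 0 V ω)) with hg2
  have hs : ∀ A B : Matrix n n ℂ, sechMean U e (A + B) = sechMean U e A + sechMean U e B :=
    fun A B => map_add _ A B
  have hss : ∀ (c : ℂ) (A : Matrix n n ℂ), sechMean U e (c • A) = c • sechMean U e A :=
    fun c A => map_smul _ c A
  have k1 : Integrable fun ω => g1 ω + g1 (-ω) := i1.add i1.comp_neg
  have k2 : Integrable fun ω => sechMean U e (g2 ω + g2 (-ω)) :=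
    ContinuousLinearMap.integrable_comp (bohr U e _) (i2.add i2.comp_neg)
  have w1 : ∫ ω, (g1 ω + g1 (-ω)) = (2 : ℂ) • ∫ ω, g1 ω := by
    rw [integral_add i1 i1.comp_neg, integral_neg_eq_self, two_smul]
  have w2 : ∫ ω, sechMean U e (g2 ω + g2 (-ω)) = (2 : ℂ) • sechMean U e (∫ ω, g2 ω) := by
    have : ∫ ω, (g2 ω + g2 (-ω)) = (2 : ℂ) • ∫ ω, g2 ω := by
      rw [integral_add i2 i2.comp_neg, integral_neg_eq_self, two_smul]
    rw [← hss, ← this]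
    exact ContinuousLinearMap.integral_comp_comm (bohr U e _) (i2.add i2.comp_neg)
  have hpt : ∀ ω, (freqWeight ω : ℂ) * (twistForm U e (freqComp U e 0 V ω) y x +
      twistForm U e (freqComp U e 0 V ω)ᴴ y x) =
      (yᴴ * sechMean U e (g2 ω + g2 (-ω)) * x).trace +
        (yᴴ * x * sechMean U e (g2 ω + g2 (-ω)) * 1).trace -
        (yᴴ * (g1 ω + g1 (-ω)) * 1).trace := fun ω => by
    rw [twistForm_add]
    have h1 : g1 (-ω) = (freqWeight ω : ℂ) •
        (freqComp U e 0 V ω * x * (freqComp U e 0 V ω)ᴴ) := by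
      simp only [hg1, freqWeight_neg, freqComp_neg U e hV, Matrix.conjTranspose_conjTranspose]
    have h2 : g2 (-ω) = (freqWeight ω : ℂ) •
        (high U e (freqComp U e 0 V ω) * (high U e (freqComp U e 0 V ω))ᴴ) := by
      simp only [hg2, freqWeight_neg, freqComp_neg U e hV, conjTranspose_low, conjTranspose_high,
        Matrix.conjTranspose_conjTranspose]
    rw [h1, h2]
    simp only [hg1, hg2, hs, hss, mul_one, mul_add, add_mul, Matrix.mul_smul, Matrix.smul_mul,
      Matrix.trace_add, Matrix.trace_smul, smul_eq_mul]
    ring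
  have j1 := integrable_trace_mul k2 yᴴ x
  have j2 := integrable_trace_mul k2 (yᴴ * x) 1
  have j3 := integrable_trace_mul k1 yᴴ 1
  simp only [hpt]
  refine ⟨(j1.add j2).sub j3, ?_⟩
  have hint := (integral_sub (j1.add j2) j3).trans
    (congrArg₂ (· - ·) (integral_add j1 j2) (Eq.refl _))
  simp only [Pi.add_apply] at hint
  rw [hint, ← trace_mul_integral k2, ← trace_mul_integral k2, ← trace_mul_integral k1, w1, w2]
  have hsplit : gexp U e (-(1 / 2)) = gexp U e (-(1 / 4)) * gexp U e (-(1 / 4)) := by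
    rw [gexp_mul]; congr 1; ring
  have hqq : ∀ Z : Matrix n n ℂ, (Yᴴ * gexp U e (-(1 / 2)) * Z * gexp U e (-(1 / 2))).trace =
      (yᴴ * (gexp U e (-(1 / 4)) * Z * gexp U e (-(1 / 4)))).trace := fun Z => by
    have hqH : (gexp U e (-(1 / 4)))ᴴ = gexp U e (-(1 / 4)) := by
      rw [gexp_conjTranspose]; simp
    rw [hsplit, ← mul_assoc _ (gexp U e (-(1 / 4))) (gexp U e (-(1 / 4))), Matrix.trace_mul_comm]
    simp only [y, Matrix.conjTranspose_mul, hqH, mul_assoc]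
  have h2 := gexp_neg_mul_gexp U e (1 / 4)
  have h3 := gexp_mul_gexp_neg U e (1 / 4)
  have e1 : gexp U e (-(1 / 4)) * (effOp U e V * X) * gexp U e (-(1 / 4)) =
      sechMean U e (decay U e V) * x := by
    rw [← low_effOp, low_eq]
    calc _ = gexp U e (-(1 / 4)) * effOp U e V * 1 * X * gexp U e (-(1 / 4)) := by noncomm_ring
      _ = _ := by rw [← h3]; simp only [x]; noncomm_ring
  have e2 : gexp U e (-(1 / 4)) * (X * (effOp U e V)ᴴ) * gexp U e (-(1 / 4)) =
      x * sechMean U e (decay U e V) := by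
    rw [← high_effOp_conjTranspose, high_eq]
    calc _ = gexp U e (-(1 / 4)) * X * 1 * (effOp U e V)ᴴ * gexp U e (-(1 / 4)) := by noncomm_ring
      _ = _ := by rw [← h2]; simp only [x]; noncomm_ring
  rw [hqq, jumpDual_apply, mul_sub, mul_sub, sub_mul, sub_mul, e1, e2, v1, v2]
  simp only [hss, mul_one, mul_sub, Matrix.mul_smul, Matrix.smul_mul, Matrix.trace_smul,
    Matrix.trace_sub, smul_eq_mul, mul_assoc]
  ring

end Dirichlet

/-! ### Truncation in frequency -/

section Truncation

open MeasureTheory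

theorem gaussAmp_sq (y : ℝ) :
    gaussAmp y ^ 2 = (Real.sqrt (2 * Real.pi))⁻¹ * Real.exp (-(1 / 2) * y ^ 2) := by
  rw [gaussAmp, mul_pow, Real.sq_sqrt (by positivity), ← Real.exp_nat_mul]
  congr 2
  push_cast
  ring

theorem integrable_gaussAmp_sq : Integrable fun y => gaussAmp y ^ 2 := by
  simp only [gaussAmp_sq]
  exact (integrable_exp_neg_mul_sq (by norm_num)).const_mul _

theorem integral_gaussAmp_sq : ∫ y, gaussAmp y ^ 2 = 1 := by
  simp only [gaussAmp_sq]
  rw [integral_const_mul, integral_gaussian, div_div_eq_mul_div, div_one, mul_comm Real.pi]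
  exact inv_mul_cancel₀ (Real.sqrt_pos.2 (by positivity)).ne'

/-- The `L¹` norm of the Gaussian window. -/
def windowMass : ℝ := ∫ s, ‖window 0 s‖

theorem windowMass_nonneg : 0 ≤ windowMass := integral_nonneg fun _ => norm_nonneg _

/-- The integral of `e^{-η|ω|/2}`. -/
def tailMass (η : ℝ) : ℝ := ∫ ω, Real.exp (-(η / 2) * |ω|)

theorem tailMass_nonneg (η : ℝ) : 0 ≤ tailMass η := integral_nonneg fun _ => (Real.exp_pos _).le

theorem integrable_exp_neg_mul_abs {a : ℝ} (ha : 0 < a) :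
    Integrable fun ω : ℝ => Real.exp (-a * |ω|) := by
  refine (integrable_inv_one_add_sq.const_mul (1 + 2 / a ^ 2)).mono'
    (Continuous.aestronglyMeasurable (by fun_prop)) (Filter.Eventually.of_forall fun ω => ?_)
  have h1 := Real.quadratic_le_exp_of_nonneg (mul_nonneg ha.le (abs_nonneg ω))
  have h2 : 1 + ω ^ 2 ≤ (1 + 2 / a ^ 2) * Real.exp (a * |ω|) := by
    have h3 : (1 + 2 / a ^ 2) * (1 + a * |ω| + (a * |ω|) ^ 2 / 2) =
        1 + ω ^ 2 + (2 / a ^ 2 + a ^ 2 * ω ^ 2 / 2 + (1 + 2 / a ^ 2) * (a * |ω|)) := by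
      rw [mul_pow, sq_abs]
      field_simp
      ring
    have h4 : 0 ≤ 2 / a ^ 2 + a ^ 2 * ω ^ 2 / 2 + (1 + 2 / a ^ 2) * (a * |ω|) := by positivity
    calc _ ≤ (1 + 2 / a ^ 2) * (1 + a * |ω| + (a * |ω|) ^ 2 / 2) := by linarith
      _ ≤ _ := by gcongr
  rw [Real.norm_of_nonneg (Real.exp_pos _).le, neg_mul, Real.exp_neg, ← div_eq_mul_inv,
    inv_le_comm₀ (Real.exp_pos _) (by positivity), inv_div, div_le_iff₀ (by positivity)]
  linarith

variable {n : Type*} [Fintype n] [DecidableEq n] (U : Matrix.unitaryGroup n ℂ) (e : n → ℝ)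

theorem norm_freqComp_le (c : ℂ) (hc : c.re = 0) (A : Matrix n n ℂ) (ω : ℝ) :
    ‖freqComp U e c A ω‖ ≤ Real.exp (c.im ^ 2) * windowMass * ‖A‖ := by
  refine (norm_windowFT_heis_le U e A c ω).trans (le_of_eq ?_)
  rw [windowMass, ← integral_const_mul]
  congr 2
  funext s
  rw [norm_window, norm_window, hc, Complex.zero_re, Complex.zero_im, mul_left_comm,
    ← Real.exp_add]
  congr 2
  ring

/-- The part of `O` of Bohr frequencies close to `ω`. -/
def freqLoc (O : Matrix n n ℂ) (ω : ℝ) : Matrix n n ℂ :=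
  freqComp U e 0 (freqComp U e 0 O ω) ω

theorem freqLoc_eq_bohr (O : Matrix n n ℂ) (ω : ℝ) :
    freqLoc U e O ω = bohr U e (fun ν => ((gaussAmp (ω - ν) ^ 2 : ℝ) : ℂ)) O := by
  rw [freqLoc, freqComp_eq_bohr, freqComp_eq_bohr, bohr_bohr]
  refine congrArg (fun φ => bohr U e φ O) (funext fun ν => ?_)
  simp [windowAmp, pow_two]

theorem integrable_freqLoc (O : Matrix n n ℂ) : Integrable (freqLoc U e O) := by
  have h : freqLoc U e O = fun ω => bohr U e (fun ν => ((gaussAmp (ω - ν) ^ 2 : ℝ) : ℂ)) O :=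
    funext fun ω => freqLoc_eq_bohr U e O ω
  rw [h]
  exact integrable_bohr U e (φ := fun ω ν => ((gaussAmp (ω - ν) ^ 2 : ℝ) : ℂ))
    (fun ν => (integrable_gaussAmp_sq.comp_sub_right ν).ofReal) O

/-- The Gaussians `gaussAmp (ω - ν) ^ 2` in `ω` are probability densities, so their integral
recovers `O`. -/
theorem integral_freqLoc (O : Matrix n n ℂ) : ∫ ω, freqLoc U e O ω = O := by
  simp only [freqLoc_eq_bohr]
  rw [← bohr_integral U e (φ := fun ω ν => ((gaussAmp (ω - ν) ^ 2 : ℝ) : ℂ))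
    (fun ν => (integrable_gaussAmp_sq.comp_sub_right ν).ofReal) O]
  conv_rhs => rw [← bohr_one U e O]
  refine congrArg (fun φ => bohr U e φ O) (funext fun ν => ?_)
  refine (integral_ofReal (𝕜 := ℂ) (f := fun ω => gaussAmp (ω - ν) ^ 2)).trans ?_
  rw [integral_sub_right_eq_self (fun y => gaussAmp y ^ 2), integral_gaussAmp_sq]
  exact Complex.ofReal_one

theorem bohr_exp_freqLoc (a : ℝ) (O : Matrix n n ℂ) (ω : ℝ) :
    bohr U e (fun ν => Complex.exp ((a : ℂ) * ν)) (freqLoc U e O ω) =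
      Complex.exp ((a : ℂ) * ω) • freqComp U e (Complex.I * a) (freqComp U e 0 O ω) ω := by
  rw [freqLoc, freqComp_eq_bohr U e (freqComp U e 0 O ω), bohr_bohr, freqComp_eq_bohr U e
    (freqComp U e 0 O ω), ← bohr_const_mul]
  refine congrArg (fun φ => bohr U e φ _) (funext fun ν => ?_)
  rw [windowAmp, windowAmp, ← mul_assoc, ← mul_assoc, ← Complex.exp_add, ← Complex.exp_add]
  congr 2
  push_cast
  linear_combination (-(a * (ω - ν))) * Complex.I_sq

/-- Up to a constant, evolution to the imaginary time `a` multiplies the component near the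
frequency `ω` by `e^{aω}`. -/
theorem norm_bohr_exp_freqLoc_le (a : ℝ) (O : Matrix n n ℂ) (ω : ℝ) :
    ‖bohr U e (fun ν => Complex.exp ((a : ℂ) * ν)) (freqLoc U e O ω)‖ ≤
      Real.exp (a * ω) * (Real.exp (a ^ 2) * windowMass ^ 2 * ‖O‖) := by
  have h1 := norm_freqComp_le U e (Complex.I * a) (by simp) (freqComp U e 0 O ω) ω
  have h2 := norm_freqComp_le U e 0 rfl O ω
  rw [bohr_exp_freqLoc, norm_smul, ← Complex.ofReal_mul, Complex.norm_exp_ofReal]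
  refine mul_le_mul_of_nonneg_left (h1.trans ?_) (Real.exp_pos _).le
  have := windowMass_nonneg
  calc _ ≤ Real.exp ((Complex.I * a).im ^ 2) * windowMass *
        (Real.exp ((0 : ℂ).im ^ 2) * windowMass * ‖O‖) := by gcongr
    _ = _ := by simp; ring

theorem bohr_freqLoc_comm (φ : ℝ → ℂ) (O : Matrix n n ℂ) (ω : ℝ) :
    bohr U e φ (freqLoc U e O ω) = freqLoc U e (bohr U e φ O) ω := by
  rw [freqLoc_eq_bohr, freqLoc_eq_bohr, bohr_bohr, bohr_bohr]
  simp only [mul_comm]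

theorem norm_freqLoc_le_of_bohr (a : ℝ) (O : Matrix n n ℂ) (ω : ℝ) :
    ‖freqLoc U e O ω‖ ≤ Real.exp (-a * ω) * (Real.exp (a ^ 2) * windowMass ^ 2 *
      ‖bohr U e (fun ν => Complex.exp ((a : ℂ) * ν)) O‖) := by
  have h := norm_bohr_exp_freqLoc_le U e (-a) (bohr U e (fun ν => Complex.exp ((a : ℂ) * ν)) O) ω
  rw [← bohr_freqLoc_comm, bohr_bohr, neg_pow_two] at h
  convert h using 2
  conv_lhs => rw [← bohr_one U e (freqLoc U e O ω)]
  refine congrArg (fun φ => bohr U e φ _) (funext fun ν => ?_)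
  rw [← Complex.exp_add]
  simp

variable {U e} {η m : ℝ} {P : Matrix n n ℂ}

/-- Bounded evolutions to the imaginary times `± iη` make the components of high frequency
exponentially small. -/
theorem Tame.norm_freqLoc_le (h : Tame U e η m P) (hη : 0 < η) (hη1 : η ≤ 1) (ω : ℝ) :
    ‖freqLoc U e P ω‖ ≤ Real.exp 1 * windowMass ^ 2 * m * Real.exp (-η * |ω|) := by
  have hsq : Real.exp (η ^ 2) ≤ Real.exp 1 := Real.exp_le_exp.2 (by nlinarith)
  rcases le_total 0 ω with hω | hω
  · rw [abs_of_nonneg hω]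
    refine (norm_freqLoc_le_of_bohr U e η P ω).trans ?_
    rw [mul_comm]
    gcongr
    exact h.pos
  · rw [abs_of_nonpos hω]
    refine (norm_freqLoc_le_of_bohr U e (-η) P ω).trans ?_
    rw [mul_comm, neg_pow_two, neg_neg, mul_neg, neg_mul, neg_neg]
    gcongr
    exact h.neg

variable (U e)

/-- The part of `O` of Bohr frequencies up to about `Ω`. -/
def trunc (Ω : ℝ) (O : Matrix n n ℂ) : Matrix n n ℂ :=
  ∫ ω in Set.Icc (-Ω) Ω, freqLoc U e O ω

variable {U e}

theorem Tame.norm_trunc_le (h : Tame U e η m P) (hη : 0 < η) (hη1 : η ≤ 1) (Ω : ℝ) :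
    ‖trunc U e Ω P‖ ≤ Real.exp 1 * windowMass ^ 2 * tailMass η * m := by
  have hm : 0 ≤ m := (norm_nonneg _).trans h.pos
  have hi := (integrable_exp_neg_mul_abs (a := η / 2) (by positivity)).const_mul
    (Real.exp 1 * windowMass ^ 2 * m)
  refine (norm_integral_le_of_norm_le hi.integrableOn (Filter.Eventually.of_forall fun ω =>
    (h.norm_freqLoc_le hη hη1 ω).trans ?_)).trans ((setIntegral_le_integral hi
      (Filter.Eventually.of_forall fun ω => ?_)).trans (le_of_eq ?_))
  · gcongr
    linarith
  · positivity
  · rw [integral_const_mul, tailMass]; ring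

theorem Tame.norm_sub_trunc_le (h : Tame U e η m P) (hη : 0 < η) (hη1 : η ≤ 1) (Ω : ℝ) :
    ‖P - trunc U e Ω P‖ ≤
      Real.exp 1 * windowMass ^ 2 * tailMass η * m * Real.exp (-(η * Ω / 2)) := by
  have hm : 0 ≤ m := (norm_nonneg _).trans h.pos
  have hi := (integrable_exp_neg_mul_abs (a := η / 2) (by positivity)).const_mul
    (Real.exp 1 * windowMass ^ 2 * m * Real.exp (-(η * Ω / 2)))
  have h1 : P - trunc U e Ω P = ∫ ω in (Set.Icc (-Ω) Ω)ᶜ, freqLoc U e P ω := by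
    rw [sub_eq_iff_eq_add', trunc, integral_add_compl measurableSet_Icc (integrable_freqLoc U e P),
      integral_freqLoc]
  rw [h1]
  refine (norm_integral_le_of_norm_le hi.integrableOn ((ae_restrict_mem
    measurableSet_Icc.compl).mono fun ω hω => (h.norm_freqLoc_le hη hη1 ω).trans ?_)).trans
    ((setIntegral_le_integral hi (Filter.Eventually.of_forall fun ω => ?_)).trans (le_of_eq ?_))
  · have hω' : Ω ≤ |ω| := by
      by_contra hlt
      exact hω (abs_le.1 (not_le.1 hlt).le)
    rw [mul_assoc _ (Real.exp _) (Real.exp _), ← Real.exp_add]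
    gcongr
    nlinarith
  · positivity
  · rw [integral_const_mul, tailMass]; ring

/-- Truncation makes the evolution to any imaginary time `|a| ≤ 1` bounded, at an exponential cost
in `Ω`. -/
theorem norm_bohr_exp_trunc_le {a : ℝ} (ha : |a| ≤ 1) {O : Matrix n n ℂ} (hO : ‖O‖ ≤ 1) {Ω : ℝ}
    (hΩ : 0 ≤ Ω) : ‖bohr U e (fun ν => Complex.exp ((a : ℂ) * ν)) (trunc U e Ω O)‖ ≤
      2 * Ω * Real.exp (|a| * Ω) * (Real.exp 1 * windowMass ^ 2) := by
  rw [trunc, ← ContinuousLinearMap.integral_comp_comm _ (integrable_freqLoc U e O).integrableOn]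
  refine (norm_setIntegral_le_of_norm_le_const (C := Real.exp (|a| * Ω) *
    (Real.exp 1 * windowMass ^ 2)) (by simp) fun ω hω => ?_).trans (le_of_eq ?_)
  · refine (norm_bohr_exp_freqLoc_le U e a O ω).trans ?_
    have h1 : a * ω ≤ |a| * Ω := (le_abs_self _).trans (by
      rw [abs_mul]; gcongr; exact abs_le.2 hω)
    have h2 : a ^ 2 ≤ 1 := by rw [← sq_abs]; nlinarith [abs_nonneg a]
    have h3 : Real.exp (a ^ 2) * windowMass ^ 2 * ‖O‖ ≤ Real.exp 1 * windowMass ^ 2 := by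
      calc _ ≤ Real.exp 1 * windowMass ^ 2 * 1 := by gcongr
        _ = _ := mul_one _
    gcongr
  · rw [Measure.real, Real.volume_Icc, ENNReal.toReal_ofReal (by linarith)]; ring

end Truncation

/-! ### Decay of commutators with the jumps -/

section Commutator

open MeasureTheory

/-- The integral of `|f|²/p`, for the Gaussian window `f` and the time kernel `p`. -/
def windowCost : ℝ := ∫ s, ‖window 0 s‖ ^ 2 / sechKernel s

theorem windowCost_nonneg : 0 ≤ windowCost :=
  integral_nonneg fun s => div_nonneg (sq_nonneg _) (sechKernel_pos s).le

theorem integrable_windowCost : Integrable fun s => ‖window 0 s‖ ^ 2 / sechKernel s := by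
  refine ((integrable_exp_neg_mul_sq one_pos).const_mul
    (Real.sqrt (2 / Real.pi) * Real.exp (Real.pi ^ 2))).mono'
    ((((continuous_window 0).norm.pow 2).div continuous_sechKernel
      fun s => (sechKernel_pos s).ne').aestronglyMeasurable) (Filter.Eventually.of_forall fun s => ?_)
  rw [Real.norm_of_nonneg (div_nonneg (sq_nonneg _) (sechKernel_pos s).le), norm_window, mul_pow,
    Real.sq_sqrt (Real.sqrt_nonneg _), sechKernel, div_inv_eq_mul, ← Real.exp_nat_mul,
    mul_assoc (Real.sqrt _), mul_assoc (Real.sqrt _)]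
  refine mul_le_mul_of_nonneg_left ?_ (Real.sqrt_nonneg _)
  have h1 : Real.cosh (2 * Real.pi * s) ≤ Real.exp (Real.pi ^ 2 + s ^ 2) := by
    rw [Real.cosh_eq, div_le_iff₀ two_pos, mul_two]
    exact add_le_add (Real.exp_le_exp.2 (by nlinarith [sq_nonneg (Real.pi - s)]))
      (Real.exp_le_exp.2 (by nlinarith [sq_nonneg (Real.pi + s)]))
  calc _ ≤ Real.exp ((2 : ℕ) * ((0 : ℂ).im ^ 2 - (s + (0 : ℂ).re) ^ 2)) *
        Real.exp (Real.pi ^ 2 + s ^ 2) := by gcongr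
    _ = _ := by
      rw [← Real.exp_add, ← Real.exp_add]
      congr 1
      simp only [Complex.zero_im, Complex.zero_re]
      push_cast
      ring

variable {n : Type*} [Fintype n] [DecidableEq n] (U : Matrix.unitaryGroup n ℂ) (e : n → ℝ)

/-- The vector `ρ^{1/2}` is normalized in the Hilbert–Schmidt norm when `ρ = e^{-K}` has trace one.
-/
theorem hs_gexp_half (hZ : (gexp U e (-1)).trace = 1) : hs (gexp U e (-(1 / 2))) = 1 := by
  have h := trace_conjTranspose_mul_self (gexp U e (-(1 / 2)))
  rw [gexp_conjTranspose, gexp_mul, show star (-(1 / 2) : ℂ) + -(1 / 2) = -1 by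
    simp; norm_num, hZ] at h
  have h2 : hs (gexp U e (-(1 / 2))) ^ 2 = 1 := by exact_mod_cast h.symm
  exact (pow_eq_one_iff_of_nonneg (hs_nonneg _) two_ne_zero).1 h2

theorem norm_trace_mul_gexp_le (hZ : (gexp U e (-1)).trace = 1) (Y Z : Matrix n n ℂ) :
    ‖(Y * gexp U e (-(1 / 2)) * Z * gexp U e (-(1 / 2))).trace‖ ≤ ‖Y‖ * ‖Z‖ := by
  have h := hs_gexp_half U e hZ
  rw [mul_assoc]
  refine (norm_trace_mul_le _ _).trans ?_
  refine (mul_le_mul (hs_mul_le _ _) (hs_mul_le _ _) (hs_nonneg _)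
    (mul_nonneg (norm_nonneg _) (hs_nonneg _))).trans (le_of_eq ?_)
  rw [h, mul_one, mul_one]

theorem norm_trace_mul_gibbs_le (hZ : (gexp U e (-1)).trace = 1) (Y : Matrix n n ℂ) :
    ‖(Y * gexp U e (-1)).trace‖ ≤ ‖Y‖ := by
  have h := norm_trace_mul_gexp_le U e hZ Y 1
  rw [mul_one, mul_assoc, gexp_mul, show -(1 / 2 : ℂ) + -(1 / 2) = -1 by norm_num] at h
  exact h.trans (mul_le_of_le_one_right (norm_nonneg _) norm_one_le)

/-- The diagonal of `twistForm`. -/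
def twistSq (F x : Matrix n n ℂ) : ℝ :=
  ∫ t, sechKernel t * hs (twist U e (heis U e t F) x) ^ 2

theorem twistSq_nonneg (F x : Matrix n n ℂ) : 0 ≤ twistSq U e F x :=
  integral_nonneg fun t => mul_nonneg (sechKernel_pos t).le (sq_nonneg _)

theorem sech_twist_self (F x : Matrix n n ℂ) (t : ℝ) :
    (sechKernel t : ℂ) * ((twist U e (heis U e t F) x)ᴴ * twist U e (heis U e t F) x).trace =
      ((sechKernel t * hs (twist U e (heis U e t F) x) ^ 2 : ℝ) : ℂ) := by
  rw [trace_conjTranspose_mul_self]; push_cast; rfl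

theorem integrable_twistSq (F x : Matrix n n ℂ) :
    Integrable fun t => sechKernel t * hs (twist U e (heis U e t F) x) ^ 2 := by
  have h := (integrable_sech_twist U e F x x).re
  refine h.congr (Filter.Eventually.of_forall fun t => ?_)
  simp only [sech_twist_self]
  exact Complex.ofReal_re _

theorem twistForm_self (F x : Matrix n n ℂ) : twistForm U e F x x = (twistSq U e F x : ℂ) := by
  rw [twistForm, twistSq]
  simp only [sech_twist_self]
  exact integral_ofReal

/-- The Dirichlet form of the jump `V`, up to a constant factor. -/
def dirichlet (V x : Matrix n n ℂ) : ℝ :=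
  ∫ ω, freqWeight ω * (twistSq U e (freqComp U e 0 V ω) x + twistSq U e (freqComp U e 0 V ω)ᴴ x)

theorem dirichlet_nonneg (V x : Matrix n n ℂ) : 0 ≤ dirichlet U e V x :=
  integral_nonneg fun ω => mul_nonneg (freqWeight_pos ω).le
    (add_nonneg (twistSq_nonneg _ _ _ _) (twistSq_nonneg _ _ _ _))

variable {V : Matrix n n ℂ}

theorem integrable_dirichlet (hV : V.IsHermitian) (X : Matrix n n ℂ) :
    Integrable fun ω => freqWeight ω *
      (twistSq U e (freqComp U e 0 V ω) (gexp U e (-(1 / 4)) * X * gexp U e (-(1 / 4))) +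
      twistSq U e (freqComp U e 0 V ω)ᴴ (gexp U e (-(1 / 4)) * X * gexp U e (-(1 / 4)))) := by
  refine (kms_form U e hV X X).1.re.congr (Filter.Eventually.of_forall fun ω => ?_)
  simp only [twistForm_self, ← Complex.ofReal_add, ← Complex.ofReal_mul]
  exact Complex.ofReal_re _

/-- The Dirichlet form of `X` in the inner product `⟨Y, X⟩ = tr (Y† ρ^{1/2} X ρ^{1/2})`. -/
theorem dirichlet_eq (hV : V.IsHermitian) (X : Matrix n n ℂ) :
    Real.exp (-(1 / 8)) * dirichlet U e V (gexp U e (-(1 / 4)) * X * gexp U e (-(1 / 4))) =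
      -2 * (Xᴴ * gexp U e (-(1 / 2)) * jumpDual U e V X * gexp U e (-(1 / 2))).trace.re := by
  have h := (kms_form U e hV X X).2
  simp only [twistForm_self, ← Complex.ofReal_add, ← Complex.ofReal_mul] at h
  have h2 : ∫ ω, ((freqWeight ω * (twistSq U e (freqComp U e 0 V ω)
      (gexp U e (-(1 / 4)) * X * gexp U e (-(1 / 4))) +
      twistSq U e (freqComp U e 0 V ω)ᴴ (gexp U e (-(1 / 4)) * X * gexp U e (-(1 / 4)))) : ℝ) : ℂ) =
      (dirichlet U e V (gexp U e (-(1 / 4)) * X * gexp U e (-(1 / 4))) : ℂ) := integral_ofReal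
  rw [h2, ← Complex.ofReal_mul] at h
  have h3 := congrArg Complex.re h
  rw [Complex.ofReal_re] at h3
  rw [← h3]
  simp

/-- The generator preserves expectations in the Gibbs state. -/
theorem trace_jumpDual_gibbs (hV : V.IsHermitian) (X : Matrix n n ℂ) :
    (jumpDual U e V X * gexp U e (-1)).trace = 0 := by
  have h := (kms_form U e hV X 1).2
  have htw : ∀ F : Matrix n n ℂ,
      twist U e F (gexp U e (-(1 / 4)) * 1 * gexp U e (-(1 / 4))) = 0 := fun F => by
    rw [twist_sandwich]; simp
  simp only [twistForm, htw, Matrix.conjTranspose_zero, zero_mul, Matrix.trace_zero, mul_zero,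
    integral_zero, add_zero, Matrix.conjTranspose_one, one_mul] at h
  have h2 := (mul_eq_zero.1 h).resolve_left (by norm_num)
  rw [mul_assoc, Matrix.trace_mul_comm, mul_assoc, gexp_mul] at h2
  rw [← h2]
  congr 3
  norm_num

/-- The weighted inequality of the arithmetic and geometric means: `p` and `u` play the roles of the
time kernel and the frequency weight, and `τ` remains free. -/
theorem amgm_weighted {w h p u τ : ℝ} (hp : 0 < p) (hu : 0 < u) (hτ : 0 < τ) :
    w * h ≤ τ / 2 / u * (w ^ 2 / p) + u / (2 * τ) * (p * h ^ 2) := by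
  have h1 : τ / 2 / u * (w ^ 2 / p) + u / (2 * τ) * (p * h ^ 2) - w * h =
      (τ * w - u * p * h) ^ 2 / (2 * τ * u * p) := by
    field_simp
    ring
  have h2 : 0 ≤ (τ * w - u * p * h) ^ 2 / (2 * τ * u * p) := by positivity
  linarith

variable (V)

/-- The functional `F ↦ tr (e^{-K/4} [F, X] e^{-K/4} R)`. -/
def twistTrace (x R : Matrix n n ℂ) : Matrix n n ℂ →L[ℂ] ℂ :=
  traceCLM ∘L (ContinuousLinearMap.mul ℂ (Matrix n n ℂ)).flip R ∘L
    ((ContinuousLinearMap.mul ℂ (Matrix n n ℂ)).flip x ∘L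
      bohr U e (fun ν => Complex.exp (-(1 / 4) * ν)) -
    ContinuousLinearMap.mul ℂ (Matrix n n ℂ) x ∘L bohr U e (fun ν => Complex.exp (1 / 4 * ν)))

theorem twistTrace_apply (x R F : Matrix n n ℂ) :
    twistTrace U e x R F = (twist U e F x * R).trace := rfl

/-- A component of the jump near one frequency is an average of the evolutions that enter the
Dirichlet form. -/
theorem norm_twistTrace_freqLoc_le (x R : Matrix n n ℂ) (ω : ℝ) {τ : ℝ} (hτ : 0 < τ) :
    ‖twistTrace U e x R (freqLoc U e V ω)‖ ≤ hs R * (τ / 2 / freqWeight ω * windowCost +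
      freqWeight ω / (2 * τ) * twistSq U e (freqComp U e 0 V ω) x) := by
  set F := freqComp U e 0 V ω with hF
  have hi := integrable_windowFT 0 (isTrigFamily_heis U e F) ω
  rw [freqLoc, ← hF, freqComp, windowFT, map_smul, ← ContinuousLinearMap.integral_comp_comm _ hi,
    norm_smul]
  have h1 : ‖((Real.sqrt (2 * Real.pi) : ℂ))⁻¹‖ ≤ 1 := by
    rw [norm_inv, Complex.norm_real, Real.norm_of_nonneg (Real.sqrt_nonneg _)]
    refine inv_le_one_of_one_le₀ (Real.one_le_sqrt.2 ?_)
    linarith [Real.pi_gt_three]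
  refine (mul_le_of_le_one_left (norm_nonneg _) h1).trans ?_
  have hb : Integrable fun s => hs R * (τ / 2 / freqWeight ω * (‖window 0 s‖ ^ 2 / sechKernel s) +
      freqWeight ω / (2 * τ) * (sechKernel s * hs (twist U e (heis U e s F) x) ^ 2)) :=
    ((integrable_windowCost.const_mul _).add ((integrable_twistSq U e F x).const_mul _)).const_mul _
  refine (norm_integral_le_of_norm_le hb (Filter.Eventually.of_forall fun s => ?_)).trans
    (le_of_eq ?_)
  · rw [map_smul, norm_smul, norm_mul, norm_phase, mul_one, twistTrace_apply]
    calc _ ≤ ‖window 0 s‖ * (hs (twist U e (heis U e s F) x) * hs R) := by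
          gcongr; exact norm_trace_mul_le _ _
      _ = hs R * (‖window 0 s‖ * hs (twist U e (heis U e s F) x)) := by ring
      _ ≤ _ := mul_le_mul_of_nonneg_left
          (amgm_weighted (sechKernel_pos s) (freqWeight_pos ω) hτ) (hs_nonneg R)
  · rw [integral_const_mul, integral_add (integrable_windowCost.const_mul _)
      ((integrable_twistSq U e F x).const_mul _), integral_const_mul, integral_const_mul,
      windowCost, twistSq]

variable {V}

/-- The commutator with a truncated jump is controlled by the Dirichlet form of `X`. The reciprocal
of `freqWeight` is where the truncation is needed. -/
theorem norm_twistTrace_trunc_le (hV : V.IsHermitian) (X R : Matrix n n ℂ) {Ω τ : ℝ} (hΩ : 0 ≤ Ω)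
    (hτ : 0 < τ) :
    let x := gexp U e (-(1 / 4)) * X * gexp U e (-(1 / 4))
    ‖twistTrace U e x R (trunc U e Ω V)‖ ≤
      hs R * (τ * windowCost * Ω * Real.exp (Ω / 2) + dirichlet U e V x / (2 * τ)) := by
  intro x
  have hi := integrable_dirichlet U e hV X
  change Integrable (fun ω => freqWeight ω * (twistSq U e (freqComp U e 0 V ω) x +
    twistSq U e (freqComp U e 0 V ω)ᴴ x)) at hi
  rw [trunc, ← ContinuousLinearMap.integral_comp_comm _ (integrable_freqLoc U e V).integrableOn]
  have hc : IntegrableOn (fun _ : ℝ => τ / 2 * Real.exp (Ω / 2) * windowCost) (Set.Icc (-Ω) Ω) :=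
    integrableOn_const (by simp)
  have hd := (hi.const_mul (1 / (2 * τ)))
  have hb := (hc.add hd.integrableOn).const_mul (hs R)
  refine (norm_integral_le_of_norm_le hb ((ae_restrict_mem measurableSet_Icc).mono
    fun ω hω => (norm_twistTrace_freqLoc_le U e V x R ω hτ).trans ?_)).trans ?_
  · refine mul_le_mul_of_nonneg_left (add_le_add ?_ ?_) (hs_nonneg R)
    · beta_reduce
      rw [freqWeight, div_eq_mul_inv (τ / 2), ← Real.exp_neg, neg_neg]
      have := windowCost_nonneg
      have hab : |ω| ≤ Ω := abs_le.2 hω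
      gcongr
    · have h1 := twistSq_nonneg U e (freqComp U e 0 V ω)ᴴ x
      have h2 := (freqWeight_pos ω).le
      have h3 : freqWeight ω / (2 * τ) = 1 / (2 * τ) * freqWeight ω := by ring
      beta_reduce
      rw [h3, mul_assoc]
      gcongr
      linarith
  · rw [integral_const_mul]
    refine mul_le_mul_of_nonneg_left ?_ (hs_nonneg R)
    refine (integral_add hc hd.integrableOn).le.trans (add_le_add (le_of_eq ?_) ?_)
    · rw [setIntegral_const, Measure.real, Real.volume_Icc, ENNReal.toReal_ofReal (by linarith),
        smul_eq_mul]
      ring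
    · refine (setIntegral_le_integral hd (Filter.Eventually.of_forall fun ω => ?_)).trans
        (le_of_eq ?_)
      · exact mul_nonneg (by positivity) (mul_nonneg (freqWeight_pos ω).le
          (add_nonneg (twistSq_nonneg _ _ _ _) (twistSq_nonneg _ _ _ _)))
      · rw [integral_const_mul, dirichlet]; ring

/-- Distributing `ρ = e^{-K/4} e^{-K/2} e^{-K/4}` around the commutator moves the outer factors to
the imaginary times `± i/4`. -/
theorem trace_commutator_eq_twistTrace (P F Q X : Matrix n n ℂ) :
    (P * (F * X - X * F) * Q * gexp U e (-1)).trace =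
      twistTrace U e (gexp U e (-(1 / 4)) * X * gexp U e (-(1 / 4)))
        (high U e Q * gexp U e (-(1 / 2)) * low U e P) F := by
  rw [twistTrace_apply, twist_sandwich, high_eq, low_eq]
  have h2 := gexp_neg_mul_gexp U e (1 / 4)
  have h3 := gexp_mul_gexp_neg U e (1 / 4)
  set q := gexp U e (-(1 / 4))
  set p := gexp U e (1 / 4)
  have h4 : q * gexp U e (-(1 / 2)) * q = gexp U e (-1) := by
    rw [gexp_mul, gexp_mul]; congr 1; norm_num
  have h5 : q * (F * X - X * F) * q * (p * Q * q * gexp U e (-(1 / 2)) * (q * P * p)) =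
      q * ((F * X - X * F) * Q * gexp U e (-1) * P * p) := by
    calc _ = q * (F * X - X * F) * (q * p) * Q * (q * gexp U e (-(1 / 2)) * q) * P * p := by
          noncomm_ring
      _ = _ := by rw [h2, h4]; noncomm_ring
  rw [h5, Matrix.trace_mul_comm q, mul_assoc _ p q, h3, mul_one, Matrix.trace_mul_comm _ P]
  simp only [mul_assoc]

end Commutator

section Commutator

open MeasureTheory

variable {n : Type*} [Fintype n] [DecidableEq n] (U : Matrix.unitaryGroup n ℂ) (e : n → ℝ)

/-- The constant in `norm_trace_commutator_le`. -/
def commConst (η : ℝ) : ℝ :=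
  let k := Real.exp 1 * windowMass ^ 2
  let K := k * tailMass η
  2 * K * (1 + K + K ^ 2) + 4 * k ^ 2 * (windowCost + 2 * Real.exp (1 / 8))

theorem commConst_nonneg (η : ℝ) : 0 ≤ commConst η := by
  have h1 := windowMass_nonneg
  have h2 := tailMass_nonneg η
  have h3 := windowCost_nonneg
  unfold commConst
  positivity

variable {U e} {η m : ℝ} {V P Q : Matrix n n ℂ}

/-- If the Dirichlet form of `X` is small, then so are the correlations of `[V, X]` with operators
whose evolution to short imaginary times is under control: the frequencies of these operators may
be truncated at `Ω`, after which they cost a factor exponential in `Ω`. -/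
theorem norm_trace_commutator_le (hZ : (gexp U e (-1)).trace = 1) (hη : 0 < η) (hη1 : η ≤ 1)
    (hm : 1 ≤ m) (hV : V.IsHermitian) (hVt : Tame U e η m V) (hP : Tame U e η m P)
    (hQ : Tame U e η m Q) {X : Matrix n n ℂ} (hX : ‖X‖ ≤ 1) {Ω : ℝ} (hΩ : 0 ≤ Ω)
    (hD : dirichlet U e V (gexp U e (-(1 / 4)) * X * gexp U e (-(1 / 4))) ≤
      4 * Real.exp (1 / 8) * Real.exp (-(12 * Ω))) :
    ‖(P * (V * X - X * V) * Q * gexp U e (-1)).trace‖ ≤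
      commConst η * m ^ 3 * Real.exp (-(η * Ω / 2)) := by
  set k := Real.exp 1 * windowMass ^ 2 with hk
  set K := k * tailMass η with hK
  have hk0 : 0 ≤ k := by positivity
  have hK0 : 0 ≤ K := mul_nonneg hk0 (tailMass_nonneg η)
  have hcost := windowCost_nonneg
  set δ := K * m * Real.exp (-(η * Ω / 2)) with hδ
  have hδ0 : 0 ≤ δ := by positivity
  set P' := trunc U e Ω P
  set V' := trunc U e Ω V
  set Q' := trunc U e Ω Q
  have hPd : ‖P - P'‖ ≤ δ := hP.norm_sub_trunc_le hη hη1 Ω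
  have hVd : ‖V - V'‖ ≤ δ := hVt.norm_sub_trunc_le hη hη1 Ω
  have hQd : ‖Q - Q'‖ ≤ δ := hQ.norm_sub_trunc_le hη hη1 Ω
  have hPn : ‖P'‖ ≤ K * m := hP.norm_trunc_le hη hη1 Ω
  have hVn : ‖V'‖ ≤ K * m := hVt.norm_trunc_le hη hη1 Ω
  have hcomm : ∀ (Y : Matrix n n ℂ) (c : ℝ), ‖Y‖ ≤ c → ‖Y * X - X * Y‖ ≤ 2 * c :=
    fun Y c hY => by
      refine (norm_sub_le _ _).trans ?_
      have h1 := norm_mul_le Y X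
      have h2 := norm_mul_le X Y
      nlinarith [norm_nonneg X, norm_nonneg Y]
  have hsplit : P * (V * X - X * V) * Q = (P - P') * ((V * X - X * V) * Q) +
      P' * (((V - V') * X - X * (V - V')) * Q) + P' * ((V' * X - X * V') * (Q - Q')) +
      P' * (V' * X - X * V') * Q' := by noncomm_ring
  have hprod : ∀ {A B C : Matrix n n ℂ} {a b c : ℝ}, ‖A‖ ≤ a → ‖B‖ ≤ b → ‖C‖ ≤ c →
      ‖A * (B * C)‖ ≤ a * (b * c) := fun {A B C a b c} hA hB hC =>
    (norm_mul_le _ _).trans (mul_le_mul hA ((norm_mul_le _ _).trans (mul_le_mul hB hC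
      (norm_nonneg _) ((norm_nonneg _).trans hB))) (norm_nonneg _) ((norm_nonneg _).trans hA))
  have e1 := hprod hPd (hcomm V 1 hVt.norm_le) hQ.norm_le
  have e2 := hprod hPn (hcomm (V - V') δ hVd) hQ.norm_le
  have e3 := hprod hPn (hcomm V' _ hVn) hQd
  have herr : ‖(P - P') * ((V * X - X * V) * Q) +
      P' * (((V - V') * X - X * (V - V')) * Q) + P' * ((V' * X - X * V') * (Q - Q'))‖ ≤
      2 * K * (1 + K + K ^ 2) * m ^ 3 * Real.exp (-(η * Ω / 2)) := by
    refine (norm_add₃_le.trans (add_le_add (add_le_add e1 e2) e3)).trans ?_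
    have h1 : m ≤ m ^ 3 := le_self_pow₀ hm (by norm_num)
    have h2 : m ^ 2 ≤ m ^ 3 := pow_le_pow_right₀ hm (by norm_num)
    have hx := (Real.exp_pos (-(η * Ω / 2))).le
    calc _ = 2 * K * Real.exp (-(η * Ω / 2)) * (m + K * m ^ 2 + K ^ 2 * m ^ 3) := by
          rw [hδ]; ring
      _ ≤ 2 * K * Real.exp (-(η * Ω / 2)) * (m ^ 3 + K * m ^ 3 + K ^ 2 * m ^ 3) := by gcongr
      _ = _ := by ring
  have hmain : ‖(P' * (V' * X - X * V') * Q' * gexp U e (-1)).trace‖ ≤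
      4 * k ^ 2 * (windowCost + 2 * Real.exp (1 / 8)) * m ^ 3 * Real.exp (-(η * Ω / 2)) := by
    rw [trace_commutator_eq_twistTrace]
    -- `τ = e^{-6Ω}` is the square root of the order `e^{-12Ω}` of the Dirichlet form
    refine (norm_twistTrace_trunc_le U e hV X _ hΩ (Real.exp_pos (-(6 * Ω)))).trans ?_
    have hb : ∀ (a : ℝ), |a| = 1 / 4 → ∀ O : Matrix n n ℂ, ‖O‖ ≤ 1 →
        ‖bohr U e (fun ν => Complex.exp ((a : ℂ) * ν)) (trunc U e Ω O)‖ ≤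
          2 * Ω * Real.exp (Ω / 4) * k := fun a ha O hO => by
      refine (norm_bohr_exp_trunc_le (by rw [ha]; norm_num) hO hΩ).trans (le_of_eq ?_)
      rw [ha]; congr 3; ring
    have hlow : ‖low U e P'‖ ≤ 2 * Ω * Real.exp (Ω / 4) * k := by
      have := hb (-(1 / 4)) (by norm_num) P hP.norm_le
      push_cast at this
      exact this
    have hhigh : ‖high U e Q'‖ ≤ 2 * Ω * Real.exp (Ω / 4) * k := by
      have := hb (1 / 4) (by norm_num) Q hQ.norm_le
      push_cast at this
      exact this
    have hR : hs (high U e Q' * gexp U e (-(1 / 2)) * low U e P') ≤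
        (2 * Ω * Real.exp (Ω / 4) * k) * (2 * Ω * Real.exp (Ω / 4) * k) := by
      refine (hs_mul_le' _ _).trans (mul_le_mul ((hs_mul_le _ _).trans ?_) hlow (norm_nonneg _)
        (by positivity))
      rw [hs_gexp_half U e hZ, mul_one]
      exact hhigh
    have hΩe : Ω ≤ Real.exp Ω := by linarith [Real.add_one_le_exp Ω]
    have hdiv : dirichlet U e V (gexp U e (-(1 / 4)) * X * gexp U e (-(1 / 4))) /
        (2 * Real.exp (-(6 * Ω))) ≤ 2 * Real.exp (1 / 8) * Real.exp (-(6 * Ω)) := by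
      rw [div_le_iff₀ (by positivity)]
      refine hD.trans (le_of_eq ?_)
      rw [show -(12 * Ω) = -(6 * Ω) + -(6 * Ω) by ring, Real.exp_add]
      ring
    have hexp1 : 1 ≤ Real.exp (Ω + Ω / 2) := Real.one_le_exp (by linarith)
    calc _ ≤ ((2 * Ω * Real.exp (Ω / 4) * k) * (2 * Ω * Real.exp (Ω / 4) * k)) *
          (Real.exp (-(6 * Ω)) * windowCost * Ω * Real.exp (Ω / 2) +
            2 * Real.exp (1 / 8) * Real.exp (-(6 * Ω))) := by
          refine mul_le_mul hR (add_le_add le_rfl hdiv) (add_nonneg (by positivity)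
            (div_nonneg (dirichlet_nonneg _ _ _ _) (by positivity))) (by positivity)
      _ ≤ ((2 * Real.exp Ω * Real.exp (Ω / 4) * k) * (2 * Real.exp Ω * Real.exp (Ω / 4) * k)) *
          (Real.exp (-(6 * Ω)) * windowCost * Real.exp Ω * Real.exp (Ω / 2) +
            2 * Real.exp (1 / 8) * Real.exp (-(6 * Ω)) * Real.exp (Ω + Ω / 2)) := by
          have h9 : 2 * Real.exp (1 / 8) * Real.exp (-(6 * Ω)) ≤
              2 * Real.exp (1 / 8) * Real.exp (-(6 * Ω)) * Real.exp (Ω + Ω / 2) :=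
            le_mul_of_one_le_right (by positivity) hexp1
          refine mul_le_mul ?_ (add_le_add ?_ h9) (by positivity) (by positivity)
          · gcongr
          · gcongr
      _ = 4 * k ^ 2 * (windowCost + 2 * Real.exp (1 / 8)) * 1 *
          (Real.exp Ω * Real.exp (Ω / 4) * Real.exp Ω * Real.exp (Ω / 4) * Real.exp (-(6 * Ω)) *
            Real.exp Ω * Real.exp (Ω / 2)) := by
          rw [Real.exp_add]; ring
      _ ≤ 4 * k ^ 2 * (windowCost + 2 * Real.exp (1 / 8)) * m ^ 3 * Real.exp (-(η * Ω / 2)) := by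
          gcongr
          · exact one_le_pow₀ hm
          -- the exponents add up to `-2Ω`, and `η ≤ 1`
          · simp only [← Real.exp_add]
            refine Real.exp_le_exp.2 ?_
            nlinarith
  rw [hsplit, add_mul, Matrix.trace_add]
  refine (norm_add_le _ _).trans ((add_le_add ((norm_trace_mul_gibbs_le U e hZ _).trans herr)
    hmain).trans (le_of_eq ?_))
  rw [commConst]
  ring

end Commutator

/-! ### Stationarity and the Dirichlet form of a time average -/

section Average

open MeasureTheory

variable {n : Type*} [Fintype n] [DecidableEq n] (U : Matrix.unitaryGroup n ℂ) (e : n → ℝ)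

theorem norm_one_clm_le : ‖(1 : Matrix n n ℂ →L[ℂ] Matrix n n ℂ)‖ ≤ 1 :=
  ContinuousLinearMap.norm_id_le

/-- A functional that annihilates the range of the generator is invariant under the time average. -/
theorem clm_avgExp_eq {𝔸 : Type*} [NormedRing 𝔸] [NormedAlgebra ℂ 𝔸] [CompleteSpace 𝔸] {L : 𝔸}
    {Φ : 𝔸 →L[ℂ] ℂ} (h : ∀ T, Φ (L * T) = 0) {t : ℝ} (ht : 0 < t) : Φ (avgExp L t) = Φ 1 := by
  have h1 : ∀ s : ℝ, Φ (NormedSpace.exp ((s : ℂ) • L)) = Φ 1 := fun s => by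
    rcases eq_or_ne s 0 with rfl | hs
    · rw [Complex.ofReal_zero, zero_smul, NormedSpace.exp_zero]
    · have h3 := h (avgExp L s)
      rw [mul_avgExp, map_smul, map_sub, smul_eq_mul, mul_eq_zero, sub_eq_zero] at h3
      exact h3.resolve_left (by simpa using hs)
  rw [avgExp, map_smul, ← ContinuousLinearMap.intervalIntegral_comp_comm Φ
    ((continuous_exp_real_smul L).intervalIntegrable 0 t)]
  simp only [h1]
  rw [intervalIntegral.integral_const, sub_zero, Complex.real_smul, smul_eq_mul, ← mul_assoc,
    ← Complex.ofReal_mul, one_div_mul_cancel ht.ne', Complex.ofReal_one, one_mul]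

variable {ι : Type*} (J : Finset ι) (V : ι → Matrix n n ℂ)

theorem dissipative_sum_jumpDual : Dissipative (∑ k ∈ J, jumpDual U e (V k)) :=
  Dissipative.sum norm_one_clm_le _ fun _ _ => dissipative_jumpDual _ _ _

variable {J V}

/-- The Gibbs state is stationary for the time average. -/
theorem trace_avgExp_gibbs (hV : ∀ k ∈ J, (V k).IsHermitian) {t : ℝ} (ht : 0 < t)
    (X : Matrix n n ℂ) :
    (avgExp (∑ k ∈ J, jumpDual U e (V k)) t X * gexp U e (-1)).trace =
      (X * gexp U e (-1)).trace := by
  obtain ⟨Φ, hΦ⟩ : ∃ Φ : (Matrix n n ℂ →L[ℂ] Matrix n n ℂ) →L[ℂ] ℂ,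
      ∀ T, Φ T = (T X * gexp U e (-1)).trace :=
    ⟨traceCLM ∘L (ContinuousLinearMap.mul ℂ (Matrix n n ℂ)).flip (gexp U e (-1)) ∘L
      ContinuousLinearMap.apply ℂ (Matrix n n ℂ) X, fun T => rfl⟩
  have h := clm_avgExp_eq (𝔸 := Matrix n n ℂ →L[ℂ] Matrix n n ℂ)
    (L := ∑ k ∈ J, jumpDual U e (V k)) (Φ := Φ) (fun T => ?_) ht
  · rwa [hΦ, hΦ] at h
  · rw [hΦ, mul_apply_eq_comp, sum_apply, Finset.sum_mul, Matrix.trace_sum]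
    exact Finset.sum_eq_zero fun k hk => trace_jumpDual_gibbs U e (hV k hk) _

/-- Time averaging up to `t` makes the Dirichlet forms of all jumps `O(1/t)`. -/
theorem dirichlet_avgExp_le (hZ : (gexp U e (-1)).trace = 1) (hV : ∀ k ∈ J, (V k).IsHermitian)
    {t : ℝ} (ht : 0 < t) {X : Matrix n n ℂ} (hX : ‖X‖ ≤ 1) {k : ι} (hk : k ∈ J) :
    dirichlet U e (V k) (gexp U e (-(1 / 4)) * avgExp (∑ k ∈ J, jumpDual U e (V k)) t X *
      gexp U e (-(1 / 4))) ≤ 4 * Real.exp (1 / 8) * (1 / t) := by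
  set L := ∑ k ∈ J, jumpDual U e (V k) with hL
  set Y := avgExp L t X with hY
  set y := gexp U e (-(1 / 4)) * Y * gexp U e (-(1 / 4)) with hy
  have hdis := dissipative_sum_jumpDual U e J V
  have h1 : ∑ k ∈ J, Real.exp (-(1 / 8)) * dirichlet U e (V k) y =
      -2 * (Yᴴ * gexp U e (-(1 / 2)) * L Y * gexp U e (-(1 / 2))).trace.re := by
    rw [hL, sum_apply, Finset.mul_sum, Finset.sum_mul, Matrix.trace_sum, Complex.re_sum,
      Finset.mul_sum]
    exact Finset.sum_congr rfl fun k hk => dirichlet_eq U e (hV k hk) Y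
  have h2 : Real.exp (-(1 / 8)) * dirichlet U e (V k) y ≤
      ∑ k ∈ J, Real.exp (-(1 / 8)) * dirichlet U e (V k) y :=
    Finset.single_le_sum (f := fun k => Real.exp (-(1 / 8)) * dirichlet U e (V k) y)
      (fun k _ => mul_nonneg (Real.exp_pos _).le (dirichlet_nonneg U e _ _)) hk
  have hYn : ‖Y‖ ≤ 1 := by
    refine ((avgExp L t).le_opNorm X).trans ?_
    exact mul_le_one₀ (norm_avgExp_le norm_one_clm_le hdis ht) (norm_nonneg _) hX
  have hLY : L Y = ((1 / t : ℝ) : ℂ) • (NormedSpace.exp ((t : ℂ) • L) X - X) := by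
    have := mul_avgExp (𝔸 := Matrix n n ℂ →L[ℂ] Matrix n n ℂ) L t
    have h3 := congrArg (fun T : Matrix n n ℂ →L[ℂ] Matrix n n ℂ => T X) this
    exact h3
  have hLn : ‖L Y‖ ≤ 2 * (1 / t) := by
    rw [hLY, norm_smul, Complex.norm_real, Real.norm_of_nonneg (by positivity), mul_comm]
    gcongr
    refine (norm_sub_le _ _).trans ?_
    have h4 : ‖NormedSpace.exp ((t : ℂ) • L) X‖ ≤ 1 :=
      ((NormedSpace.exp ((t : ℂ) • L)).le_opNorm X).trans
        (mul_le_one₀ (hdis.norm_exp_le norm_one_clm_le ht.le) (norm_nonneg _) hX)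
    linarith
  have h5 : ‖(Yᴴ * gexp U e (-(1 / 2)) * L Y * gexp U e (-(1 / 2))).trace‖ ≤ 2 * (1 / t) := by
    refine (norm_trace_mul_gexp_le U e hZ _ _).trans ?_
    rw [Matrix.l2_opNorm_conjTranspose]
    exact (mul_le_of_le_one_left (norm_nonneg _) hYn).trans hLn
  have h6 := (Complex.abs_re_le_norm _).trans h5
  have h7 := (abs_le.1 h6).1
  have h8 : Real.exp (-(1 / 8)) * dirichlet U e (V k) y ≤ 4 * (1 / t) := by linarith
  rw [Real.exp_neg, inv_mul_le_iff₀ (Real.exp_pos _)] at h8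
  linarith

end Average

/-! ### Depolarizing a region by Pauli twirls -/

section Twirl

variable {Λ : Type} [Fintype Λ] [DecidableEq Λ]

theorem resetRegion_empty (O : Op Λ) : resetRegion ∅ O = O := by
  ext x y
  rw [resetRegion, Matrix.of_apply, if_pos (by simp), Finset.card_empty, pow_zero, inv_one, one_mul,
    Fintype.sum_unique]
  rfl

omit [Fintype Λ] in
theorem sum_glue_insert {i : Λ} {A : Finset Λ} (hi : i ∉ A) (f : (Λ → Fin 2) → (Λ → Fin 2) → ℂ)
    (x y : Λ → Fin 2) :
    ∑ v : ↥(insert i A) → Fin 2, f (glue (insert i A) v x) (glue (insert i A) v y) =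
      ∑ a, ∑ u : A → Fin 2, f (glue A u (Function.update x i a)) (glue A u (Function.update y i a)) := by
  rw [← Fintype.sum_prod_type']
  let g : (↥(insert i A) → Fin 2) ≃ Fin 2 × (A → Fin 2) :=
    { toFun := fun v => (v ⟨i, Finset.mem_insert_self i A⟩,
        fun j => v ⟨j, Finset.mem_insert_of_mem j.2⟩)
      invFun := fun p j => if h : (j : Λ) ∈ A then p.2 ⟨j, h⟩ else p.1
      left_inv := fun v => by
        funext j
        by_cases h : (j : Λ) ∈ A
        · simp [h]
        · obtain ⟨j, hj⟩ := j
          obtain rfl : j = i := (Finset.mem_insert.1 hj).resolve_right h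
          simp [hi]
      right_inv := fun p => by
        ext j
        · simp [hi]
        · simp }
  have hg : ∀ (v : ↥(insert i A) → Fin 2) (z : Λ → Fin 2),
      glue (insert i A) v z = glue A (g v).2 (Function.update z i (g v).1) := fun v z => by
    funext j
    by_cases h : j ∈ A
    · simp [glue, h, g]
    · by_cases hji : j = i
      · subst hji; simp [glue, hi, g]
      · simp [glue, h, hji]
  exact Fintype.sum_equiv g _ (fun p => f (glue A p.2 (Function.update x i p.1))
    (glue A p.2 (Function.update y i p.1))) fun v => by rw [hg, hg]

/-- The identity and the three Pauli matrices. -/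
def pauliOne : Fin 4 → Matrix (Fin 2) (Fin 2) ℂ := Fin.cons 1 pauli

/-- The Pauli matrices and the identity form an orthogonal basis of the two-by-two matrices. -/
theorem sum_pauliOne (p q a b : Fin 2) :
    ∑ k, pauliOne k p a * pauliOne k b q = if p = q ∧ a = b then 2 else 0 := by
  rw [Fin.sum_univ_succ]
  have h0 : pauli 0 = !![0, 1; 1, 0] := rfl
  have h1 : pauli 1 = !![0, -Complex.I; Complex.I, 0] := rfl
  have h2 : pauli 2 = !![1, 0; 0, -1] := rfl
  simp only [pauliOne, Fin.cons_zero, Fin.cons_succ, Fin.sum_univ_three, h0, h1, h2]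
  fin_cases p <;> fin_cases q <;> fin_cases a <;> fin_cases b <;>
    norm_num [Matrix.one_apply]

/-- Depolarizing one more qubit is averaging over conjugations by the Paulis of this qubit. -/
theorem resetRegion_insert {i : Λ} {A : Finset Λ} (hi : i ∉ A) (O : Op Λ) :
    resetRegion (insert i A) O = (1 / 4 : ℂ) •
      ∑ k, siteOp i (pauliOne k) * resetRegion A O * siteOp i (pauliOne k) := by
  ext x y
  have h1 : (∑ k, siteOp i (pauliOne k) * resetRegion A O * siteOp i (pauliOne k)) x y =
      if x i = y i then 2 * ∑ a, resetRegion A O (Function.update x i a) (Function.update y i a)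
      else 0 := by
    rw [Matrix.sum_apply]
    have h2 : ∀ k, (siteOp i (pauliOne k) * resetRegion A O * siteOp i (pauliOne k)) x y =
        ∑ b, ∑ a, pauliOne k (x i) a * pauliOne k b (y i) *
          resetRegion A O (Function.update x i a) (Function.update y i b) := fun k => by
      rw [mul_siteOp_apply]
      refine Finset.sum_congr rfl fun b _ => ?_
      rw [siteOp_mul_apply, Finset.sum_mul]
      exact Finset.sum_congr rfl fun a _ => by ring
    simp only [h2]
    rw [Finset.sum_comm]
    have h3 : ∀ b, ∑ k, ∑ a, pauliOne k (x i) a * pauliOne k b (y i) *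
          resetRegion A O (Function.update x i a) (Function.update y i b) =
        if x i = y i then 2 * resetRegion A O (Function.update x i b) (Function.update y i b)
          else 0 := fun b => by
      rw [Finset.sum_comm]
      simp only [← Finset.sum_mul, sum_pauliOne]
      split_ifs with h <;> simp [h]
    simp only [h3]
    split_ifs
    · rw [Finset.mul_sum]
    · simp
  rw [Matrix.smul_apply, h1]
  have h4 : ∀ a, (∀ j ∈ A, Function.update x i a j = Function.update y i a j) ↔
      ∀ j ∈ A, x j = y j := fun a => forall₂_congr fun j hj => by
    have : j ≠ i := fun h => hi (h ▸ hj)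
    rw [Function.update_of_ne this, Function.update_of_ne this]
  simp only [resetRegion, Matrix.of_apply, h4, Finset.forall_mem_insert]
  by_cases hx : x i = y i
  · by_cases hA : ∀ j ∈ A, x j = y j
    · rw [if_pos ⟨hx, hA⟩, if_pos hx, sum_glue_insert hi (fun z w => O z w)]
      simp only [if_pos hA]
      rw [Finset.card_insert_of_notMem hi, ← Finset.mul_sum, smul_eq_mul, pow_succ, mul_inv]
      ring
    · rw [if_neg fun h => hA h.2, if_pos hx]
      simp [hA]
  · rw [if_neg fun h => hx h.1, if_neg hx, smul_zero]

theorem trace_mul_resetRegion_insert {i : Λ} {A : Finset Λ} (hi : i ∉ A) (M O : Op Λ) :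
    (M * resetRegion (insert i A) O).trace = (1 / 4 : ℂ) *
      ∑ k, (siteOp i (pauliOne k) * M * siteOp i (pauliOne k) * resetRegion A O).trace := by
  rw [resetRegion_insert hi, Matrix.mul_smul, Matrix.trace_smul, smul_eq_mul, Finset.mul_sum,
    Matrix.trace_sum]
  congr 1
  refine Finset.sum_congr rfl fun k _ => ?_
  rw [← mul_assoc, Matrix.trace_mul_comm]
  simp only [mul_assoc]

theorem norm_quarter_sum_le {f : Fin 4 → ℂ} {c : ℝ} (h : ∀ k, ‖f k‖ ≤ c) :
    ‖(1 / 4 : ℂ) * ∑ k, f k‖ ≤ c := by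
  have h1 : ‖∑ k, f k‖ ≤ 4 * c := by
    refine (norm_sum_le _ _).trans ((Finset.sum_le_card_nsmul _ _ _ fun k _ => h k).trans ?_)
    simp
  rw [norm_mul]
  have h2 : ‖(1 / 4 : ℂ)‖ = 1 / 4 := by norm_num
  rw [h2]
  linarith

variable {U : Matrix.unitaryGroup (Λ → Fin 2) ℂ} {e : (Λ → Fin 2) → ℝ} {η : ℝ}

theorem tame_siteOp_pauliOne (h : ∀ i a, Tame U e η 2 (siteOp (Λ := Λ) i (pauli a))) (i : Λ)
    (k : Fin 4) : Tame U e η 2 (siteOp i (pauliOne k)) := by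
  refine Fin.cases ?_ (fun a => ?_) k
  · have h1 : siteOp i (pauliOne 0) = 1 := siteOp_one i
    rw [h1]
    exact tame_one.mono one_le_two
  · exact h i a

/-- Expectations in a depolarized state are averages of expectations of conjugated operators. -/
theorem norm_trace_mul_resetRegion_le (h : ∀ i a, Tame U e η 2 (siteOp (Λ := Λ) i (pauli a)))
    (O : Op Λ) {c : ℝ} (A : Finset Λ) (M : Op Λ)
    (hM : ∀ P P', Tame U e η (2 ^ A.card) P → Tame U e η (2 ^ A.card) P' →
      ‖(P * M * P' * O).trace‖ ≤ c) : ‖(M * resetRegion A O).trace‖ ≤ c := by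
  induction A using Finset.induction_on generalizing M with
  | empty =>
    have := hM 1 1 (by simpa using tame_one) (by simpa using tame_one)
    rwa [one_mul, mul_one, ← resetRegion_empty O] at this
  | insert i A hi ih =>
    rw [trace_mul_resetRegion_insert hi]
    refine norm_quarter_sum_le fun k => ih _ fun P P' hP hP' => ?_
    have hk := tame_siteOp_pauliOne h i k
    have h1 := hM (P * siteOp i (pauliOne k)) (siteOp i (pauliOne k) * P')
      (by rw [Finset.card_insert_of_notMem hi, pow_succ]; exact hP.mul hk)
      (by rw [Finset.card_insert_of_notMem hi, pow_succ']; exact hk.mul hP')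
    simpa only [mul_assoc] using h1

/-- An operator that almost commutes with the Paulis of a region, in the sense of expectations in
the state `O`, has almost the same expectation after depolarizing the region. -/
theorem norm_trace_resetRegion_sub_le (h : ∀ i a, Tame U e η 2 (siteOp (Λ := Λ) i (pauli a)))
    (O X : Op Λ) {c : ℝ} (hc : 0 ≤ c) (A : Finset Λ)
    (hX : ∀ i ∈ A, ∀ a P P', Tame U e η (2 ^ A.card) P → Tame U e η (2 ^ A.card) P' →
      ‖(P * (siteOp i (pauli a) * X - X * siteOp i (pauli a)) * P' * O).trace‖ ≤ c)
    (B : Finset Λ) (hB : B ⊆ A) :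
    ‖(X * resetRegion B O).trace - (X * O).trace‖ ≤ B.card * c := by
  induction B using Finset.induction_on with
  | empty => simp [resetRegion_empty]
  | insert i B hi ih =>
    have hiA : i ∈ A := hB (Finset.mem_insert_self i B)
    have hcard : B.card + 1 ≤ A.card := by
      rw [← Finset.card_insert_of_notMem hi]; exact Finset.card_le_card hB
    have hstep : ‖(X * resetRegion (insert i B) O).trace - (X * resetRegion B O).trace‖ ≤ c := by
      have h1 : (X * resetRegion (insert i B) O).trace - (X * resetRegion B O).trace =
          (1 / 4 : ℂ) * ∑ k, ((siteOp i (pauliOne k) * X * siteOp i (pauliOne k) - X) *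
            resetRegion B O).trace := by
        rw [trace_mul_resetRegion_insert hi]
        simp only [sub_mul, Matrix.trace_sub, Finset.sum_sub_distrib, mul_sub]
        simp
      rw [h1]
      refine norm_quarter_sum_le fun k => ?_
      refine Fin.cases ?_ (fun a => ?_) k
      · have h2 : siteOp i (pauliOne 0) = 1 := siteOp_one i
        rw [h2]
        simpa using hc
      · have h3 : siteOp i (pauliOne a.succ) = siteOp i (pauli a) := rfl
        have h4 : siteOp i (pauli a) * siteOp i (pauli a) = 1 := by
          rw [siteOp_mul, pauli_mul_self, siteOp_one]
        have h5 : siteOp i (pauli a) * X * siteOp i (pauli a) - X =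
            (siteOp i (pauli a) * X - X * siteOp i (pauli a)) * siteOp i (pauli a) := by
          rw [sub_mul, mul_assoc X, h4, mul_one]
        rw [h3, h5]
        refine norm_trace_mul_resetRegion_le h O B _ fun P P' hP hP' => ?_
        have hpow : ∀ k ≤ A.card, (2 : ℝ) ^ k ≤ 2 ^ A.card := fun k hk =>
          pow_le_pow_right₀ one_le_two hk
        have h6 := hX i hiA a P (siteOp i (pauli a) * P') (hP.mono (hpow _ (by omega)))
          (((h i a).mul hP').mono (by rw [← pow_succ']; exact hpow _ hcard))
        simpa only [mul_assoc] using h6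
    rw [Finset.card_insert_of_notMem hi]
    have h7 := ih ((Finset.subset_insert i B).trans hB)
    calc _ = ‖((X * resetRegion (insert i B) O).trace - (X * resetRegion B O).trace) +
          ((X * resetRegion B O).trace - (X * O).trace)‖ := by rw [sub_add_sub_cancel]
      _ ≤ c + B.card * c := (norm_add_le _ _).trans (add_le_add hstep h7)
      _ = _ := by push_cast; ring

end Twirl

/-! ### The global recovery estimate -/

section Recovery

variable {n : Type*} [Fintype n] [DecidableEq n] (U : Matrix.unitaryGroup n ℂ) (e : n → ℝ)

theorem bohr_add_const (c : ℝ) : bohr U (fun i => e i + c) = bohr U e := by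
  funext φ
  ext1 O
  exact eq_of_rot U fun i j => by simp

theorem jumpDual_add_const (c : ℝ) (V : Matrix n n ℂ) :
    jumpDual U (fun i => e i + c) V = jumpDual U e V := by
  simp only [jumpDual, effOp, decay, freqComp, heis, bohr_add_const]

theorem gexp_add_const (c : ℝ) :
    gexp U (fun i => e i + c) (-1) = (Real.exp (-c) : ℂ) • gexp U e (-1) :=
  eq_of_rot U fun i j => by
    rw [rot_smul, rot_gexp, rot_gexp, Matrix.smul_apply, Matrix.diagonal_apply,
      Matrix.diagonal_apply]
    split_ifs
    · push_cast
      rw [smul_eq_mul, ← Complex.exp_add]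
      congr 1
      ring
    · rw [smul_zero]

theorem trace_gexp_neg_one : (gexp U e (-1)).trace = ((∑ i, Real.exp (-e i) : ℝ) : ℂ) := by
  rw [← trace_rot U, rot_gexp, Matrix.trace_diagonal]
  push_cast
  simp

/-- A shift of the energies normalizes the Gibbs weights. -/
theorem exists_trace_gexp_eq_one [Nonempty n] : ∃ c : ℝ,
    (gexp U (fun i => e i + c) (-1)).trace = 1 ∧
      gexp U (fun i => e i + c) (-1) = (gexp U e (-1)).trace⁻¹ • gexp U e (-1) := by
  have hZ : 0 < ∑ i, Real.exp (-e i) :=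
    Finset.sum_pos (fun i _ => Real.exp_pos _) Finset.univ_nonempty
  refine ⟨Real.log (∑ i, Real.exp (-e i)), ?_⟩
  have h : gexp U (fun i => e i + Real.log (∑ i, Real.exp (-e i))) (-1) =
      (gexp U e (-1)).trace⁻¹ • gexp U e (-1) := by
    rw [gexp_add_const, Real.exp_neg, Real.exp_log hZ, trace_gexp_neg_one]
    push_cast
    rfl
  refine ⟨?_, h⟩
  rw [h, Matrix.trace_smul, smul_eq_mul, inv_mul_cancel₀]
  rw [trace_gexp_neg_one]
  exact_mod_cast hZ.ne'

end Recovery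

section Recovery

/-- A short imaginary time over which local operators stay bounded under the evolution by a
Hamiltonian of interaction degree `d` at inverse temperature `β`. -/
def imagTime (β : ℝ) (d : ℕ) : ℝ := min 1 (1 / (4 * d * β))

theorem imagTime_pos {β : ℝ} {d : ℕ} (hβ : 0 < β) (hd : 1 ≤ d) : 0 < imagTime β d := by
  have : (0 : ℝ) < d := by exact_mod_cast hd
  exact lt_min one_pos (by positivity)

theorem imagTime_le_one (β : ℝ) (d : ℕ) : imagTime β d ≤ 1 := min_le_left _ _

variable {Λ Γ : Type} [Fintype Λ] [DecidableEq Λ] [Fintype Γ] (I : LocalHamiltonian Λ Γ)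

/-- The Gibbs state has an eigenbasis `U` and normalized energies `e` in which it is `e^{-K}`; in
this description single-qubit Paulis are tame and the dual recovery map is a time average. -/
theorem LocalHamiltonian.exists_normalized {β : ℝ} {d : ℕ} (hβ : 0 < β) (hd1 : 1 ≤ d)
    (hd : I.DegreeLE d) : ∃ (U : Matrix.unitaryGroup (Λ → Fin 2) ℂ) (e : (Λ → Fin 2) → ℝ),
      gibbs I.ham β = gexp U e (-1) ∧ (gexp U e (-1)).trace = 1 ∧
      (∀ i a, Tame U e (imagTime β d) 2 (siteOp i (pauli a))) ∧
      ∀ A t, superDual (I.recovery β A t) =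
        avgExp (∑ p ∈ A ×ˢ (Finset.univ : Finset (Fin 3)),
          jumpDual U e (siteOp p.1 (pauli p.2))) t := by
  set U := I.ham_isHermitian.eigenvectorUnitary with hU
  obtain ⟨c, hc1, hc2⟩ := exists_trace_gexp_eq_one U (fun j => β * I.ham_isHermitian.eigenvalues j)
  refine ⟨U, fun j => β * I.ham_isHermitian.eigenvalues j + c, ?_, hc1, fun i a => ?_, fun A t => ?_⟩
  · rw [hc2, gibbs_eq_gexp I.ham_isHermitian]
  · have hpos := imagTime_pos hβ hd1
    have hdb : (0 : ℝ) < 4 * d * β := by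
      have : (0 : ℝ) < d := by exact_mod_cast hd1
      positivity
    have hle : imagTime β d ≤ 1 / (4 * d * β) := min_le_right _ _
    rw [le_div_iff₀ hdb] at hle
    have hn := norm_siteOp_pauli_le (Λ := Λ) i a
    have hz : ∀ z : ℝ, |z| = imagTime β d →
        ‖bohr U (fun j => β * I.ham_isHermitian.eigenvalues j + c)
          (fun ν => Complex.exp (z * ν)) (siteOp i (pauli a))‖ ≤ 2 := fun z hz => by
      rw [bohr_add_const]
      refine (I.norm_bohr_exp_le hd hβ (by rw [hz]; nlinarith) (actsOn_siteOp i _)).trans ?_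
      linarith
    exact ⟨hn, hz _ (abs_of_pos hpos), hz _ (by rw [abs_neg, abs_of_pos hpos])⟩
  · rw [LocalHamiltonian.recovery, superDual_timeAverage _ _ _ hβ, regionDual,
      ← Finset.sum_product' A Finset.univ fun i a => jumpDual U
        (fun j => β * I.ham_isHermitian.eigenvalues j) (siteOp i (pauli a))]
    simp only [jumpDual_add_const]

/-- The recovery map restores the Gibbs state with an error that decays with a power of the time. -/
theorem recoveryBound {β : ℝ} {d : ℕ} (hβ : 0 < β) (hd1 : 1 ≤ d) :
    RecoveryBound β d (2 + commConst (imagTime β d)) (1 + Real.log 8) (imagTime β d / 24) := by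
  intro Λ Γ _ _ _ I hd A t ht
  obtain ⟨U, e, hρ, hZ, htame, hrec⟩ := I.exists_normalized hβ hd1 hd
  set η := imagTime β d with hη
  have hη0 : 0 < η := imagTime_pos hβ hd1
  have hη1 : η ≤ 1 := imagTime_le_one β d
  set L := ∑ p ∈ A ×ˢ (Finset.univ : Finset (Fin 3)), jumpDual U e (siteOp p.1 (pauli p.2)) with hL
  have hherm : ∀ p ∈ A ×ˢ (Finset.univ : Finset (Fin 3)),
      (siteOp p.1 (pauli p.2) : Op Λ).IsHermitian := fun p _ => by
    rw [Matrix.IsHermitian, siteOp_conjTranspose, pauli_conjTranspose]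
  have hC := commConst_nonneg η
  have hlog8 : 0 < Real.log 8 := Real.log_pos (by norm_num)
  have hexp : 1 ≤ Real.exp ((1 + Real.log 8) * A.card) := Real.one_le_exp (by positivity)
  refine traceNorm_le_of_forall fun X hX => ?_
  rw [mul_sub, Matrix.trace_sub, ← trace_superDual_mul, hrec]
  have hdis : Dissipative L := dissipative_sum_jumpDual U e _ _
  have hXt : ‖avgExp L t X‖ ≤ 1 :=
    ((avgExp L t).le_opNorm X).trans
      (mul_le_one₀ (norm_avgExp_le norm_one_clm_le hdis ht) (norm_nonneg _) hX)
  rw [hρ, ← trace_avgExp_gibbs U e hherm ht X, ← hL]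
  rcases le_total t 1 with ht1 | ht1
  -- at short times the right-hand side exceeds the trivial bound `2`
  · have h1 : ‖(avgExp L t X * resetRegion A (gexp U e (-1))).trace‖ ≤ 1 := by
      refine norm_trace_mul_resetRegion_le htame _ A _ fun P P' hP hP' => ?_
      refine (norm_trace_mul_gibbs_le U e hZ _).trans ?_
      refine (norm_mul_le _ _).trans (mul_le_one₀ ?_ (norm_nonneg _) hP'.norm_le)
      exact (norm_mul_le _ _).trans (mul_le_one₀ hP.norm_le (norm_nonneg _) hXt)
    have h2 : ‖(avgExp L t X * gexp U e (-1)).trace‖ ≤ 1 :=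
      (norm_trace_mul_gibbs_le U e hZ _).trans hXt
    have h3 : 1 ≤ t ^ (-(η / 24)) :=
      Real.one_le_rpow_of_pos_of_le_one_of_nonpos ht ht1 (by linarith)
    calc _ ≤ (2 : ℝ) * 1 * 1 := (norm_sub_le _ _).trans (by linarith)
      _ ≤ _ := by gcongr; linarith
  -- this cutoff makes the Dirichlet form, of order `1/t`, equal to `e^{-12Ω}`
  · set Ω := Real.log t / 12 with hΩ
    have hΩ0 : 0 ≤ Ω := div_nonneg (Real.log_nonneg ht1) (by norm_num)
    have h1 : Real.exp (-(12 * Ω)) = 1 / t := by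
      rw [hΩ, mul_div_cancel₀ _ (by norm_num), Real.exp_neg, Real.exp_log ht, one_div]
    have h2 : Real.exp (-(η * Ω / 2)) = t ^ (-(η / 24)) := by
      rw [Real.rpow_def_of_pos ht, hΩ]
      congr 1
      ring
    have h3 := norm_trace_resetRegion_sub_le htame (gexp U e (-1)) (avgExp L t X)
      (c := commConst η * (2 ^ A.card) ^ 3 * Real.exp (-(η * Ω / 2))) (by positivity) A
      (fun i hi a P P' hP hP' => by
        have hcard : 1 ≤ A.card := Finset.card_pos.2 ⟨i, hi⟩
        have hp : (i, a) ∈ A ×ˢ (Finset.univ : Finset (Fin 3)) :=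
          Finset.mem_product.2 ⟨hi, Finset.mem_univ a⟩
        exact norm_trace_commutator_le hZ hη0 hη1 (one_le_pow₀ one_le_two) (hherm (i, a) hp)
          ((htame i a).mono (le_self_pow₀ one_le_two (by omega))) hP hP' hXt hΩ0
          (by rw [h1]; exact dirichlet_avgExp_le U e hZ hherm ht hX hp)) A subset_rfl
    refine h3.trans ?_
    rw [h2]
    -- `|A| 8^{|A|} ≤ e^{(1 + log 8)|A|}`
    have h4 : (A.card : ℝ) * (2 ^ A.card) ^ 3 ≤ Real.exp ((1 + Real.log 8) * A.card) := by
      have h5 : ((2 : ℝ) ^ A.card) ^ 3 = Real.exp (Real.log 8 * A.card) := by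
        rw [mul_comm, Real.exp_nat_mul, Real.exp_log (by norm_num), ← pow_mul, mul_comm, pow_mul]
        norm_num
      rw [h5, add_mul, one_mul, Real.exp_add]
      gcongr
      linarith [Real.add_one_le_exp (A.card : ℝ)]
    calc _ = commConst η * ((A.card : ℝ) * (2 ^ A.card) ^ 3) * t ^ (-(η / 24)) := by ring
      _ ≤ (2 + commConst η) * Real.exp ((1 + Real.log 8) * A.card) * t ^ (-(η / 24)) := by
        gcongr
        linarith

theorem traceNorm_gibbs_le {β : ℝ} {d : ℕ} (hβ : 0 < β) (hd1 : 1 ≤ d) (hd : I.DegreeLE d) :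
    traceNorm (gibbs I.ham β) ≤ 1 := by
  obtain ⟨U, e, hρ, hZ, -, -⟩ := I.exists_normalized hβ hd1 hd
  refine traceNorm_le_of_forall fun X hX => ?_
  rw [hρ]
  exact (norm_trace_mul_gibbs_le U e hZ _).trans hX

/-- By the twirl representation, an expectation in the depolarized state is an average of
expectations in the Gibbs state. -/
theorem traceNorm_resetRegion_gibbs_le {β : ℝ} {d : ℕ} (hβ : 0 < β) (hd1 : 1 ≤ d)
    (hd : I.DegreeLE d) (A : Finset Λ) : traceNorm (resetRegion A (gibbs I.ham β)) ≤ 1 := by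
  obtain ⟨U, e, hρ, hZ, htame, -⟩ := I.exists_normalized hβ hd1 hd
  refine traceNorm_le_of_forall fun X hX => ?_
  rw [hρ]
  refine norm_trace_mul_resetRegion_le htame _ A _ fun P P' hP hP' => ?_
  refine (norm_trace_mul_gibbs_le U e hZ _).trans ?_
  refine (norm_mul_le _ _).trans (mul_le_one₀ ?_ (norm_nonneg _) hP'.norm_le)
  exact (norm_mul_le _ _).trans (mul_le_one₀ hP.norm_le (norm_nonneg _) hX)

end Recovery

/-! ### The local recovery estimate -/

section LocalRecovery

variable {Λ Γ : Type} [Fintype Λ] [DecidableEq Λ] [Fintype Γ] (I : LocalHamiltonian Λ Γ)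

theorem traceNorm_sub_le (O O' : Op Λ) : traceNorm (O - O') ≤ traceNorm O + traceNorm O' := by
  rw [sub_eq_add_neg, ← traceNorm_neg O']
  exact traceNorm_add_le O (-O')

/-- At the time `t` the global error `r e^{μ|A|} t^{-λ}` and the localization error, of order
`|A| t e^{-mℓ}`, are of the same size. -/
theorem LocalHamiltonian.traceNorm_gibbs_sub_localRecovery_le {β : ℝ} {d : ℕ} (hβ : 0 < β)
    (hd1 : 1 ≤ d) (hd : I.DegreeLE d) {r μ lam : ℝ} (hr : 1 ≤ r) (hlam : 0 < lam) (hlam1 : lam < 1)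
    (hR : RecoveryBound β d r μ lam) {m : ℝ}
    (hm : m = min (Real.log 2) (1 / (8 * Real.exp 1) / (d * β))) (A : Finset Λ) (ℓ : ℕ) {t : ℝ}
    (ht : t = Real.exp ((μ * A.card + m * ℓ) / (lam + 1))) :
    traceNorm (gibbs I.ham β - I.localRecovery β A t ℓ (resetRegion A (gibbs I.ham β))) ≤
      (2 + 24 * jumpConst) *
        (r * Real.exp (((μ + 2) * A.card - m * lam * ℓ) / 2)) := by
  have ht0 : 0 < t := ht ▸ Real.exp_pos _
  have hJ := jumpConst_nonneg
  set ρ := gibbs I.ham β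
  set σ := resetRegion A ρ
  have hσ : traceNorm σ ≤ 1 := traceNorm_resetRegion_gibbs_le I hβ hd1 hd A
  have hρ : traceNorm ρ ≤ 1 := traceNorm_gibbs_le I hβ hd1 hd
  rcases le_total (μ * A.card) (lam * m * ℓ) with hle | hle
  · have h1 : traceNorm (ρ - I.localRecovery β A t ℓ σ) ≤
        r * Real.exp (μ * A.card) * t ^ (-lam) + 12 * jumpConst * (A.card * t *
          (Real.exp (-(1 / (8 * Real.exp 1) * (ℓ / (d * β)))) + 1 / 2 ^ ℓ)) := by
      have h2 := hR Λ Γ I hd A t ht0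
      have h3 := (traceNorm_apply_le (I.localRecovery β A t ℓ - I.recovery β A t) σ).trans
        (mul_le_of_le_one_right (norm_nonneg _) hσ)
      have h4 := h3.trans (I.norm_superDual_localRecovery_sub_le ℓ hd hd1 hβ ht0)
      have h5 : ρ - I.localRecovery β A t ℓ σ = -(I.recovery β A t σ - ρ) -
          (I.localRecovery β A t ℓ - I.recovery β A t) σ := by
        rw [sub_apply]; abel
      rw [h5]
      refine (traceNorm_sub_le _ _).trans (add_le_add ?_ h4)
      rw [traceNorm_neg]
      exact h2
    have hexp1 : Real.exp (-(1 / (8 * Real.exp 1) * (ℓ / (d * β)))) ≤ Real.exp (-(m * ℓ)) := by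
      have : m ≤ 1 / (8 * Real.exp 1) / (d * β) := hm ▸ min_le_right _ _
      refine Real.exp_le_exp.2 (neg_le_neg ?_)
      calc m * ℓ ≤ 1 / (8 * Real.exp 1) / (d * β) * ℓ := by gcongr
        _ = _ := by ring
    have hexp2 : 1 / 2 ^ ℓ ≤ Real.exp (-(m * ℓ)) := by
      have : m ≤ Real.log 2 := hm ▸ min_le_left _ _
      have h6 : (1 : ℝ) / 2 ^ ℓ = Real.exp (-(Real.log 2 * ℓ)) := by
        rw [Real.exp_neg, mul_comm, Real.exp_nat_mul, Real.exp_log two_pos, one_div]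
      rw [h6]
      gcongr
    set E := (μ * A.card - lam * m * ℓ) / (lam + 1) with hE
    have hl : lam + 1 ≠ 0 := by linarith
    have hE1 : Real.exp (μ * A.card) * t ^ (-lam) = Real.exp E := by
      rw [ht, ← Real.exp_mul, ← Real.exp_add, hE]
      congr 1
      field_simp
      ring
    have hE2 : t * Real.exp (-(m * ℓ)) = Real.exp E := by
      rw [ht, ← Real.exp_add, hE]
      congr 1
      field_simp
      ring
    -- the exponent `E` is nonpositive and `λ + 1 ≤ 2`
    have hE3 : E ≤ (μ * A.card - lam * m * ℓ) / 2 := by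
      rw [hE, div_le_div_iff₀ (by linarith) two_pos]
      nlinarith
    have hA : (A.card : ℝ) ≤ Real.exp A.card := by linarith [Real.add_one_le_exp (A.card : ℝ)]
    have hA1 : 1 ≤ Real.exp (A.card : ℝ) := Real.one_le_exp (by positivity)
    calc _ ≤ r * Real.exp (μ * A.card) * t ^ (-lam) + 12 * jumpConst * (A.card * t *
          (Real.exp (-(m * ℓ)) + Real.exp (-(m * ℓ)))) := h1.trans (by gcongr)
      _ = (r + 24 * jumpConst * A.card) * Real.exp E := by
        rw [mul_assoc r, hE1, ← two_mul, ← hE2]; ring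
      _ ≤ (r * Real.exp A.card + 24 * jumpConst * (r * Real.exp A.card)) *
          Real.exp ((μ * A.card - lam * m * ℓ) / 2) := by
        gcongr
        · exact le_mul_of_one_le_right (by linarith) hA1
        · exact hA.trans (le_mul_of_one_le_left (Real.exp_pos _).le hr)
      _ = (1 + 24 * jumpConst) * (r * Real.exp (((μ + 2) * A.card - m * lam * ℓ) / 2)) := by
        rw [show ((μ + 2) * A.card - m * lam * ℓ) / 2 =
          A.card + (μ * A.card - lam * m * ℓ) / 2 by ring, Real.exp_add]
        ring
      _ ≤ _ := by gcongr; norm_num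
  -- here the right-hand side exceeds the trivial bound `2`
  · have h1 : traceNorm (I.localRecovery β A t ℓ σ) ≤ 1 :=
      (traceNorm_timeAverage_le _ β A hβ ht0 σ).trans hσ
    have h2 : 1 ≤ Real.exp (((μ + 2) * A.card - m * lam * ℓ) / 2) :=
      Real.one_le_exp (by nlinarith [Nat.cast_nonneg (α := ℝ) A.card])
    calc _ ≤ (2 + 0) * (1 * 1) := (traceNorm_sub_le _ _).trans (by linarith)
      _ ≤ _ := by gcongr; positivity

end LocalRecovery

end QGibbs

end

theorem mainTheorem2 :
    ∃ c' : ℝ, 0 < c' ∧ ∃ C : ℝ, 0 < C ∧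
      ∀ (β : ℝ) (d : ℕ), 0 < β → 1 ≤ d →
        (∀ (Λ Γ : Type) [Fintype Λ] [DecidableEq Λ] [Fintype Γ]
            (I : QGibbs.LocalHamiltonian Λ Γ), I.DegreeLE d →
          ∀ (A : Finset Λ) (t : ℝ) (ℓ : ℕ), 0 < t →
            QGibbs.SuperActsOn (I.neighborhood A ℓ) (I.localRecovery β A t ℓ) ∧
            QGibbs.superNormOne (I.localRecovery β A t ℓ - I.recovery β A t) ≤
              ENNReal.ofReal
                (C * (A.card * t * (Real.exp (-(c' * (ℓ / (d * β)))) + 1 / 2 ^ ℓ)))) ∧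
        (∃ r μ lam : ℝ, 1 ≤ r ∧ 0 < μ ∧ 0 < lam ∧ lam < 1 ∧
          QGibbs.RecoveryBound β d r μ lam) ∧
        (∀ r μ lam : ℝ, 1 ≤ r → 0 < μ → 0 < lam → lam < 1 → QGibbs.RecoveryBound β d r μ lam →
          ∀ (m : ℝ), m = min (Real.log 2) (c' / (d * β)) →
          ∀ (Λ Γ : Type) [Fintype Λ] [DecidableEq Λ] [Fintype Γ]
            (I : QGibbs.LocalHamiltonian Λ Γ), I.DegreeLE d →
          ∀ (A : Finset Λ) (ℓ : ℕ) (t : ℝ),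
            t = Real.exp ((μ * A.card + m * ℓ) / (lam + 1)) →
            QGibbs.traceNorm (QGibbs.gibbs I.ham β -
                I.localRecovery β A t ℓ (QGibbs.resetRegion A (QGibbs.gibbs I.ham β))) ≤
              C * (r * Real.exp (((μ + 2) * A.card - m * lam * ℓ) / 2))) := by
  have hJ := QGibbs.jumpConst_nonneg
  refine ⟨1 / (8 * Real.exp 1), by positivity, 2 + 24 * QGibbs.jumpConst, by positivity,
    fun β d hβ hd1 => ⟨?_, ?_, ?_⟩⟩
  · intro Λ Γ _ _ _ I hd A t ℓ ht
    refine ⟨I.superActsOn_localRecovery A ℓ hβ t, (QGibbs.superNormOne_le _).trans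
      (ENNReal.ofReal_le_ofReal
        ((I.norm_superDual_localRecovery_sub_le ℓ hd hd1 hβ ht).trans ?_))⟩
    have h : (0 : ℝ) ≤ A.card * t *
        (Real.exp (-(1 / (8 * Real.exp 1) * (ℓ / (d * β)))) + 1 / 2 ^ ℓ) := by positivity
    exact mul_le_mul_of_nonneg_right (by linarith) h
  · have hC := QGibbs.commConst_nonneg (QGibbs.imagTime β d)
    have hlog8 : 0 < Real.log 8 := Real.log_pos (by norm_num)
    have hη := QGibbs.imagTime_pos hβ hd1
    have hη1 := QGibbs.imagTime_le_one β d
    exact ⟨_, _, _, by linarith, by linarith, by linarith, by linarith,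
      QGibbs.recoveryBound hβ hd1⟩
  · intro r μ lam hr _ hlam hlam1 hR m hm Λ Γ _ _ _ I hd A ℓ t ht
    exact I.traceNorm_gibbs_sub_localRecovery_le hβ hd1 hd hr hlam hlam1 hR hm A ℓ ht
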